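/- Let $X$ be a proper Gromov-hyperbolic metric space (four-point condition), and let $G=\mathrm{Isom}(X)$ with the compact-open topology. Assume that $G$ acts non-elementarily on $X$ (its limit set in the Gromov boundary has at least three points) and that its elliptic radical, i.e. its maximal compact normal subgroup, is trivial. Let $U\subset G$ be the set of hyperbolic isometries (those whose orbit maps $n\mapsto\gamma^n x$ are quasi-isometric embeddings of $\mathbb Z$). Fix a Haar measure $dg$ on $G$ and, for each $\gamma\in G$, a Haar measure $dh$ on its centraliser $G_\gamma$. If $G$ contains a lattice and $\gamma\in U$, let $dx$ be the $G$-invariant measure on $G/G_\gamma$ such that $dg=dx\,dh$, and for a non-negative continuous compactly supported function $f$ on $G$ put $$\mathcal O_f(\gamma)=\int_{G/G_\gamma} f(x\gamma x^{-1})\,dx .$$ For a lattice $\Gamma\subset G$ and $\gamma\in\Gamma$ let $\Gamma_\gamma=\Gamma\cap G_\gamma$, and let $\mu_\Gamma$ be the invariant random subgroup of $\Gamma$, i.e. the push-forward of the $G$-invariant probability measure on $G/\Gamma$ under $g\Gamma\mapsto g\Gamma g^{-1}$, a probability measure on the space $\mathrm{Sub}_G$ of closed subgroups of $G$ with the Chabauty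 topology. Let $(\Gamma_n)_{n\in\mathbb N}$ be a sequence of lattices in $G$ such that for every continuous compactly supported $f:G\to[0,\infty)$ $$\lim_{n\to+\infty}\frac{\sum_{[\gamma]_{\Gamma_n}\subset U}\operatorname{vol}\big((\Gamma_n)_\gamma\backslash G_\gamma\big)\,\mathcal O_f(\gamma)}{\operatorname{vol}(\Gamma_n\backslash G)}=0,$$ where the sum is over the $\Gamma_n$-conjugacy classes of hyperbolic elements $\gamma\in\Gamma_n$ (the quotients are elements of $[0,\infty]$). Then $\mu_{\Gamma_n}$ converges weakly-* to $\delta_{\{1\}}$, and $\Gamma_n\backslash X$ converges to $X$ in the Benjamini–Schramm sense: for every $o\in X$ the random pointed metric spaces $(\Gamma_n\backslash X,\Gamma_n g^{-1}o)$, with $g\Gamma_n$ distributed according to the $G$-invariant probability measure on $G/\Gamma_n$, converge in law to the pointed space $(X,o)$ for the pointed Gromov–Hausdorff topology. -/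

import Mathlib

open MeasureTheory Filter Topology
open scoped ENNReal NNReal CompactlySupported

noncomputable section

/-! ### The isometry group of a proper metric space as a topological group -/

namespace IsometryEquiv

variable {X : Type*} [MetricSpace X]

/-- An isometry as a continuous map. -/
def toContinuousMap (g : X ≃ᵢ X) : C(X, X) := ⟨g, g.continuous⟩

@[simp] theorem toContinuousMap_apply (g : X ≃ᵢ X) (x : X) : g.toContinuousMap x = g x := rfl

/-- The compact-open topology on `Isom(X)`. -/
instance instTopologicalSpace : TopologicalSpace (X ≃ᵢ X) :=
  TopologicalSpace.induced toContinuousMap inferInstance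

/-- The Borel σ-algebra on `Isom(X)`. -/
instance instMeasurableSpace : MeasurableSpace (X ≃ᵢ X) := borel _

instance instBorelSpace : BorelSpace (X ≃ᵢ X) := ⟨rfl⟩

/-- The tautological action of `Isom(X)` on `X`. -/
instance instMulAction : MulAction (X ≃ᵢ X) X where
  smul g x := g x
  one_smul _ := rfl
  mul_smul _ _ _ := rfl

theorem smul_def (g : X ≃ᵢ X) (x : X) : g • x = g x := rfl

theorem continuous_toContinuousMap :
    Continuous (toContinuousMap : (X ≃ᵢ X) → C(X, X)) := continuous_induced_dom

theorem toContinuousMap_injective :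
    Function.Injective (toContinuousMap : (X ≃ᵢ X) → C(X, X)) := fun _ _ e =>
  IsometryEquiv.ext fun x => DFunLike.congr_fun e x

instance instT2Space : T2Space (X ≃ᵢ X) :=
  T2Space.of_injective_continuous toContinuousMap_injective continuous_toContinuousMap

instance instIsTopologicalGroup [ProperSpace X] : IsTopologicalGroup (X ≃ᵢ X) where
  continuous_mul := by
    refine continuous_induced_rng.2 ?_
    have : (toContinuousMap ∘ fun p : (X ≃ᵢ X) × (X ≃ᵢ X) => p.1 * p.2) =
        fun p => p.1.toContinuousMap.comp p.2.toContinuousMap := rfl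
    rw [this]
    exact (continuous_toContinuousMap.comp continuous_fst).compCM
      (continuous_toContinuousMap.comp continuous_snd)
  continuous_inv := by
    refine continuous_induced_rng.2 (continuous_iff_continuousAt.2 fun g₀ => ?_)
    rw [ContinuousAt, ContinuousMap.tendsto_iff_forall_isCompact_tendstoUniformlyOn]
    intro K hK
    have h := (continuous_toContinuousMap (X := X)).continuousAt (x := g₀)
    rw [ContinuousAt, ContinuousMap.tendsto_iff_forall_isCompact_tendstoUniformlyOn] at h
    have h' := h ((g₀⁻¹ : X ≃ᵢ X) '' K) (hK.image (g₀⁻¹ : X ≃ᵢ X).continuous)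
    rw [Metric.tendstoUniformlyOn_iff] at h' ⊢
    intro ε hε
    filter_upwards [h' ε hε] with g hg x hx
    have := hg (g₀⁻¹ x) ⟨x, hx, rfl⟩
    simp only [toContinuousMap_apply, apply_inv_self] at this
    calc dist (g₀⁻¹ x) (g⁻¹ x) = dist (g (g₀⁻¹ x)) (g (g⁻¹ x)) := (g.dist_eq _ _).symm
      _ = dist x (g (g₀⁻¹ x)) := by rw [apply_inv_self, dist_comm]
      _ < ε := this

end IsometryEquiv

/-! ### Gromov hyperbolicity -/

section Hyperbolic

variable (X : Type*) [MetricSpace X]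

/-- Gromov hyperbolicity (four-point condition). -/
def IsGromovHyperbolic : Prop :=
  ∃ δ : ℝ, ∀ x y z w : X,
    dist x y + dist z w ≤ max (dist x z + dist y w) (dist x w + dist y z) + 2 * δ

variable {X}

/-- The Gromov product `(x | y)_o`. -/
def gromovProduct (o x y : X) : ℝ := (dist x o + dist y o - dist x y) / 2

/-- The sequence `u` converges to a point of the Gromov boundary: `(u i | u j)_o → ∞`
as `i, j → ∞`. -/
def ConvergesAtInfinity (o : X) (u : ℕ → X) : Prop :=
  Tendsto (fun p : ℕ × ℕ => gromovProduct o (u p.1) (u p.2)) atTop atTop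

/-- Two sequences converging at infinity define the same point of the Gromov boundary:
`(u i | v j)_o → ∞` as `i, j → ∞`. -/
def SameBoundaryPoint (o : X) (u v : ℕ → X) : Prop :=
  Tendsto (fun p : ℕ × ℕ => gromovProduct o (u p.1) (v p.2)) atTop atTop

variable (X) in
/-- The action of `Isom(X)` on `X` is non-elementary: its limit set (the set of points of the
Gromov boundary which are limits of sequences in an orbit) has at least three points. -/
def IsNonElementary : Prop :=
  ∃ (o : X) (a : Fin 3 → ℕ → (X ≃ᵢ X)),
    (∀ i, ConvergesAtInfinity o fun n => a i n o) ∧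
    ∀ i j, i ≠ j → ¬ SameBoundaryPoint o (fun n => a i n o) (fun n => a j n o)

/-- Hyperbolic isometries: the orbit maps `n ↦ γ ^ n x` are quasi-isometric embeddings of `ℤ`.
(The upper bound `dist x (γ ^ n x) ≤ |n| * dist x (γ x)` is automatic.) -/
def IsHyperbolicIsometry (γ : X ≃ᵢ X) : Prop :=
  ∀ x : X, ∃ c > 0, ∃ C : ℝ, ∀ n : ℤ, c * |(n : ℝ)| - C ≤ dist x ((γ ^ n) x)

variable (X) in
/-- The elliptic radical of `Isom(X)`: the subgroup generated by all compact normal subgroups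
(the maximal compact normal subgroup when the action is non-elementary). -/
def ellipticRadical : Subgroup (X ≃ᵢ X) :=
  sSup {N | N.Normal ∧ IsCompact (N : Set (X ≃ᵢ X))}

end Hyperbolic

/-! ### The Chabauty space and the invariant random subgroup of a lattice -/

section Chabauty

variable {G : Type*} [Group G] [TopologicalSpace G]

/-- The Chabauty topology on the set of closed subgroups, generated by the sets
`{H | H ∩ U ≠ ∅}` with `U` open and `{H | H ∩ K = ∅}` with `K` compact. -/
instance chabautyTopology : TopologicalSpace (ClosedSubgroup G) :=
  TopologicalSpace.generateFrom
    ({S | ∃ U : Set G, IsOpen U ∧ S = {H | ((H.toSubgroup : Set G) ∩ U).Nonempty}} ∪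
     {S | ∃ K : Set G, IsCompact K ∧ S = {H | (H.toSubgroup : Set G) ∩ K = ∅}})

instance chabautyMeasurableSpace : MeasurableSpace (ClosedSubgroup G) := borel _

instance chabautyBorelSpace : BorelSpace (ClosedSubgroup G) := ⟨rfl⟩

/-- The trivial subgroup as a closed subgroup. -/
def trivialClosedSubgroup (G : Type*) [Group G] [TopologicalSpace G] [T1Space G] :
    ClosedSubgroup G :=
  ⟨⊥, isClosed_singleton⟩

variable [IsTopologicalGroup G]

/-- The closed subgroup `g H g⁻¹`. -/
def conjClosedSubgroup (H : ClosedSubgroup G) (g : G) : ClosedSubgroup G :=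
  ⟨H.toSubgroup.map (MulAut.conj g).toMonoidHom, by
    have h : ((H.toSubgroup.map (MulAut.conj g).toMonoidHom : Subgroup G) : Set G) =
        (fun x => g⁻¹ * x * g) ⁻¹' (H.toSubgroup : Set G) := by
      ext x
      constructor
      · rintro ⟨y, hy, rfl⟩
        simpa [mul_assoc] using hy
      · intro hx
        exact ⟨g⁻¹ * x * g, hx, by simp [mul_assoc]⟩
    change IsClosed ((H.toSubgroup.map (MulAut.conj g).toMonoidHom : Subgroup G) : Set G)
    rw [h]
    exact H.isClosed'.preimage (by fun_prop)⟩

theorem mem_conjClosedSubgroup {H : ClosedSubgroup G} {g x : G} :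
    x ∈ (conjClosedSubgroup H g).toSubgroup ↔ g⁻¹ * x * g ∈ H.toSubgroup := by
  constructor
  · rintro ⟨y, hy, rfl⟩
    simpa [mul_assoc] using hy
  · intro hx
    exact ⟨g⁻¹ * x * g, hx, by simp [mul_assoc]⟩

theorem continuous_conjClosedSubgroup (H : ClosedSubgroup G) :
    Continuous (conjClosedSubgroup H) := by
  refine continuous_generateFrom_iff.2 ?_
  rintro S (⟨U, hU, rfl⟩ | ⟨K, hK, rfl⟩)
  · have h : conjClosedSubgroup H ⁻¹' {H | ((H.toSubgroup : Set G) ∩ U).Nonempty} =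
        ⋃ y ∈ H.toSubgroup, (fun g : G => g * y * g⁻¹) ⁻¹' U := by
      ext g
      simp only [Set.mem_preimage, Set.mem_ofPred_eq, Set.mem_iUnion]
      constructor
      · rintro ⟨x, hx, hxU⟩
        exact ⟨g⁻¹ * x * g, mem_conjClosedSubgroup.1 hx, by simpa [mul_assoc] using hxU⟩
      · rintro ⟨y, hy, hyU⟩
        exact ⟨g * y * g⁻¹, mem_conjClosedSubgroup.2 (by simpa [mul_assoc] using hy), hyU⟩
    rw [h]
    exact isOpen_biUnion fun y _ => hU.preimage (by fun_prop)
  · have h : conjClosedSubgroup H ⁻¹' {H | (H.toSubgroup : Set G) ∩ K = ∅} =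
        (Prod.fst '' {p : G × K | p.1⁻¹ * (p.2 : G) * p.1 ∈ (H.toSubgroup : Set G)})ᶜ := by
      ext g
      simp only [Set.mem_preimage, Set.mem_ofPred_eq, Set.eq_empty_iff_forall_notMem,
        Set.mem_compl_iff, Set.mem_image, Prod.exists, not_exists, Set.mem_inter_iff, not_and]
      constructor
      · rintro h a b hab rfl
        exact h b (mem_conjClosedSubgroup.2 hab) b.2
      · intro h x hx hxK
        exact h g ⟨x, hxK⟩ (mem_conjClosedSubgroup.1 hx) rfl
    rw [h, isOpen_compl_iff]
    have : CompactSpace K := isCompact_iff_compactSpace.1 hK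
    exact isClosedMap_fst_of_compactSpace _ (H.isClosed'.preimage (by fun_prop))

variable [T2Space G] [MeasurableSpace G]

/-- A lattice: a discrete subgroup `Γ` such that `G ⧸ Γ` carries a `G`-invariant
probability measure. -/
structure IsLattice (Γ : Subgroup G) : Prop where
  discrete : DiscreteTopology Γ
  exists_invariant : ∃ P : Measure (G ⧸ Γ), IsProbabilityMeasure P ∧ SMulInvariantMeasure G (G ⧸ Γ) P

namespace IsLattice

variable {Γ : Subgroup G}

/-- The (unique) `G`-invariant probability measure on `G ⧸ Γ`. -/
def invariantProbability (h : IsLattice Γ) : Measure (G ⧸ Γ) := h.exists_invariant.choose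

instance (h : IsLattice Γ) : IsProbabilityMeasure h.invariantProbability :=
  h.exists_invariant.choose_spec.1

/-- A lattice is closed, hence a point of the Chabauty space. -/
def toClosedSubgroup (h : IsLattice Γ) : ClosedSubgroup G :=
  ⟨Γ, by have := h.discrete; exact Subgroup.isClosed_of_discrete⟩

/-- The map `g Γ ↦ g Γ g⁻¹`. -/
def conjMap (h : IsLattice Γ) : G ⧸ Γ → ClosedSubgroup G :=
  Quotient.lift (conjClosedSubgroup h.toClosedSubgroup) (by
    intro a b hab
    have hab : a⁻¹ * b ∈ Γ := QuotientGroup.leftRel_apply.1 hab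
    have key : ∀ x, x ∈ (conjClosedSubgroup h.toClosedSubgroup a).toSubgroup ↔
        x ∈ (conjClosedSubgroup h.toClosedSubgroup b).toSubgroup := by
      intro x
      rw [mem_conjClosedSubgroup, mem_conjClosedSubgroup]
      change _ ∈ Γ ↔ _ ∈ Γ
      have e : b⁻¹ * x * b = (a⁻¹ * b)⁻¹ * (a⁻¹ * x * a) * (a⁻¹ * b) := by group
      rw [e, Γ.mul_mem_cancel_right hab, Γ.mul_mem_cancel_left (Γ.inv_mem hab)]
    cases hA : conjClosedSubgroup h.toClosedSubgroup a
    cases hB : conjClosedSubgroup h.toClosedSubgroup b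
    rw [hA, hB] at key
    congr 1
    exact Subgroup.ext key)

theorem measurable_conjMap [BorelSpace G] (h : IsLattice Γ) : Measurable h.conjMap :=
  measurable_from_quotient.2 (continuous_conjClosedSubgroup h.toClosedSubgroup).measurable

/-- The invariant random subgroup `μ_Γ`: the law of `g Γ g⁻¹` for `g Γ` random in `G ⧸ Γ`. -/
def irs [BorelSpace G] (h : IsLattice Γ) : ProbabilityMeasure (ClosedSubgroup G) :=
  ⟨h.invariantProbability.map h.conjMap,
    Measure.isProbabilityMeasure_map h.measurable_conjMap.aemeasurable⟩

end IsLattice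

/-- The trivial invariant random subgroup `δ_{1}`. -/
def trivialIRS (G : Type*) [Group G] [TopologicalSpace G] [T1Space G] :
    ProbabilityMeasure (ClosedSubgroup G) :=
  ⟨Measure.dirac (trivialClosedSubgroup G), inferInstance⟩

end Chabauty

/-! ### Quotient measures and orbital integrals -/

section OrbitalIntegral

variable {G : Type*} [Group G] [TopologicalSpace G] [MeasurableSpace G]

/-- `dμ = dν dη`: Weil's integration formula for the measure `μ` on `G`, the Haar measure `η` on
the subgroup `H` and the measure `ν` on `G ⧸ H`. (The inner integral depends only on the coset `x`,
by left invariance of `η`; left invariance of `ν` follows from that of `μ`.) -/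
def IsQuotientMeasure (μ : Measure G) {H : Subgroup G} (η : Measure H) (ν : Measure (G ⧸ H)) :
    Prop :=
  ∀ f : G → ℝ≥0∞, Measurable f →
    ∫⁻ g, f g ∂μ = ∫⁻ x : G ⧸ H, ∫⁻ h : H, f (x.out * h) ∂η ∂ν

open Classical in
/-- The invariant measure `dx` on `G ⧸ H` determined by `dμ = dx dη` (which exists and is unique
for `G` second countable locally compact, `H` closed, `G` and `H` unimodular). -/
def quotientMeasure (μ : Measure G) {H : Subgroup G} (η : Measure H) : Measure (G ⧸ H) :=
  if h : ∃ ν : Measure (G ⧸ H), IsQuotientMeasure μ η ν then h.choose else 0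

/-- The centraliser `G_γ`. -/
abbrev centraliser (γ : G) : Subgroup G := Subgroup.centralizer {γ}

/-- The orbital integral `O_f(γ) = ∫_{G / G_γ} f(x γ x⁻¹) dx` of a non-negative function `f`. -/
def orbitalIntegral (μ : Measure G) (γ : G) (η : Measure (centraliser γ)) (f : G → ℝ≥0∞) : ℝ≥0∞ :=
  ∫⁻ x : G ⧸ centraliser γ, f (x.out * γ * x.out⁻¹) ∂(quotientMeasure μ η)

/-- `vol(Γ_γ \ G_γ)`, where `Γ_γ = Γ ∩ G_γ`. -/
def centraliserCovolume (Γ : Subgroup G) (γ : G) (η : Measure (centraliser γ)) : ℝ≥0∞ :=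
  covolume (Γ.subgroupOf (centraliser γ)) (centraliser γ) η

/-- A representative in `G` of a conjugacy class of the subgroup `Γ`. -/
def classRep {Γ : Subgroup G} (c : ConjClasses Γ) : G :=
  ((Quotient.out (s := IsConj.setoid Γ) c : Γ) : G)

end OrbitalIntegral

/-- The sum of `vol(Γ_γ \ G_γ) O_f(γ)` over the `Γ`-conjugacy classes `[γ]_Γ` of hyperbolic
isometries in `Γ`; `η γ` is the Haar measure on `G_γ`. -/
def hyperbolicSum {X : Type*} [MetricSpace X] (μ : Measure (X ≃ᵢ X))
    (η : ∀ γ : X ≃ᵢ X, Measure (centraliser γ)) (Γ : Subgroup (X ≃ᵢ X)) (f : (X ≃ᵢ X) → ℝ≥0∞) :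
    ℝ≥0∞ :=
  ∑' c : {c : ConjClasses Γ // IsHyperbolicIsometry (classRep c)},
    centraliserCovolume Γ (classRep c.1) (η (classRep c.1)) *
      orbitalIntegral μ (classRep c.1) (η (classRep c.1)) f

/-! ### Quotient metric spaces and Benjamini–Schramm convergence -/

section BenjaminiSchramm

variable {X : Type*} [MetricSpace X]

/-- The quotient `Γ \ X`. -/
def QuotientSpace (Γ : Subgroup (X ≃ᵢ X)) : Type _ := MulAction.orbitRel.Quotient Γ X

namespace QuotientSpace

variable {Γ : Subgroup (X ≃ᵢ X)}

/-- The projection `X → Γ \ X`. -/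
def mk (Γ : Subgroup (X ≃ᵢ X)) (x : X) : QuotientSpace Γ :=
  Quotient.mk (MulAction.orbitRel Γ X) x

theorem mk_eq {x y : X} : mk Γ x = mk Γ y ↔ ∃ g ∈ Γ, g y = x := by
  refine Quotient.eq.trans ?_
  rw [MulAction.orbitRel_apply]
  constructor
  · rintro ⟨g, hg⟩
    exact ⟨g, g.2, hg⟩
  · rintro ⟨g, hg, h⟩
    exact ⟨⟨g, hg⟩, h⟩

theorem mk_surjective : Function.Surjective (mk Γ) := Quotient.mk_surjective

/-- The distance between two orbits. -/
def orbitDist (a b : QuotientSpace Γ) : ℝ :=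
  sInf {r | ∃ x y : X, mk Γ x = a ∧ mk Γ y = b ∧ r = dist x y}

theorem orbitDist_le (x y : X) : orbitDist (mk Γ x) (mk Γ y) ≤ dist x y :=
  csInf_le ⟨0, by rintro _ ⟨_, _, _, _, rfl⟩; exact dist_nonneg⟩ ⟨x, y, rfl, rfl, rfl⟩

theorem orbitDist_nonneg (a b : QuotientSpace Γ) : 0 ≤ orbitDist a b :=
  Real.sInf_nonneg (by rintro _ ⟨_, _, _, _, rfl⟩; exact dist_nonneg)

theorem exists_lt (x : X) (b : QuotientSpace Γ) {r : ℝ} (h : orbitDist (mk Γ x) b < r) :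
    ∃ y, mk Γ y = b ∧ dist x y < r := by
  obtain ⟨y₀, rfl⟩ := mk_surjective b
  obtain ⟨_, ⟨x', y, hx, hy, rfl⟩, hr⟩ :=
    exists_lt_of_csInf_lt (s := {r | ∃ x' y : X, mk Γ x' = mk Γ x ∧ mk Γ y = mk Γ y₀ ∧
      r = dist x' y}) ⟨dist x y₀, x, y₀, rfl, rfl, rfl⟩ h
  obtain ⟨g, hg, rfl⟩ := mk_eq.1 hx
  refine ⟨g⁻¹ y, ?_, ?_⟩
  · rw [← hy]
    exact mk_eq.2 ⟨g⁻¹, Γ.inv_mem hg, rfl⟩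
  · rw [← g.dist_eq, IsometryEquiv.apply_inv_self]
    exact hr

/-- The quotient (pseudo-)metric on `Γ \ X`; it is a metric when the orbits of `Γ` are closed, in
particular when `X` is proper and `Γ` is a discrete subgroup. -/
instance instPseudoMetricSpace : PseudoMetricSpace (QuotientSpace Γ) where
  dist := orbitDist
  dist_self a := by
    obtain ⟨x, rfl⟩ := mk_surjective a
    exact le_antisymm ((orbitDist_le x x).trans_eq (dist_self x)) (orbitDist_nonneg _ _)
  dist_comm a b := by
    change sInf _ = sInf _
    congr 1
    ext r
    constructor <;> rintro ⟨x, y, hx, hy, rfl⟩ <;> exact ⟨y, x, hy, hx, dist_comm _ _⟩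
  dist_triangle a b c := by
    refine le_of_forall_pos_le_add fun ε hε => ?_
    obtain ⟨x, rfl⟩ := mk_surjective a
    obtain ⟨y, rfl, hxy⟩ := exists_lt x b (lt_add_of_pos_right _ (half_pos hε))
    obtain ⟨z, rfl, hyz⟩ := exists_lt y c (lt_add_of_pos_right _ (half_pos hε))
    calc orbitDist (mk Γ x) (mk Γ z) ≤ dist x z := orbitDist_le x z
      _ ≤ dist x y + dist y z := dist_triangle _ _ _
      _ ≤ orbitDist (mk Γ x) (mk Γ y) + orbitDist (mk Γ y) (mk Γ z) + ε := by linarith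

theorem dist_def (a b : QuotientSpace Γ) : dist a b = orbitDist a b := rfl

end QuotientSpace

/-- The pointed space `(A, a)` lies in the basic pointed Gromov–Hausdorff neighbourhood of `(B, b)`
with parameters `R, ε`: there is an `ε`-isometry from the `R`-ball around `a` to `B` which maps `a`
to `b` and whose image is `ε`-dense in the `(R - ε)`-ball around `b`. -/
def PointedGHClose {A B : Type*} [PseudoMetricSpace A] [PseudoMetricSpace B]
    (R ε : ℝ) (a : A) (b : B) : Prop :=
  ∃ f : Metric.ball a R → B,
    (∀ p : Metric.ball a R, (p : A) = a → f p = b) ∧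
    (∀ p q : Metric.ball a R, |dist (f p) (f q) - dist (p : A) (q : A)| < ε) ∧
    ∀ y ∈ Metric.ball b (R - ε), ∃ p, dist (f p) y < ε

/-- The base point `Γ g⁻¹ o` of `Γ \ X` attached to `g Γ`; the pointed space `(Γ \ X, Γ g⁻¹ o)` is
isometric to `(gΓg⁻¹ \ X, gΓg⁻¹ o)`. -/
def cosetBasePoint {Γ : Subgroup (X ≃ᵢ X)} (o : X) : (X ≃ᵢ X) ⧸ Γ → QuotientSpace Γ :=
  Quotient.lift (fun g => QuotientSpace.mk Γ (g⁻¹ o)) (by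
    intro a b hab
    have hab : a⁻¹ * b ∈ Γ := QuotientGroup.leftRel_apply.1 hab
    exact QuotientSpace.mk_eq.2 ⟨a⁻¹ * b, hab, by
      simp only [IsometryEquiv.mul_apply, IsometryEquiv.apply_inv_self]⟩)

/-- Benjamini–Schramm convergence of `Γ n \ X` to `X`: for every base point `o`, the random pointed
metric spaces `(Γ n \ X, Γ n g⁻¹ o)`, with `g Γ n` distributed according to the invariant probability
measure, converge in law to the deterministic pointed space `(X, o)` for the pointed
Gromov–Hausdorff topology. The limit law being a Dirac mass, this means that every basic
neighbourhood of `(X, o)` has probability tending to `1`. -/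
def BenjaminiSchrammConverges [ProperSpace X] (Γ : ℕ → Subgroup (X ≃ᵢ X))
    (hΓ : ∀ n, IsLattice (Γ n)) : Prop :=
  ∀ (o : X) (R ε : ℝ), 0 < R → 0 < ε →
    Tendsto (fun n => (hΓ n).invariantProbability
      {x | ¬ PointedGHClose R ε (cosetBasePoint o x) o}) atTop (𝓝 0)

end BenjaminiSchramm

end

/-! Both conclusions reduce to one claim: for every compact K not containing 1, the probability that
a random conjugate gΓ_n g⁻¹ meets K tends to 0. In the Chabauty topology only such K restrict the
neighbourhoods of {1} (`tendsto_irs_of_tendsto_measure_hitSet`). For the geometric statement, K is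
the set of isometries which move the base point a bounded amount but visibly displace some point of
an R-ball (`benjaminiSchrammConverges_of_tendsto_measure_hitSet`). By compactness it is enough to
treat a neighbourhood V of one element k₀ ≠ 1.

The hypothesis sees only hyperbolic elements, whereas k₀ is arbitrary. Ping-pong bridges the gap:
for every m there are g_1, ..., g_m such that for i ≠ j any product of an element of g_i V g_i⁻¹
with one of g_j V g_j⁻¹ is hyperbolic (`exists_nhds_conj_isHyperbolicIsometry`). A random conjugate
which meets two of these sets therefore contains a hyperbolic element of a fixed compact set. That
event has probability at most the expected number of such elements, which unfolding bounds by the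
normalised sum τ_n of the hypothesis (`IsLattice.lintegral_tsum_conj_le`). By invariance all m sets
are met with the same probability P_n, and pairwise intersections have probability at most τ_n, so m
P_n ≤ 1 + m² τ_n. Letting n and then m tend to infinity gives P_n → 0.

To find the g_i, take a loxodromic a with ends a⁺ and a⁻. If k₀ fixed all translates of a⁺, it would
lie in a normal subgroup fixing three boundary points, whose closure is compact, against the
triviality of the radical. So up to conjugation k₀ moves a⁺. Conjugation by c_i a⁻ⁿ, with the points
c_i a⁻ pairwise distinct, then makes the displacements of V large and in independent directions.

This requires that no end of a be fixed by all of Isom(X). The lattice makes Isom(X) unimodular, and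
a unimodular group fixing a⁺ also fixes a⁻ (`IsLoxodromic.same_inv_of_forall_same`), which would
leave only two limit points. Unimodularity, also of the centralisers of hyperbolic elements, makes
the quotient measures exist. -/

set_option linter.unusedSectionVars false

/-! ### Gromov products -/

section GromovProduct

variable {X : Type*} [MetricSpace X] {δ : ℝ}

/-- The four-point condition with constant `δ`. -/
def FourPoint (X : Type*) [MetricSpace X] (δ : ℝ) : Prop :=
  ∀ x y z w : X,
    dist x y + dist z w ≤ max (dist x z + dist y w) (dist x w + dist y z) + 2 * δ

theorem FourPoint.nonneg (h : FourPoint X δ) (o : X) : 0 ≤ δ := by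
  have := h o o o o
  simp at this
  exact this

theorem gromovProduct_comm (o x y : X) : gromovProduct o x y = gromovProduct o y x := by
  unfold gromovProduct
  rw [dist_comm x y]
  ring

theorem gromovProduct_nonneg (o x y : X) : 0 ≤ gromovProduct o x y := by
  unfold gromovProduct
  linarith [dist_triangle_right x y o]

theorem gromovProduct_le_left (o x y : X) : gromovProduct o x y ≤ dist o x := by
  unfold gromovProduct
  linarith [dist_triangle y x o, dist_comm x y, dist_comm x o]

theorem gromovProduct_le_right (o x y : X) : gromovProduct o x y ≤ dist o y := by
  rw [gromovProduct_comm]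
  exact gromovProduct_le_left o y x

theorem gromovProduct_self (o x : X) : gromovProduct o x x = dist o x := by
  unfold gromovProduct
  rw [dist_self, dist_comm x o]
  ring

theorem gromovProduct_isometry (g : X ≃ᵢ X) (o x y : X) :
    gromovProduct (g o) (g x) (g y) = gromovProduct o x y := by
  simp only [gromovProduct, g.dist_eq]

theorem gromovProduct_le_add_dist_left (o x x' y : X) :
    gromovProduct o x y ≤ gromovProduct o x' y + dist x x' := by
  unfold gromovProduct
  linarith [dist_triangle x x' o, dist_triangle x' x y, dist_comm x x']

theorem gromovProduct_le_add_dist_right (o x y y' : X) :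
    gromovProduct o x y ≤ gromovProduct o x y' + dist y y' := by
  rw [gromovProduct_comm o x y, gromovProduct_comm o x y']
  exact gromovProduct_le_add_dist_left o y y' x

theorem gromovProduct_le_add_dist_base (o o' x y : X) :
    gromovProduct o x y ≤ gromovProduct o' x y + dist o o' := by
  unfold gromovProduct
  linarith [dist_triangle x o' o, dist_triangle y o' o, dist_comm o o']

theorem gromovProduct_isometry_ge (g : X ≃ᵢ X) (o x y : X) :
    gromovProduct o x y - dist o (g o) ≤ gromovProduct o (g x) (g y) := by
  have := gromovProduct_le_add_dist_base (g o) o (g x) (g y)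
  rw [gromovProduct_isometry, dist_comm] at this
  linarith

/-- The hyperbolic inequality for Gromov products. -/
theorem FourPoint.gromovProduct_or (h : FourPoint X δ) (o x y z : X) :
    gromovProduct o x z - δ ≤ gromovProduct o x y ∨
      gromovProduct o z y - δ ≤ gromovProduct o x y := by
  have := h x y z o
  unfold gromovProduct
  rcases le_max_iff.1 (show dist x y + dist z o - 2 * δ ≤ _ by linarith) with h1 | h1
  · left
    linarith
  · right
    linarith [dist_comm z y]

/-- Bounding a Gromov product by changing one of its arguments. -/
theorem FourPoint.le_of_lt (h : FourPoint X δ) {o x y z : X} {C : ℝ}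
    (hC : gromovProduct o x y ≤ C) (hz : C + δ < gromovProduct o x z) :
    gromovProduct o z y ≤ C + δ := by
  rcases h.gromovProduct_or o x y z with h1 | h1 <;> linarith

theorem FourPoint.le_of_lt₂ (h : FourPoint X δ) {o x y x' y' : X} {C : ℝ}
    (hC : gromovProduct o x y ≤ C) (hx : C + 2 * δ < gromovProduct o x x')
    (hy : C + 2 * δ < gromovProduct o y y') :
    gromovProduct o x' y' ≤ C + 2 * δ := by
  have hδ := h.nonneg o
  have h1 := h.le_of_lt hC (z := x') (by linarith)
  rw [gromovProduct_comm] at h1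
  have h2 := h.le_of_lt h1 (z := y') (by linarith)
  rw [gromovProduct_comm] at h2
  linarith

end GromovProduct

/-! ### Sequences converging at infinity -/

section Sequences

variable {X : Type*} [MetricSpace X] {δ : ℝ} {o : X} {u v w : ℕ → X}

theorem sameBoundaryPoint_iff :
    SameBoundaryPoint o u v ↔
      ∀ C : ℝ, ∃ N : ℕ, ∀ i ≥ N, ∀ j ≥ N, C ≤ gromovProduct o (u i) (v j) := by
  unfold SameBoundaryPoint
  rw [tendsto_atTop]
  refine forall_congr' fun C => ?_
  rw [eventually_atTop_prod_self]
  exact exists_congr fun N => ⟨fun h i hi j hj => h i j hi hj, fun h i j hi hj => h i hi j hj⟩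

theorem convergesAtInfinity_iff_same :
    ConvergesAtInfinity o u ↔ SameBoundaryPoint o u u := Iff.rfl

theorem SameBoundaryPoint.symm (h : SameBoundaryPoint o u v) : SameBoundaryPoint o v u := by
  rw [sameBoundaryPoint_iff] at h ⊢
  intro C
  obtain ⟨N, hN⟩ := h C
  exact ⟨N, fun i hi j hj => by rw [gromovProduct_comm]; exact hN j hj i hi⟩

theorem SameBoundaryPoint.trans (hX : FourPoint X δ) (h : SameBoundaryPoint o u v)
    (h' : SameBoundaryPoint o v w) : SameBoundaryPoint o u w := by
  rw [sameBoundaryPoint_iff] at h h' ⊢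
  intro C
  obtain ⟨N, hN⟩ := h (C + δ)
  obtain ⟨N', hN'⟩ := h' (C + δ)
  refine ⟨max N N', fun i hi j hj => ?_⟩
  have h1 := hN i (le_of_max_le_left hi) (max N N') (le_max_left _ _)
  have h2 := hN' (max N N') (le_max_right _ _) j (le_of_max_le_right hj)
  rcases hX.gromovProduct_or o (u i) (w j) (v (max N N')) with h3 | h3 <;> linarith

theorem SameBoundaryPoint.map (h : SameBoundaryPoint o u v) (g : X ≃ᵢ X) :
    SameBoundaryPoint o (g ∘ u) (g ∘ v) := by
  rw [sameBoundaryPoint_iff] at h ⊢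
  intro C
  obtain ⟨N, hN⟩ := h (C + dist o (g o))
  refine ⟨N, fun i hi j hj => ?_⟩
  have := gromovProduct_isometry_ge g o (u i) (v j)
  have := hN i hi j hj
  simp only [Function.comp_apply]
  linarith

theorem SameBoundaryPoint.of_map {g : X ≃ᵢ X} (h : SameBoundaryPoint o (g ∘ u) (g ∘ v)) :
    SameBoundaryPoint o u v := by
  have := h.map g⁻¹
  have e : ∀ s : ℕ → X, (g⁻¹ : X ≃ᵢ X) ∘ (g ∘ s) = s := fun s => by
    funext n
    exact g.inv_apply_self (s n)
  rwa [e, e] at this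

theorem SameBoundaryPoint.of_dist_le {C : ℝ} (hu : ConvergesAtInfinity o u)
    (h : ∀ n, dist (u n) (v n) ≤ C) : SameBoundaryPoint o u v := by
  rw [convergesAtInfinity_iff_same, sameBoundaryPoint_iff] at hu
  rw [sameBoundaryPoint_iff]
  intro D
  obtain ⟨N, hN⟩ := hu (D + C)
  refine ⟨N, fun i hi j hj => ?_⟩
  have := gromovProduct_le_add_dist_right o (u i) (u j) (v j)
  have := hN i hi j hj
  have := h j
  linarith

theorem ConvergesAtInfinity.map (h : ConvergesAtInfinity o u) (g : X ≃ᵢ X) :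
    ConvergesAtInfinity o (g ∘ u) := SameBoundaryPoint.map h g

theorem ConvergesAtInfinity.exists_dist_ge (h : ConvergesAtInfinity o u) (C : ℝ) :
    ∃ N : ℕ, ∀ i ≥ N, C ≤ dist o (u i) := by
  obtain ⟨N, hN⟩ := sameBoundaryPoint_iff.1 (convergesAtInfinity_iff_same.1 h) C
  exact ⟨N, fun i hi => by simpa [gromovProduct_self] using hN i hi i hi⟩

/-- Sequences with distinct limits have bounded Gromov products. -/
theorem exists_gromovProduct_le (hX : FourPoint X δ) (hu : ConvergesAtInfinity o u)
    (hv : ConvergesAtInfinity o v) (h : ¬ SameBoundaryPoint o u v) :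
    ∃ (C : ℝ) (N : ℕ), ∀ i ≥ N, ∀ j ≥ N, gromovProduct o (u i) (v j) ≤ C := by
  rw [sameBoundaryPoint_iff] at h
  rw [convergesAtInfinity_iff_same, sameBoundaryPoint_iff] at hu hv
  push Not at h
  obtain ⟨C, hC⟩ := h
  obtain ⟨N, hN⟩ := hu (C + 2 * δ + 1)
  obtain ⟨N', hN'⟩ := hv (C + 2 * δ + 1)
  refine ⟨C + 2 * δ, max N N', fun i hi j hj => ?_⟩
  obtain ⟨i₀, hi₀, j₀, hj₀, h₀⟩ := hC (max N N')
  have h1 := hN i₀ (le_of_max_le_left hi₀) i (le_of_max_le_left hi)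
  have h2 := hN' j₀ (le_of_max_le_right hj₀) j (le_of_max_le_right hj)
  exact hX.le_of_lt₂ h₀.le (by linarith) (by linarith)

end Sequences

/-! ### Loxodromic isometries -/

section Loxodromic

variable {X : Type*} [MetricSpace X] {δ : ℝ} {o : X} {a : X ≃ᵢ X} {B : ℝ}

/-- The orbit of `o` under the powers of `a` is a quasi-geodesic: the Gromov products of its two
ends are bounded by `B`, and it tends to infinity. -/
structure IsLoxodromic (o : X) (a : X ≃ᵢ X) (B : ℝ) : Prop where
  gromovProduct_le : ∀ m n : ℕ, gromovProduct o (((a ^ m)⁻¹ : X ≃ᵢ X) o) ((a ^ n) o) ≤ B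
  tendsto_dist : Tendsto (fun n : ℕ => dist o ((a ^ n) o)) atTop atTop

/-- The orbit ray `n ↦ aⁿ o`. -/
def orbitRay (o : X) (a : X ≃ᵢ X) (n : ℕ) : X := (a ^ n) o

theorem orbitRay_apply (o : X) (a : X ≃ᵢ X) (n : ℕ) : orbitRay o a n = (a ^ n) o := rfl

theorem orbitRay_inv_apply (o : X) (a : X ≃ᵢ X) (n : ℕ) :
    orbitRay o a⁻¹ n = ((a ^ n)⁻¹ : X ≃ᵢ X) o := by
  rw [orbitRay_apply, inv_pow]

theorem dist_inv_apply (g : X ≃ᵢ X) (x y : X) :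
    dist ((g⁻¹ : X ≃ᵢ X) x) y = dist x (g y) := by
  rw [← g.dist_eq, IsometryEquiv.apply_inv_self]

theorem dist_apply_inv (g : X ≃ᵢ X) (x y : X) :
    dist x ((g⁻¹ : X ≃ᵢ X) y) = dist (g x) y := by
  rw [dist_comm, dist_inv_apply, dist_comm]

theorem dist_self_inv_apply (g : X ≃ᵢ X) (o : X) :
    dist o ((g⁻¹ : X ≃ᵢ X) o) = dist o (g o) := by
  rw [dist_apply_inv, dist_comm]

theorem dist_mul_apply (g h : X ≃ᵢ X) (o : X) :
    dist o ((g * h) o) =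
      dist o (g o) + dist o (h o) - 2 * gromovProduct o ((g⁻¹ : X ≃ᵢ X) o) (h o) := by
  unfold gromovProduct
  rw [IsometryEquiv.mul_apply, dist_inv_apply, dist_inv_apply, dist_comm (h o) o]
  ring

theorem dist_mul_apply_le (g h : X ≃ᵢ X) (o : X) :
    dist o ((g * h) o) ≤ dist o (g o) + dist o (h o) := by
  have := dist_mul_apply g h o
  have := gromovProduct_nonneg o ((g⁻¹ : X ≃ᵢ X) o) (h o)
  linarith

theorem dist_pow_apply_le (o : X) (a : X ≃ᵢ X) (n : ℕ) :
    dist o ((a ^ n) o) ≤ n * dist o (a o) := by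
  induction n with
  | zero => simp
  | succ n ih =>
    rw [pow_succ]
    have := dist_mul_apply_le (a ^ n) a o
    push_cast
    linarith

/-- The displacement criterion: `d(o, a² o)` is much larger than `d(o, a o)`. -/
def HasLargeSquare (δ : ℝ) (o : X) (a : X ≃ᵢ X) : Prop :=
  dist o (a o) + (4 * δ + 1) ≤ dist o ((a * a) o)

namespace HasLargeSquare

theorem gromovProduct_eq (o : X) (a : X ≃ᵢ X) :
    gromovProduct o ((a⁻¹ : X ≃ᵢ X) o) (a o) = dist o (a o) - dist o ((a * a) o) / 2 := by
  have := dist_mul_apply a a o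
  linarith

theorem inv (h : HasLargeSquare δ o a) : HasLargeSquare δ o a⁻¹ := by
  unfold HasLargeSquare at h ⊢
  rwa [← mul_inv_rev, dist_self_inv_apply, dist_self_inv_apply]

/-- Local-to-global principle by induction. The second bound for n + 1 is the first one for n, since
(a o | a (aⁿ⁺¹ o)) equals d(o, a o) minus (a⁻¹ o | aⁿ⁺¹ o). It says that aⁿ⁺² o lies in the
direction of a o, so its product with a⁻¹ o exceeds that of a o by at most δ, which is the first
bound for n + 1. -/
theorem gromovProduct_pow_le (hX : FourPoint X δ) (h : HasLargeSquare δ o a) (n : ℕ) :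
    gromovProduct o ((a⁻¹ : X ≃ᵢ X) o) ((a ^ (n + 1)) o) ≤
        dist o (a o) - dist o ((a * a) o) / 2 + δ ∧
      gromovProduct o (a o) ((a ^ (n + 1)) o) ≥ (dist o (a o) + (4 * δ + 1)) / 2 - δ := by
  have hδ := hX.nonneg o
  unfold HasLargeSquare at h
  have hp := gromovProduct_eq o a
  have h2 : dist o ((a * a) o) ≤ 2 * dist o (a o) := by
    have := dist_mul_apply_le a a o
    linarith
  induction n with
  | zero =>
    rw [zero_add, pow_one, gromovProduct_self, hp]
    constructor <;> linarith
  | succ n ih =>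
    have e : gromovProduct o (a o) ((a ^ (n + 1 + 1)) o) =
        dist o (a o) - gromovProduct o ((a⁻¹ : X ≃ᵢ X) o) ((a ^ (n + 1)) o) := by
      rw [pow_succ' a (n + 1)]
      unfold gromovProduct
      rw [dist_inv_apply, dist_inv_apply, IsometryEquiv.mul_apply, a.dist_eq,
        dist_comm (a o) o, dist_comm (a ((a ^ (n + 1)) o)) o, dist_comm ((a ^ (n + 1)) o) o]
      ring
    have h3 : gromovProduct o (a o) ((a ^ (n + 1 + 1)) o) ≥
        (dist o (a o) + (4 * δ + 1)) / 2 - δ := by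
      linarith [ih.1]
    refine ⟨?_, h3⟩
    rw [gromovProduct_comm] at hp
    rw [gromovProduct_comm]
    have h4 := hX.le_of_lt hp.le (z := (a ^ (n + 1 + 1)) o) (by linarith)
    linarith

/-- By `gromovProduct_pow_le` little is lost to backtracking, so each further factor a increases the
displacement by at least 1. -/
theorem le_dist_pow (hX : FourPoint X δ) (h : HasLargeSquare δ o a) (n : ℕ) :
    (n : ℝ) ≤ dist o ((a ^ n) o) := by
  have hδ := hX.nonneg o
  have h' := h
  unfold HasLargeSquare at h'
  have h2 : dist o ((a * a) o) ≤ 2 * dist o (a o) := by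
    have := dist_mul_apply_le a a o
    linarith
  induction n with
  | zero => simp
  | succ n ih =>
    cases n with
    | zero => simp only [zero_add, Nat.cast_one, pow_one]; linarith
    | succ n =>
      have h1 := (h.gromovProduct_pow_le hX n).1
      have h3 := dist_mul_apply a (a ^ (n + 1)) o
      rw [pow_succ' a (n + 1), h3]
      push_cast at ih ⊢
      linarith

theorem isLoxodromic (hX : FourPoint X δ) (h : HasLargeSquare δ o a) :
    ∃ B, IsLoxodromic o a B := by
  have hδ := hX.nonneg o
  refine ⟨dist o (a o) - dist o ((a * a) o) / 2 + 2 * δ, ⟨fun m n => ?_, ?_⟩⟩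
  · have h2 : dist o ((a * a) o) ≤ 2 * dist o (a o) := by
      have := dist_mul_apply_le a a o
      linarith
    cases m with
    | zero =>
      have e : ((a ^ 0)⁻¹ : X ≃ᵢ X) o = o := by simp
      have := gromovProduct_le_left o o ((a ^ n) o)
      rw [dist_self] at this
      rw [e]
      linarith
    | succ m =>
      cases n with
      | zero =>
        have e : (a ^ 0) o = o := by simp
        have := gromovProduct_le_right o (((a ^ (m + 1))⁻¹ : X ≃ᵢ X) o) o
        rw [dist_self] at this
        rw [e]
        linarith
      | succ n =>
        have h1 := (h.gromovProduct_pow_le hX n).1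
        have h3 := (h.inv.gromovProduct_pow_le hX m).2
        rw [dist_self_inv_apply, inv_pow] at h3
        unfold HasLargeSquare at h
        have := hX.le_of_lt h1 (z := ((a ^ (m + 1))⁻¹ : X ≃ᵢ X) o) (by linarith)
        linarith
  · exact tendsto_atTop_mono (fun n => h.le_dist_pow hX n) tendsto_natCast_atTop_atTop

theorem isHyperbolicIsometry (hX : FourPoint X δ) (h : HasLargeSquare δ o a) :
    IsHyperbolicIsometry a := by
  intro x
  refine ⟨1, one_pos, 2 * dist x o, fun n => ?_⟩
  have key : |(n : ℝ)| ≤ dist o ((a ^ n) o) := by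
    rcases Int.eq_nat_or_neg n with ⟨k, rfl | rfl⟩
    · simpa using h.le_dist_pow hX k
    · rw [zpow_neg, dist_self_inv_apply]
      simpa using h.le_dist_pow hX k
  have h1 := dist_triangle4 o x ((a ^ n) x) ((a ^ n) o)
  rw [(a ^ n).dist_eq, dist_comm o x] at h1
  linarith

/-- Products of isometries which move `o` far away in independent directions. -/
theorem mul (hX : FourPoint X δ) {g h : X ≃ᵢ X} {C : ℝ}
    (h1 : gromovProduct o (g o) ((h⁻¹ : X ≃ᵢ X) o) ≤ C)
    (h2 : gromovProduct o ((g⁻¹ : X ≃ᵢ X) o) (h o) ≤ C)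
    (hg : 2 * C + 8 * δ + 1 ≤ dist o (g o)) (hh : 2 * C + 8 * δ + 1 ≤ dist o (h o)) :
    HasLargeSquare δ o (g * h) := by
  have hδ := hX.nonneg o
  have hC := (gromovProduct_nonneg _ _ _).trans h1
  have e := dist_mul_apply g h o
  have e2 := dist_mul_apply (g * h) (g * h) o
  have p1 : gromovProduct o (g o) ((g * h) o) = dist o (g o) -
      gromovProduct o ((g⁻¹ : X ≃ᵢ X) o) (h o) := by
    unfold gromovProduct
    rw [dist_inv_apply, dist_inv_apply, IsometryEquiv.mul_apply, g.dist_eq,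
      dist_comm (g o) o, dist_comm (g (h o)) o, dist_comm (h o) o]
    ring
  have p2 : gromovProduct o ((h⁻¹ : X ≃ᵢ X) o) (((g * h)⁻¹ : X ≃ᵢ X) o) = dist o (h o) -
      gromovProduct o ((g⁻¹ : X ≃ᵢ X) o) (h o) := by
    have e3 := dist_self_inv_apply (g * h) o
    have e4 := dist_self_inv_apply h o
    rw [dist_comm] at e3 e4
    unfold gromovProduct
    rw [e3, e4, e, mul_inv_rev, IsometryEquiv.mul_apply, (h⁻¹ : X ≃ᵢ X).dist_eq, dist_self_inv_apply]
    unfold gromovProduct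
    rw [dist_comm _ o, dist_self_inv_apply, dist_comm _ o]
    ring
  -- The point gh o follows g o and (gh)⁻¹ o follows h⁻¹ o, so gh does not backtrack when squared.
  have h3 := hX.le_of_lt₂ h1 (x' := (g * h) o) (y' := ((g * h)⁻¹ : X ≃ᵢ X) o)
    (by linarith) (by linarith)
  rw [gromovProduct_comm] at h3
  unfold HasLargeSquare
  linarith

end HasLargeSquare

/-- If neither `g` nor its inverse satisfies the displacement criterion, the orbit points `g o` and
`g⁻¹ o` lie in the same direction. -/
theorem lt_gromovProduct_of_not_hasLargeSquare (h : ¬ HasLargeSquare δ o a) :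
    (dist o (a o) - (4 * δ + 1)) / 2 < gromovProduct o (a o) ((a⁻¹ : X ≃ᵢ X) o) := by
  rw [gromovProduct_comm, HasLargeSquare.gromovProduct_eq]
  unfold HasLargeSquare at h
  linarith

/-- Two distinct limit points of orbits produce a loxodromic isometry. -/
theorem exists_hasLargeSquare (hX : FourPoint X δ) {s t : ℕ → X ≃ᵢ X}
    (hs : ConvergesAtInfinity o fun n => s n o) (ht : ConvergesAtInfinity o fun n => t n o)
    (hst : ¬ SameBoundaryPoint o (fun n => s n o) fun n => t n o) :
    ∃ a : X ≃ᵢ X, HasLargeSquare δ o a := by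
  have hδ := hX.nonneg o
  obtain ⟨C, N, hN⟩ := exists_gromovProduct_le hX hs ht hst
  obtain ⟨N₁, hN₁⟩ := hs.exists_dist_ge (2 * (C + 2 * δ) + 8 * δ + 1)
  obtain ⟨N₂, hN₂⟩ := ht.exists_dist_ge (2 * (C + 2 * δ) + 8 * δ + 1)
  set n := max N (max N₁ N₂) with hn
  have h0 := hN n (by simp [hn]) n (by simp [hn])
  have h1 := hN₁ n (by simp [hn])
  have h2 := hN₂ n (by simp [hn])
  set g := s n
  set f := t n
  by_contra hne
  push Not at hne
  -- If neither g nor f qualifies, then g⁻¹ o points in the direction of g o and f⁻¹ o in that of f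
  -- o. These two directions are independent, so the product criterion applies to gf.
  have hg := lt_gromovProduct_of_not_hasLargeSquare (hne g)
  have hf := lt_gromovProduct_of_not_hasLargeSquare (hne f)
  have k1 := hX.le_of_lt h0 (z := (g⁻¹ : X ≃ᵢ X) o) (by linarith)
  rw [gromovProduct_comm] at h0
  have k2 := hX.le_of_lt h0 (z := (f⁻¹ : X ≃ᵢ X) o) (by linarith)
  rw [gromovProduct_comm] at k2
  exact hne _ (HasLargeSquare.mul hX (C := C + 2 * δ) (g := g) (h := f)
    (by linarith) (by linarith) h1 h2)

/-- Every hyperbolic isometry has a power satisfying the displacement criterion. -/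
theorem IsHyperbolicIsometry.exists_pow_hasLargeSquare (h : IsHyperbolicIsometry a) (o : X)
    (δ : ℝ) : ∃ N : ℕ, HasLargeSquare δ o (a ^ N) := by
  by_contra hne
  push Not at hne
  obtain ⟨c, hc, C, hC⟩ := h o
  -- If the criterion fails for all powers, every doubling adds at most 4δ + 1, so the displacement
  -- of a^(2^j) grows linearly in j, while hyperbolicity demands c 2^j.
  have key : ∀ j : ℕ, dist o ((a ^ (2 ^ j)) o) ≤ j * (4 * δ + 1) + dist o (a o) := by
    intro j
    induction j with
    | zero => simp
    | succ j ih =>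
      have := hne (2 ^ j)
      unfold HasLargeSquare at this
      rw [← pow_add, ← two_mul, ← pow_succ'] at this
      push_cast
      linarith
  have lim : Tendsto (fun j : ℕ => (j : ℝ) / 2 ^ j) atTop (𝓝 0) := by
    simpa using tendsto_pow_const_div_const_pow_of_one_lt 1 (one_lt_two (α := ℝ))
  have lim2 : Tendsto (fun j : ℕ => (1 : ℝ) / 2 ^ j) atTop (𝓝 0) := by
    simpa using tendsto_pow_atTop_nhds_zero_of_lt_one (r := (1 / 2 : ℝ)) (by norm_num) (by norm_num)
  have lim3 : Tendsto (fun j : ℕ => (j : ℝ) / 2 ^ j * (4 * δ + 1) +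
      1 / 2 ^ j * (dist o (a o) + C)) atTop (𝓝 0) := by
    simpa using (lim.mul_const (4 * δ + 1)).add (lim2.mul_const (dist o (a o) + C))
  obtain ⟨j, hj⟩ := (lim3.eventually (gt_mem_nhds hc)).exists
  have h1 := hC ((2 ^ j : ℕ) : ℤ)
  rw [zpow_natCast] at h1
  have h2 := key j
  have hpos : (0 : ℝ) < 2 ^ j := by positivity
  have h3 : c * 2 ^ j ≤ j * (4 * δ + 1) + (dist o (a o) + C) := by
    push_cast at h1
    rw [abs_of_pos hpos] at h1
    linarith
  have h4 : ((j : ℝ) / 2 ^ j * (4 * δ + 1) + 1 / 2 ^ j * (dist o (a o) + C)) * 2 ^ j =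
      j * (4 * δ + 1) + (dist o (a o) + C) := by
    field_simp
  have := mul_lt_mul_of_pos_right hj hpos
  linarith

end Loxodromic

/-! ### The topology of the isometry group -/

section IsometryGroup

variable {X : Type*} [MetricSpace X]

theorem continuous_isometryEquiv_apply (x : X) : Continuous fun g : X ≃ᵢ X => g x :=
  (continuous_eval_const (F := C(X, X)) x).comp IsometryEquiv.continuous_toContinuousMap

theorem isOpen_setOf_dist_lt (x y : X) (r : ℝ) : IsOpen {g : X ≃ᵢ X | dist (g x) y < r} :=
  isOpen_lt ((continuous_isometryEquiv_apply x).dist continuous_const) continuous_const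

theorem isClosed_setOf_dist_le (o : X) (R : ℝ) : IsClosed {g : X ≃ᵢ X | dist o (g o) ≤ R} :=
  isClosed_le (continuous_const.dist (continuous_isometryEquiv_apply o)) continuous_const

instance [ProperSpace X] : SecondCountableTopology (X ≃ᵢ X) :=
  (Topology.IsInducing.mk rfl :
    Topology.IsInducing (IsometryEquiv.toContinuousMap (X := X))).secondCountableTopology

/-- The compact-open topology on isometries is the topology of pointwise convergence. -/
theorem isInducing_isometryEquiv_coe :
    Topology.IsInducing fun (g : X ≃ᵢ X) (x : X) => g x := by
  refine Topology.isInducing_iff_nhds.2 fun g₀ => le_antisymm ?_ ?_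
  · exact map_le_iff_le_comap.1
      (continuous_pi continuous_isometryEquiv_apply).continuousAt
  · have hind : 𝓝 g₀ = comap IsometryEquiv.toContinuousMap (𝓝 g₀.toContinuousMap) :=
      (Topology.IsInducing.mk rfl : Topology.IsInducing
        (IsometryEquiv.toContinuousMap (X := X))).nhds_eq_comap g₀
    rw [hind, ← map_le_iff_le_comap]
    change Tendsto IsometryEquiv.toContinuousMap _ _
    rw [ContinuousMap.tendsto_iff_forall_isCompact_tendstoUniformlyOn]
    intro K hK
    rw [Metric.tendstoUniformlyOn_iff]
    intro ε hε
    -- Isometries are equicontinuous: control on a finite ε/3-net of K gives uniform control on K.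
    obtain ⟨t, -, ht, hKt⟩ := hK.finite_cover_balls (e := ε / 3) (by positivity)
    have : ∀ᶠ g : X ≃ᵢ X in comap (fun (g : X ≃ᵢ X) (x : X) => g x) (𝓝 fun x => g₀ x),
        ∀ p ∈ t, dist (g p) (g₀ p) < ε / 3 := by
      rw [ht.eventually_all]
      intro p _
      have h1 : Tendsto (fun g : X ≃ᵢ X => g p)
          (comap (fun (g : X ≃ᵢ X) (x : X) => g x) (𝓝 fun x => g₀ x)) (𝓝 (g₀ p)) :=
        ((continuous_apply p).continuousAt (x := fun x => g₀ x)).tendsto.comp tendsto_comap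
      exact Metric.tendsto_nhds.1 h1 _ (by positivity)
    filter_upwards [this] with g hg x hx
    obtain ⟨p, hp, hxp⟩ := Set.mem_iUnion₂.1 (hKt hx)
    rw [Metric.mem_ball] at hxp
    have h1 := dist_triangle4 (g₀ x) (g₀ p) (g p) (g x)
    rw [g₀.dist_eq, g.dist_eq, dist_comm p x, dist_comm (g₀ p)] at h1
    have := hg p hp
    simp only [IsometryEquiv.toContinuousMap_apply]
    linarith

/-- An Arzelà–Ascoli statement obtained from Tychonoff: g ↦ (g, g⁻¹) is inducing into X^X × X^X, and
its values lie in a product of closed balls. The image is closed there because the equations d(φ y,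
x) = d(y, ψ x) alone force φ and ψ to be mutually inverse isometries. -/
theorem isCompact_setOf_dist_le [ProperSpace X] (o : X) (R : ℝ) :
    IsCompact {g : X ≃ᵢ X | dist o (g o) ≤ R} := by
  set Φ : (X ≃ᵢ X) → (X → X) × (X → X) := fun g => (fun x => g x, fun x => g⁻¹ x) with hΦ
  have hcont : Continuous fun (g : X ≃ᵢ X) (x : X) => (g⁻¹ : X ≃ᵢ X) x :=
    (continuous_pi continuous_isometryEquiv_apply).comp continuous_inv
  have hind : Topology.IsInducing Φ := by
    refine Topology.IsInducing.of_comp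
      ((continuous_pi continuous_isometryEquiv_apply).prodMk hcont) continuous_fst ?_
    exact isInducing_isometryEquiv_coe
  rw [hind.isCompact_iff]
  set D : Set ((X → X)) :=
    Set.univ.pi fun x => Metric.closedBall o (R + dist o x) with hD
  have hDc : IsCompact D := isCompact_univ_pi fun x => isCompact_closedBall _ _
  have himage : Φ '' {g : X ≃ᵢ X | dist o (g o) ≤ R} =
      (D ×ˢ D) ∩ {p | ∀ x y, dist (p.1 y) x = dist y (p.2 x)} ∩ {p | dist o (p.1 o) ≤ R} := by
    ext ⟨φ, ψ⟩
    constructor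
    · rintro ⟨g, hg, hgp⟩
      obtain ⟨rfl, rfl⟩ := Prod.mk.inj hgp
      simp only [Set.mem_ofPred_eq] at hg
      refine ⟨⟨⟨fun x _ => ?_, fun x _ => ?_⟩, fun x y => ?_⟩, hg⟩
      · have := dist_triangle o (g o) (g x)
        rw [g.dist_eq] at this
        rw [Metric.mem_closedBall, dist_comm]
        linarith
      · have := dist_triangle o ((g⁻¹ : X ≃ᵢ X) o) ((g⁻¹ : X ≃ᵢ X) x)
        rw [(g⁻¹ : X ≃ᵢ X).dist_eq, dist_self_inv_apply] at this
        rw [Metric.mem_closedBall, dist_comm]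
        linarith
      · exact (dist_apply_inv g y x).symm
    · rintro ⟨⟨-, h⟩, hR⟩
      simp only [Set.mem_ofPred_eq] at h hR
      have h1 : ∀ x, φ (ψ x) = x := fun x => by
        have := h x (ψ x)
        rwa [dist_self, dist_eq_zero] at this
      have h2 : ∀ y, ψ (φ y) = y := fun y => by
        have := h (φ y) y
        rw [dist_self] at this
        exact (dist_eq_zero.1 this.symm).symm
      have h3 : Isometry φ := Isometry.of_dist_eq fun x y => by rw [h, h2]
      let g : X ≃ᵢ X := ⟨⟨φ, ψ, h2, h1⟩, h3⟩
      exact ⟨g, hR, rfl⟩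
  rw [himage]
  refine ((hDc.prod hDc).inter_right ?_).inter_right ?_
  · simp only [Set.ofPred_forall]
    refine isClosed_iInter fun x => isClosed_iInter fun y => isClosed_eq ?_ ?_
    · exact ((continuous_apply y).comp continuous_fst).dist continuous_const
    · exact continuous_const.dist ((continuous_apply x).comp continuous_snd)
  · exact isClosed_le (continuous_const.dist ((continuous_apply o).comp continuous_fst))
      continuous_const

instance [ProperSpace X] : LocallyCompactSpace (X ≃ᵢ X) := by
  rcases isEmpty_or_nonempty X with hX | ⟨⟨o⟩⟩
  · have : Subsingleton (X ≃ᵢ X) := ⟨fun g h => IsometryEquiv.ext fun x => hX.elim x⟩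
    have : Finite (X ≃ᵢ X) := Finite.of_subsingleton
    infer_instance
  · have : WeaklyLocallyCompactSpace (X ≃ᵢ X) := ⟨fun g => by
      refine ⟨_, isCompact_setOf_dist_le o (dist o (g o) + 1), ?_⟩
      refine mem_of_superset ((isOpen_setOf_dist_lt o (g o) 1).mem_nhds (by simp)) fun h hh => ?_
      have := dist_triangle_right o (h o) (g o)
      simp only [Set.mem_ofPred_eq] at hh ⊢
      linarith⟩
    infer_instance

end IsometryGroup

/-! ### Dynamics of a loxodromic isometry on the boundary -/

section LoxodromicDynamics

variable {X : Type*} [MetricSpace X] {δ : ℝ} {o : X} {a : X ≃ᵢ X} {B : ℝ}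

theorem gromovProduct_mul_apply (g h : X ≃ᵢ X) (o : X) :
    gromovProduct o (g o) ((g * h) o) =
      dist o (g o) - gromovProduct o ((g⁻¹ : X ≃ᵢ X) o) (h o) := by
  unfold gromovProduct
  rw [dist_inv_apply, dist_inv_apply, IsometryEquiv.mul_apply, g.dist_eq,
    dist_comm (g o) o, dist_comm (g (h o)) o, dist_comm (h o) o]
  ring

namespace IsLoxodromic

theorem inv (ha : IsLoxodromic o a B) : IsLoxodromic o a⁻¹ B where
  gromovProduct_le m n := by
    rw [inv_pow, inv_pow, inv_inv, gromovProduct_comm]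
    exact ha.gromovProduct_le n m
  tendsto_dist := by
    simp only [inv_pow, dist_self_inv_apply]
    exact ha.tendsto_dist

theorem le_gromovProduct (ha : IsLoxodromic o a B) {m n : ℕ} (h : m ≤ n) :
    dist o ((a ^ m) o) - B ≤ gromovProduct o ((a ^ m) o) ((a ^ n) o) := by
  obtain ⟨k, rfl⟩ := Nat.exists_eq_add_of_le h
  rw [pow_add, gromovProduct_mul_apply]
  linarith [ha.gromovProduct_le m k]

theorem exists_dist_ge (ha : IsLoxodromic o a B) (C : ℝ) :
    ∃ N : ℕ, ∀ n ≥ N, C ≤ dist o ((a ^ n) o) :=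
  eventually_atTop.1 (tendsto_atTop.1 ha.tendsto_dist C)

theorem convergesAtInfinity (ha : IsLoxodromic o a B) :
    ConvergesAtInfinity o (orbitRay o a) := by
  rw [convergesAtInfinity_iff_same, sameBoundaryPoint_iff]
  intro C
  obtain ⟨N, hN⟩ := ha.exists_dist_ge (C + B)
  refine ⟨N, fun i hi j hj => ?_⟩
  rw [orbitRay_apply, orbitRay_apply]
  rcases le_total i j with h | h
  · linarith [ha.le_gromovProduct h, hN i hi]
  · rw [gromovProduct_comm]
    linarith [ha.le_gromovProduct h, hN j hj]

theorem gromovProduct_orbitRay_le (ha : IsLoxodromic o a B) (m n : ℕ) :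
    gromovProduct o (orbitRay o a m) (orbitRay o a⁻¹ n) ≤ B := by
  rw [gromovProduct_comm, orbitRay_inv_apply]
  exact ha.gromovProduct_le n m

theorem not_same (ha : IsLoxodromic o a B) :
    ¬ SameBoundaryPoint o (orbitRay o a) (orbitRay o a⁻¹) := by
  intro h
  obtain ⟨N, hN⟩ := sameBoundaryPoint_iff.1 h (B + 1)
  linarith [hN N le_rfl N le_rfl, ha.gromovProduct_orbitRay_le N N]

/-- A point which lies roughly between the two ends of `a` is close to the orbit of `o` under the
powers of `a`. -/
theorem exists_dist_zpow_le (hX : FourPoint X δ) (ha : IsLoxodromic o a B) {w : X} {x y : ℕ → X}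
    (hx : SameBoundaryPoint o x (orbitRay o a)) (hy : SameBoundaryPoint o y (orbitRay o a⁻¹))
    (hw : ∀ i, gromovProduct w (x i) (y i) ≤ B) :
    ∃ k : ℤ, dist w ((a ^ k) o) ≤ 4 * B + 6 * δ + dist o (a o) := by
  have hδ := hX.nonneg o
  have hB : 0 ≤ B := (gromovProduct_nonneg _ _ _).trans (ha.gromovProduct_le 0 0)
  obtain ⟨N, hN⟩ := sameBoundaryPoint_iff.1 hx (B + 2 * δ + 1 + dist o w)
  obtain ⟨N', hN'⟩ := sameBoundaryPoint_iff.1 hy (B + 2 * δ + 1 + dist o w)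
  set i := max N N' with hi
  have h1 := hN i (le_max_left _ _) i (le_max_left _ _)
  have h2 := hN' i (le_max_right _ _) i (le_max_right _ _)
  -- Changing the base point from o to w costs d(o, w), which was added to the thresholds above. The
  -- outcome `h5` says that w lies roughly between aⁱ o and a⁻ⁱ o.
  have h3 := gromovProduct_le_add_dist_base o w (x i) (orbitRay o a i)
  have h4 := gromovProduct_le_add_dist_base o w (y i) (orbitRay o a⁻¹ i)
  have h5 := hX.le_of_lt₂ (hw i) (x' := orbitRay o a i) (y' := orbitRay o a⁻¹ i)
    (by linarith) (by linarith)
  rw [orbitRay_inv_apply, orbitRay_apply] at h5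
  set P := (a ^ i) o with hP
  set Q := ((a ^ i)⁻¹ : X ≃ᵢ X) o with hQ
  have hPQ : dist P Q = dist o ((a ^ (2 * i)) o) := by
    rw [hP, hQ, dist_apply_inv, ← IsometryEquiv.mul_apply, ← pow_add, dist_comm, two_mul]
  have hT : ∃ k : ℕ, dist P w - 2 * (B + 2 * δ) ≤ dist o ((a ^ k) o) := by
    refine ⟨2 * i, ?_⟩
    rw [← hPQ]
    unfold gromovProduct at h5
    linarith [dist_nonneg (x := Q) (y := w)]
  classical
  -- The orbit advances by steps of at most d(o, a o), so the least such k gives a point v = aⁱ⁻ᵏ o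
  -- at almost the same distance from P as w. Both lie between P and Q, and the four-point condition
  -- for P, Q, w, v bounds d(w, v).
  set k := Nat.find hT with hk
  have hk1 : dist P w - 2 * (B + 2 * δ) ≤ dist o ((a ^ k) o) := Nat.find_spec hT
  have hk2 : k ≤ 2 * i := by
    refine Nat.find_min' hT ?_
    rw [← hPQ]
    unfold gromovProduct at h5
    linarith [dist_nonneg (x := Q) (y := w)]
  have hk3 : dist o ((a ^ k) o) ≤ dist P w + dist o (a o) := by
    rcases Nat.eq_zero_or_pos k with h0 | h0
    · rw [h0, pow_zero]
      change dist o o ≤ _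
      rw [dist_self]
      positivity
    · have h6 := Nat.find_min hT (m := k - 1) (by omega)
      push Not at h6
      have h7 := dist_mul_apply_le (a ^ (k - 1)) a o
      rw [← pow_succ, Nat.sub_add_cancel h0] at h7
      linarith
  refine ⟨(i : ℤ) - k, ?_⟩
  set v := (a ^ ((i : ℤ) - k)) o with hv
  have hPv : dist P v = dist o ((a ^ k) o) := by
    have : P = (a ^ ((i : ℤ) - k)) ((a ^ k) o) := by
      rw [hP, ← IsometryEquiv.mul_apply, ← zpow_natCast a k, ← zpow_add, sub_add_cancel,
        zpow_natCast]
    rw [this, hv, (a ^ ((i : ℤ) - k)).dist_eq, dist_comm]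
  have hv2 : gromovProduct v P Q ≤ B := by
    have e1 : P = (a ^ ((i : ℤ) - k)) ((a ^ k) o) := by
      rw [hP, ← IsometryEquiv.mul_apply, ← zpow_natCast a k, ← zpow_add, sub_add_cancel,
        zpow_natCast]
    have e2 : Q = (a ^ ((i : ℤ) - k)) (((a ^ (2 * i - k))⁻¹ : X ≃ᵢ X) o) := by
      rw [hQ, ← IsometryEquiv.mul_apply, ← zpow_natCast a (2 * i - k), ← zpow_neg, ← zpow_add,
        ← zpow_natCast a i, ← zpow_neg]
      congr 2
      push_cast [hk2]
      ring_nf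
    rw [e1, e2, hv, gromovProduct_isometry, gromovProduct_comm]
    exact ha.gromovProduct_le _ _
  have h8 := hX P Q w v
  unfold gromovProduct at h5 hv2
  rcases le_max_iff.1 (show dist P Q + dist w v - 2 * δ ≤ _ by linarith) with h9 | h9 <;>
    linarith [dist_nonneg (x := o) (y := a o)]

/-- A sequence which stays close to the orbit of `o` under the powers of `a` converges to one of the
two ends of `a`. -/
theorem same_or_same_inv (hX : FourPoint X δ) (ha : IsLoxodromic o a B) {u : ℕ → X} {R : ℝ}
    (hu : ConvergesAtInfinity o u) (h : ∀ n, ∃ k : ℤ, dist (u n) ((a ^ k) o) ≤ R) :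
    SameBoundaryPoint o u (orbitRay o a) ∨ SameBoundaryPoint o u (orbitRay o a⁻¹) := by
  by_contra hne
  push Not at hne
  obtain ⟨C, N, hN⟩ := exists_gromovProduct_le hX hu ha.convergesAtInfinity hne.1
  obtain ⟨C', N', hN'⟩ := exists_gromovProduct_le hX hu ha.inv.convergesAtInfinity hne.2
  set D := max C C' + max N N' * dist o (a o) + R + 1 with hD
  obtain ⟨M, hM⟩ := hu.exists_dist_ge (max D (R + 1 + max C C'))
  set i := max M (max N N')
  have hi := hM i (le_max_left _ _)
  have hi1 := (le_max_left _ _).trans hi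
  have hi2 := (le_max_right _ _).trans hi
  have hC0 : 0 ≤ max C C' := (gromovProduct_nonneg o (u N) (orbitRay o a N)).trans
    ((hN N le_rfl N le_rfl).trans (le_max_left _ _))
  obtain ⟨k, hk⟩ := h i
  have hdist := dist_triangle_right o (u i) ((a ^ k) o)
  -- The point u i is so far from o that the nearby aᵏ o has |k| beyond both thresholds. Yet its
  -- product with u i is at least d(o, u i) - R, contradicting the bound for the end to which k
  -- points.
  have key : ∀ n : ℕ, dist o ((a ^ k) o) ≤ n * dist o (a o) → max N N' ≤ n := by
    intro n hn
    by_contra hlt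
    push Not at hlt
    have : (n : ℝ) * dist o (a o) ≤ (max N N' : ℕ) * dist o (a o) := by
      gcongr
    linarith
  have key2 := gromovProduct_le_add_dist_right o (u i) (u i) ((a ^ k) o)
  rw [gromovProduct_self] at key2
  rcases Int.eq_nat_or_neg k with ⟨n, rfl | rfl⟩
  · have := key n (by rw [zpow_natCast]; exact dist_pow_apply_le o a n)
    have h1 := hN i (by simp [i]) n (le_of_max_le_left this)
    rw [zpow_natCast] at key2 hk
    rw [orbitRay_apply] at h1
    linarith [le_max_left C C']
  · have := key n (by
      rw [zpow_neg, zpow_natCast, dist_self_inv_apply]; exact dist_pow_apply_le o a n)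
    have h1 := hN' i (by simp [i]) n (le_of_max_le_right this)
    rw [zpow_neg, zpow_natCast] at key2 hk
    rw [orbitRay_inv_apply] at h1
    linarith [le_max_right C C']

/-- If the isometry group preserves the pair of ends of a loxodromic isometry, then it has at most
two limit points. -/
theorem not_forall_preserves_ends (hX : FourPoint X δ) (ha : IsLoxodromic o a B)
    {s : Fin 3 → ℕ → (X ≃ᵢ X)} (hs : ∀ i, ConvergesAtInfinity o fun n => s i n o)
    (hne : ∀ i j, i ≠ j → ¬ SameBoundaryPoint o (fun n => s i n o) (fun n => s j n o)) :
    ¬ ∀ g : X ≃ᵢ X,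
      (SameBoundaryPoint o (g ∘ orbitRay o a) (orbitRay o a) ∧
          SameBoundaryPoint o (g ∘ orbitRay o a⁻¹) (orbitRay o a⁻¹)) ∨
        (SameBoundaryPoint o (g ∘ orbitRay o a) (orbitRay o a⁻¹) ∧
          SameBoundaryPoint o (g ∘ orbitRay o a⁻¹) (orbitRay o a)) := by
  intro h
  have near : ∀ g : X ≃ᵢ X, ∃ k : ℤ, dist (g o) ((a ^ k) o) ≤ 4 * B + 6 * δ + dist o (a o) := by
    intro g
    rcases h g with ⟨h1, h2⟩ | ⟨h1, h2⟩
    · refine ha.exists_dist_zpow_le hX h1 h2 fun i => ?_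
      rw [Function.comp_apply, Function.comp_apply, gromovProduct_isometry]
      exact ha.gromovProduct_orbitRay_le i i
    · refine ha.exists_dist_zpow_le hX h2 h1 fun i => ?_
      rw [Function.comp_apply, Function.comp_apply, gromovProduct_isometry, gromovProduct_comm]
      exact ha.gromovProduct_orbitRay_le i i
  have key := fun i => ha.same_or_same_inv hX (hs i) fun n => near (s i n)
  have pair : ∀ i j, i ≠ j → ∀ v, SameBoundaryPoint o (fun n => s i n o) v →
      ¬ SameBoundaryPoint o (fun n => s j n o) v := fun i j hij v hi hj =>
    hne i j hij (hi.trans hX hj.symm)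
  have p01 := pair 0 1 (by decide)
  have p02 := pair 0 2 (by decide)
  have p12 := pair 1 2 (by decide)
  -- Three distinct limit points among two ends: pigeonhole.
  rcases key 0 with k0 | k0 <;> rcases key 1 with k1 | k1 <;> rcases key 2 with k2 | k2 <;>
    first
    | exact p01 _ k0 k1
    | exact p02 _ k0 k2
    | exact p12 _ k1 k2

/-- A nontrivial power of a loxodromic isometry fixes only its two ends. -/
theorem not_same_pow (hX : FourPoint X δ) (ha : IsLoxodromic o a B) {x : ℕ → X}
    (hx : ConvergesAtInfinity o x) (h1 : ¬ SameBoundaryPoint o x (orbitRay o a))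
    (h2 : ¬ SameBoundaryPoint o x (orbitRay o a⁻¹)) {k : ℕ} (hk : k ≠ 0) :
    ¬ SameBoundaryPoint o ((a ^ k : X ≃ᵢ X) ∘ x) x := by
  intro hfix
  have iter : ∀ j : ℕ, SameBoundaryPoint o ((a ^ (k * j) : X ≃ᵢ X) ∘ x) x := by
    intro j
    induction j with
    | zero =>
      have : ((a ^ (k * 0) : X ≃ᵢ X) ∘ x) = x := by
        funext n
        simp
      rw [this]
      exact hx
    | succ j ih =>
      have e : ((a ^ (k * (j + 1)) : X ≃ᵢ X) ∘ x) = (a ^ (k * j) : X ≃ᵢ X) ∘ (a ^ k : X ≃ᵢ X) ∘ x := by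
        funext n
        simp only [Function.comp_apply, ← IsometryEquiv.mul_apply, ← pow_add, mul_add, mul_one]
      rw [e]
      exact (hfix.map _).trans hX ih
  obtain ⟨C, N, hN⟩ := exists_gromovProduct_le hX hx ha.convergesAtInfinity h1
  obtain ⟨C', N', hN'⟩ := exists_gromovProduct_le hX hx ha.inv.convergesAtInfinity h2
  obtain ⟨M, hM⟩ := ha.exists_dist_ge (C + C' + B + δ + 1)
  set j := max M N with hj
  set b := a ^ (k * j) with hb
  have hjk : j ≤ k * j := Nat.le_mul_of_pos_left j (Nat.pos_of_ne_zero hk)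
  have hbo := hM (k * j) ((le_max_left _ _).trans hjk)
  obtain ⟨I, hI⟩ := sameBoundaryPoint_iff.1 (iter j) (C' + δ + 1 + dist o (b o))
  set i := max I (max N N') with hi
  have h3 := hI i (by simp [hi]) i (by simp [hi])
  have h4 := hN i (by simp [hi]) (k * j) ((le_max_right _ _).trans hjk)
  have h5 := hN' i (by simp [hi]) (N' + k * j) (by omega)
  -- Since b shifts the backward ray of a along the orbit, this is the bound `h5` between x and that
  -- ray, transported by b.
  have h6 : gromovProduct (b o) (b (x i)) (orbitRay o a⁻¹ N') ≤ C' := by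
    have e : orbitRay o a⁻¹ N' = b (orbitRay o a⁻¹ (N' + k * j)) := by
      rw [orbitRay_inv_apply, orbitRay_inv_apply, hb, ← IsometryEquiv.mul_apply]
      congr 1
      rw [pow_add]
      group
    rw [e, gromovProduct_isometry]
    exact h5
  have h7 := gromovProduct_le_add_dist_base o (b o) (b (x i)) (x i)
  rw [Function.comp_apply, ← hb] at h3
  have h8 := hX.le_of_lt h6 (z := x i) (by linarith)
  have h9 := ha.gromovProduct_orbitRay_le (k * j) N'
  rw [orbitRay_apply, ← hb] at h4 h9
  have hbo' : C + C' + B + δ + 1 ≤ dist o (b o) := hbo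
  -- With q = a^(-N') o, the bounds on (x i | b o)_o, (x i | q)_(b o) and (b o | q)_o add up to d(o,
  -- b o) ≤ C + C' + B + δ, because all other distances cancel up to a triangle inequality.
  unfold gromovProduct at h4 h8 h9
  linarith [dist_triangle (x i) o (orbitRay o a⁻¹ N'), dist_comm o (orbitRay o a⁻¹ N'),
    dist_comm (b o) o, dist_comm (b o) (orbitRay o a⁻¹ N')]

end IsLoxodromic

/-- Finitely many sequences with distinct limits have uniformly bounded Gromov products. -/
theorem exists_gromovProduct_le_of_finite (hX : FourPoint X δ) {ι : Type*} [Finite ι]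
    {x : ι → ℕ → X} (hx : ∀ i, ConvergesAtInfinity o (x i))
    (hne : ∀ i j, i ≠ j → ¬ SameBoundaryPoint o (x i) (x j)) :
    ∃ (C : ℝ) (N : ℕ), ∀ i j, i ≠ j → ∀ m ≥ N, ∀ n ≥ N,
      gromovProduct o (x i m) (x j n) ≤ C := by
  have : ∀ p : ι × ι, ∃ (C : ℝ) (N : ℕ), p.1 ≠ p.2 → ∀ m ≥ N, ∀ n ≥ N,
      gromovProduct o (x p.1 m) (x p.2 n) ≤ C := by
    intro p
    by_cases hp : p.1 = p.2
    · exact ⟨0, 0, fun h => absurd hp h⟩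
    · obtain ⟨C, N, h⟩ := exists_gromovProduct_le hX (hx p.1) (hx p.2) (hne _ _ hp)
      exact ⟨C, N, fun _ => h⟩
  choose C N h using this
  obtain ⟨C', hC'⟩ := (Set.finite_range C).bddAbove
  obtain ⟨N', hN'⟩ := (Set.finite_range N).bddAbove
  refine ⟨C', N', fun i j hij m hm n hn => ?_⟩
  have hN := hN' ⟨(i, j), rfl⟩
  exact (h (i, j) hij m (hN.trans hm) n (hN.trans hn)).trans (hC' ⟨(i, j), rfl⟩)

/-- Isometries fixing three distinct points at infinity move `o` by a bounded amount. -/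
theorem exists_dist_le_of_fixes_three (hX : FourPoint X δ) {x : Fin 3 → ℕ → X}
    (hx : ∀ i, ConvergesAtInfinity o (x i))
    (hne : ∀ i j, i ≠ j → ¬ SameBoundaryPoint o (x i) (x j)) :
    ∃ R : ℝ, ∀ k : X ≃ᵢ X, (∀ i, SameBoundaryPoint o (k ∘ x i) (x i)) → dist o (k o) ≤ R := by
  have hδ := hX.nonneg o
  obtain ⟨C, N, hC⟩ := exists_gromovProduct_le_of_finite hX hx hne
  refine ⟨3 * C + 8 * δ, fun k hk => ?_⟩
  set p := k o with hp
  have hfix : ∃ M : ℕ, ∀ i, ∀ m ≥ M, C + 2 * δ < gromovProduct p (k (x i m)) (x i m) := by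
    have : ∀ i, ∃ M : ℕ, ∀ m ≥ M, C + 2 * δ < gromovProduct p (k (x i m)) (x i m) := by
      intro i
      obtain ⟨M, hM⟩ := sameBoundaryPoint_iff.1 (hk i) (C + 2 * δ + 1 + dist o p)
      refine ⟨M, fun m hm => ?_⟩
      have h1 := hM m hm m hm
      have h2 := gromovProduct_le_add_dist_base o p (k (x i m)) (x i m)
      rw [Function.comp_apply] at h1
      linarith
    choose M hM using this
    exact ⟨Finset.univ.sup M, fun i m hm =>
      hM i m ((Finset.le_sup (Finset.mem_univ i)).trans hm)⟩
  obtain ⟨M, hM⟩ := hfix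
  set n := max M N with hn
  have ho : ∀ i j, i ≠ j → gromovProduct o (x i n) (x j n) ≤ C := fun i j hij =>
    hC i j hij n (le_max_right _ _) n (le_max_right _ _)
  have hpp : ∀ i j, i ≠ j → gromovProduct p (x i n) (x j n) ≤ C + 2 * δ := by
    intro i j hij
    refine hX.le_of_lt₂ (x := k (x i n)) (y := k (x j n)) ?_ (hM i n (le_max_left _ _))
      (hM j n (le_max_left _ _))
    rw [hp, gromovProduct_isometry]
    exact ho i j hij
  -- The three products (x i | p)_o, (x j | p)_o and (x i | x j)_p sum to d(o, p) + (x i | x j)_o,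
  -- so bounding them bounds d(o, p).
  have two : ∀ i j, i ≠ j → gromovProduct o (x i n) p ≤ C + δ → gromovProduct o (x j n) p ≤ C + δ →
      dist o p ≤ 3 * C + 8 * δ := by
    intro i j hij h1 h2
    have h3 := hpp i j hij
    have h4 := ho i j hij
    have h5 := gromovProduct_nonneg o (x i n) (x j n)
    unfold gromovProduct at h1 h2 h3 h5
    rw [dist_comm p o] at h1 h2
    linarith
  -- From o, the point p can lie in the direction of at most one of the three boundary points, so
  -- two of them satisfy the assumptions of `two`.
  have or : ∀ i j, i ≠ j → gromovProduct o (x i n) p ≤ C + δ ∨ gromovProduct o (x j n) p ≤ C + δ := by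
    intro i j hij
    by_contra hcon
    push Not at hcon
    have h1 := hX.le_of_lt (ho i j hij) (z := p) (by linarith)
    rw [gromovProduct_comm] at h1
    linarith
  have t01 := two 0 1 (by decide)
  have t02 := two 0 2 (by decide)
  have t12 := two 1 2 (by decide)
  rcases or 0 1 (by decide) with h | h
  · rcases or 1 2 (by decide) with h' | h'
    · exact t01 h h'
    · exact t02 h h'
  · rcases or 0 2 (by decide) with h' | h'
    · exact t01 h' h
    · exact t12 h h'

end LoxodromicDynamics

/-! ### Ping-pong: conjugates whose products are hyperbolic -/

section IndependentConjugates

variable {X : Type*} [MetricSpace X] {δ : ℝ} {o : X} {a : X ≃ᵢ X} {B : ℝ}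

namespace IsLoxodromic

theorem same_map_self (ha : IsLoxodromic o a B) :
    SameBoundaryPoint o (orbitRay o a) (a ∘ orbitRay o a) := by
  refine SameBoundaryPoint.of_dist_le (C := dist o (a o)) ha.convergesAtInfinity fun n => ?_
  rw [Function.comp_apply, orbitRay_apply, ← IsometryEquiv.mul_apply, ← pow_succ', pow_succ,
    IsometryEquiv.mul_apply, (a ^ n).dist_eq]

/-- Unless an end of `a` is fixed by the whole isometry group, some isometry maps it to a point
distinct from the ends of `a`. -/
theorem exists_not_same (hX : FourPoint X δ) (ha : IsLoxodromic o a B)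
    {s : Fin 3 → ℕ → (X ≃ᵢ X)} (hs : ∀ i, ConvergesAtInfinity o fun n => s i n o)
    (hne : ∀ i j, i ≠ j → ¬ SameBoundaryPoint o (fun n => s i n o) (fun n => s j n o))
    (hF : (∀ g : X ≃ᵢ X, SameBoundaryPoint o (g ∘ orbitRay o a) (orbitRay o a)) →
      ∀ g : X ≃ᵢ X, SameBoundaryPoint o (g ∘ orbitRay o a⁻¹) (orbitRay o a⁻¹)) :
    ∃ g : X ≃ᵢ X, ¬ SameBoundaryPoint o (g ∘ orbitRay o a) (orbitRay o a) ∧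
      ¬ SameBoundaryPoint o (g ∘ orbitRay o a) (orbitRay o a⁻¹) := by
  by_contra hcon
  push Not at hcon
  refine ha.not_forall_preserves_ends hX hs hne fun g => ?_
  by_cases hall : ∀ g : X ≃ᵢ X, SameBoundaryPoint o (g ∘ orbitRay o a) (orbitRay o a)
  · exact Or.inl ⟨hall g, hF hall g⟩
  · push Not at hall
    obtain ⟨g₀, hg₀⟩ := hall
    have h0 := hcon g₀ hg₀
    -- Here g₀ a⁺ = a⁻, so g a⁻ = (g g₀) a⁺ is again a translate of a⁺ and hence one of the two
    -- ends. Injectivity on the boundary then makes g preserve the pair.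
    have hinv : SameBoundaryPoint o (g ∘ orbitRay o a⁻¹) (orbitRay o a) ∨
        SameBoundaryPoint o (g ∘ orbitRay o a⁻¹) (orbitRay o a⁻¹) := by
      have h1 : SameBoundaryPoint o (g ∘ orbitRay o a⁻¹) ((g * g₀ : X ≃ᵢ X) ∘ orbitRay o a) :=
        h0.symm.map g
      by_cases h2 : SameBoundaryPoint o ((g * g₀ : X ≃ᵢ X) ∘ orbitRay o a) (orbitRay o a)
      · exact Or.inl (h1.trans hX h2)
      · exact Or.inr (h1.trans hX (hcon _ h2))
    by_cases hg : SameBoundaryPoint o (g ∘ orbitRay o a) (orbitRay o a)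
    · refine Or.inl ⟨hg, hinv.resolve_left fun h => ha.not_same ?_⟩
      exact SameBoundaryPoint.of_map (g := g) (hg.trans hX h.symm)
    · refine Or.inr ⟨hcon g hg, hinv.resolve_right fun h => ha.not_same ?_⟩
      exact SameBoundaryPoint.of_map (g := g) ((hcon g hg).trans hX h.symm)

/-- The orbit of an end of `a` is infinite as soon as it is not contained in the set of ends. -/
theorem not_same_pow_mul (hX : FourPoint X δ) (ha : IsLoxodromic o a B) {x : ℕ → X}
    (hx : ConvergesAtInfinity o x) (h1 : ¬ SameBoundaryPoint o x (orbitRay o a))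
    (h2 : ¬ SameBoundaryPoint o x (orbitRay o a⁻¹)) {i j : ℕ} (hij : i ≠ j) :
    ¬ SameBoundaryPoint o ((a ^ i : X ≃ᵢ X) ∘ x) ((a ^ j : X ≃ᵢ X) ∘ x) := by
  have key : ∀ i j : ℕ, i < j →
      ¬ SameBoundaryPoint o ((a ^ i : X ≃ᵢ X) ∘ x) ((a ^ j : X ≃ᵢ X) ∘ x) := by
    intro i j hij h
    obtain ⟨k, rfl⟩ := Nat.exists_eq_add_of_lt hij
    have e : ((a ^ (i + k + 1) : X ≃ᵢ X) ∘ x) = (a ^ i : X ≃ᵢ X) ∘ (a ^ (k + 1) : X ≃ᵢ X) ∘ x := by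
      rw [add_assoc, pow_add]
      rfl
    rw [e] at h
    exact ha.not_same_pow hX hx h1 h2 k.succ_ne_zero h.of_map.symm
  rcases lt_or_gt_of_ne hij with h | h
  · exact key i j h
  · exact fun h' => key j i h h'.symm

/-- When the elliptic radical is trivial, a nontrivial isometry moves a translate of the attracting
end of `a`. -/
theorem exists_conj_not_same [ProperSpace X] (hX : FourPoint X δ) (hrad : ellipticRadical X = ⊥)
    (ha : IsLoxodromic o a B) {g₁ : X ≃ᵢ X}
    (h1 : ¬ SameBoundaryPoint o (g₁ ∘ orbitRay o a) (orbitRay o a))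
    (h2 : ¬ SameBoundaryPoint o (g₁ ∘ orbitRay o a) (orbitRay o a⁻¹))
    {k : X ≃ᵢ X} (hk : k ≠ 1) :
    ∃ g : X ≃ᵢ X, ¬ SameBoundaryPoint o ((g⁻¹ * k * g : X ≃ᵢ X) ∘ orbitRay o a) (orbitRay o a) := by
  by_contra hcon
  push Not at hcon
  have hconv := ha.convergesAtInfinity
  -- The pointwise stabiliser of the orbit of a⁺, which is normal because the orbit is invariant.
  let N : Subgroup (X ≃ᵢ X) :=
    { carrier := {k | ∀ g : X ≃ᵢ X,
        SameBoundaryPoint o (k ∘ g ∘ orbitRay o a) (g ∘ orbitRay o a)}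
      one_mem' := fun g => hconv.map g
      mul_mem' := fun {k k'} hk hk' g => ((hk' g).map k).trans hX (hk g)
      inv_mem' := fun {k} hk g => by
        have := ((hk g).map k⁻¹).symm
        have e : (k⁻¹ : X ≃ᵢ X) ∘ k ∘ g ∘ orbitRay o a = g ∘ orbitRay o a := by
          funext n
          simp
        rwa [e] at this }
  have hN : N.Normal := ⟨fun k hk n g => by
    have := (hk (n⁻¹ * g)).map n
    have e : n ∘ (n⁻¹ * g : X ≃ᵢ X) ∘ orbitRay o a = g ∘ orbitRay o a := by
      funext m
      simp
    rw [e] at this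
    exact this⟩
  have hmem : k ∈ N := fun g => by
    have := (hcon g).map g
    have e : g ∘ (g⁻¹ * k * g : X ≃ᵢ X) ∘ orbitRay o a = k ∘ g ∘ orbitRay o a := by
      funext m
      simp
    rwa [e] at this
  -- The points a⁺, g₁ a⁺ and a g₁ a⁺ are distinct because a fixes only its own ends. Fixing them
  -- bounds displacements on N, so the closure of N is a compact normal subgroup.
  let γ : Fin 3 → (X ≃ᵢ X) := ![1, g₁, a * g₁]
  have p01 : ¬ SameBoundaryPoint o (orbitRay o a) (g₁ ∘ orbitRay o a) := fun h => h1 h.symm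
  have p02 : ¬ SameBoundaryPoint o (orbitRay o a) (a ∘ g₁ ∘ orbitRay o a) := fun h =>
    p01 (SameBoundaryPoint.of_map (g := a) (ha.same_map_self.symm.trans hX h))
  have p12 : ¬ SameBoundaryPoint o (g₁ ∘ orbitRay o a) (a ∘ g₁ ∘ orbitRay o a) := by
    have := ha.not_same_pow_mul hX (hconv.map g₁) h1 h2 (i := 0) (j := 1) (by decide)
    rw [pow_one] at this
    exact this
  obtain ⟨R, hR⟩ := exists_dist_le_of_fixes_three hX (o := o) (x := fun i => γ i ∘ orbitRay o a)
    (fun i => hconv.map _) (by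
      intro i j hij
      fin_cases i <;> fin_cases j
      · exact absurd rfl hij
      · exact p01
      · exact p02
      · exact fun h => p01 h.symm
      · exact absurd rfl hij
      · exact p12
      · exact fun h => p02 h.symm
      · exact fun h => p12 h.symm
      · exact absurd rfl hij)
  have hsub : (N : Set (X ≃ᵢ X)) ⊆ {g | dist o (g o) ≤ R} := fun k hk => hR k fun i => hk (γ i)
  have hcomp : IsCompact (N.topologicalClosure : Set (X ≃ᵢ X)) := by
    rw [Subgroup.topologicalClosure_coe]
    exact (isCompact_setOf_dist_le o R).of_isClosed_subset isClosed_closure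
      (closure_minimal hsub (isClosed_setOf_dist_le o R))
  have hle : N.topologicalClosure ≤ ellipticRadical X :=
    le_sSup ⟨Subgroup.is_normal_topologicalClosure N, hcomp⟩
  rw [hrad] at hle
  exact hk ((Subgroup.mem_bot).1 (hle (N.le_topologicalClosure hmem)))

end IsLoxodromic

/-- The path from o to gkg⁻¹ o starts along g and then makes only a detour of size d(o, k o). A
conjugate with large displacement thus moves o in the direction of g o, and so does its inverse. -/
theorem le_gromovProduct_conj (g k : X ≃ᵢ X) (o : X) :
    (dist o ((g * k * g⁻¹) o) - dist o (k o)) / 2 ≤ gromovProduct o ((g * k * g⁻¹) o) (g o) := by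
  have h1 : dist ((g * k * g⁻¹) o) (g o) ≤ dist o (g o) + dist o (k o) := by
    rw [IsometryEquiv.mul_apply, IsometryEquiv.mul_apply, g.dist_eq]
    have := dist_triangle (k ((g⁻¹ : X ≃ᵢ X) o)) (k o) o
    rw [k.dist_eq, dist_comm ((g⁻¹ : X ≃ᵢ X) o), dist_self_inv_apply, dist_comm (k o) o] at this
    exact this
  unfold gromovProduct
  linarith [dist_comm (g o) o, dist_comm o ((g * k * g⁻¹) o)]

/-- Isometries close to one which moves the attracting end of `a` can be conjugated so that products
of different conjugates are hyperbolic. -/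
theorem IsLoxodromic.exists_nhds_conj (hX : FourPoint X δ) (ha : IsLoxodromic o a B)
    {c : ℕ → X ≃ᵢ X}
    (hc : ∀ i j, i ≠ j →
      ¬ SameBoundaryPoint o (c i ∘ orbitRay o a⁻¹) (c j ∘ orbitRay o a⁻¹))
    {k₁ : X ≃ᵢ X} (hk₁ : ¬ SameBoundaryPoint o (k₁ ∘ orbitRay o a) (orbitRay o a)) :
    ∃ V : Set (X ≃ᵢ X), IsOpen V ∧ k₁ ∈ V ∧ (∀ k ∈ V, dist o (k o) ≤ dist o (k₁ o) + 1) ∧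
      ∀ m : ℕ, ∃ g : Fin m → (X ≃ᵢ X), ∀ i j, i ≠ j → ∀ k ∈ V, ∀ k' ∈ V,
        HasLargeSquare δ o ((g i * k * (g i)⁻¹) * (g j * k' * (g j)⁻¹)) := by
  have hδ := hX.nonneg o
  have hconv := ha.convergesAtInfinity
  obtain ⟨C, N₀, hC⟩ := exists_gromovProduct_le hX (hconv.map k₁) hconv hk₁
  obtain ⟨N₁, hN₁⟩ := ha.exists_dist_ge (C + 1 + 2 * δ + B + (dist o (k₁ o) + 1) + 1)
  set K := dist o (k₁ o) + 1 with hK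
  have hK0 : 0 ≤ K := by positivity
  set N := max N₀ N₁ with hN
  have hPN := hN₁ N (le_max_right _ _)
  have hkN := hC N (le_max_left _ _) N (le_max_left _ _)
  -- That k moves a⁺ is visible at the finite stage a^N o: this open condition on k persists along
  -- the whole ray beyond a^N o.
  refine ⟨{k | dist (k ((a ^ N) o)) (k₁ ((a ^ N) o)) < 1} ∩ {k | dist (k o) (k₁ o) < 1},
    (isOpen_setOf_dist_lt _ _ _).inter (isOpen_setOf_dist_lt _ _ _), by simp, ?_, ?_⟩
  · rintro k ⟨-, hk⟩
    simp only [Set.mem_ofPred_eq] at hk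
    linarith [dist_triangle_right o (k o) (k₁ o)]
  intro m
  have key : ∀ k : X ≃ᵢ X, dist (k ((a ^ N) o)) (k₁ ((a ^ N) o)) < 1 → dist (k o) (k₁ o) < 1 →
      ∀ n ≥ N, gromovProduct o (k ((a ^ n) o)) ((a ^ n) o) ≤ C + 1 + 2 * δ := by
    intro k h1 h2 n hn
    have hkK : dist o (k o) ≤ K := by linarith [dist_triangle_right o (k o) (k₁ o)]
    have h3 := ha.le_gromovProduct hn
    have h4 := gromovProduct_isometry_ge k o ((a ^ N) o) ((a ^ n) o)
    refine hX.le_of_lt₂ (x := k ((a ^ N) o)) (y := (a ^ N) o) ?_ (by linarith) (by linarith)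
    have := gromovProduct_le_add_dist_left o (k ((a ^ N) o)) (k₁ ((a ^ N) o)) ((a ^ N) o)
    have h5 : gromovProduct o (k₁ ((a ^ N) o)) ((a ^ N) o) ≤ C := hkN
    linarith
  obtain ⟨E, N₂, hE⟩ := exists_gromovProduct_le_of_finite hX (o := o)
    (x := fun i : Fin m => c i ∘ orbitRay o a⁻¹) (fun i => ha.inv.convergesAtInfinity.map _)
    (fun i j hij => hc i j fun h => hij (Fin.ext h))
  obtain ⟨D, hD⟩ := (Set.finite_range fun i : Fin m => dist o (c i o)).bddAbove
  have hD : ∀ i : Fin m, dist o (c i o) ≤ D := fun i => hD ⟨i, rfl⟩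
  -- The threshold makes the displacement of every conjugate at least 2E + 12δ + K + 1. Here 2E +
  -- 12δ + 1 is what `HasLargeSquare.mul` requires for directions with product at most E + 2δ, and K
  -- absorbs d(o, k o) in `le_gromovProduct_conj`.
  obtain ⟨N₃, hN₃⟩ := ha.exists_dist_ge
    (2 * E + 12 * δ + 2 * K + 1 + 2 * (C + 1 + 2 * δ) + 2 * D)
  set n := max N (max N₂ N₃) with hn
  have hPn := hN₃ n (by simp [hn])
  -- The factor a⁻ⁿ carries o towards a⁻, and c i sends a⁻ to distinct points, so the g i o point in
  -- different directions. Seen from o, conjugated elements act as k does near aⁿ o, where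
  -- displacement is about 2 d(o, aⁿ o).
  refine ⟨fun i => c i * (a ^ n)⁻¹, ?_⟩
  intro i j hij
  have hq : gromovProduct o ((c i * (a ^ n)⁻¹ : X ≃ᵢ X) o) ((c j * (a ^ n)⁻¹ : X ≃ᵢ X) o) ≤ E := by
    have := hE i j hij n (by simp [hn]) n (by simp [hn])
    simpa only [Function.comp_apply, orbitRay_inv_apply, IsometryEquiv.mul_apply] using this
  have hlarge : ∀ (i : Fin m) (k : X ≃ᵢ X), dist (k ((a ^ N) o)) (k₁ ((a ^ N) o)) < 1 →
      dist (k o) (k₁ o) < 1 → 2 * E + 12 * δ + K + 1 ≤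
        dist o ((c i * (a ^ n)⁻¹ * k * (c i * (a ^ n)⁻¹)⁻¹ : X ≃ᵢ X) o) := by
    intro i k h1 h2
    have hkK : dist o (k o) ≤ K := by linarith [dist_triangle_right o (k o) (k₁ o)]
    have h3 := key k h1 h2 n (le_max_left _ _)
    set y := (((c i * (a ^ n)⁻¹)⁻¹ : X ≃ᵢ X)) o with hy
    have e : dist o ((c i * (a ^ n)⁻¹ * k * (c i * (a ^ n)⁻¹)⁻¹ : X ≃ᵢ X) o) = dist y (k y) := by
      rw [mul_assoc, IsometryEquiv.mul_apply, ← dist_inv_apply, IsometryEquiv.mul_apply]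
    have hyP : dist y ((a ^ n) o) ≤ D := by
      rw [hy, mul_inv_rev, inv_inv, IsometryEquiv.mul_apply, (a ^ n).dist_eq, dist_comm,
        dist_self_inv_apply]
      exact hD i
    rw [e]
    have h4 := dist_triangle4 ((a ^ n) o) y (k y) (k ((a ^ n) o))
    rw [k.dist_eq, dist_comm _ y] at h4
    have h5 := dist_triangle (k o) (k ((a ^ n) o)) o
    have h6 := dist_triangle (k ((a ^ n) o)) (k o) o
    have h7 := dist_triangle (k o) o (k ((a ^ n) o))
    rw [k.dist_eq] at h5 h6 h7
    unfold gromovProduct at h3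
    linarith [dist_comm (k o) o, dist_comm ((a ^ n) o) o, dist_comm (k ((a ^ n) o)) o,
      dist_comm ((a ^ n) o) (k ((a ^ n) o)), dist_nonneg (x := o) (y := (a ^ n) o)]
  rintro k ⟨hk1, hk2⟩ k' ⟨hk1', hk2'⟩
  simp only [Set.mem_ofPred_eq] at hk1 hk2 hk1' hk2'
  have hkK : dist o (k o) ≤ K := by linarith [dist_triangle_right o (k o) (k₁ o)]
  have hkK' : dist o (k' o) ≤ K := by linarith [dist_triangle_right o (k' o) (k₁ o)]
  have l1 := hlarge i k hk1 hk2
  have l2 := hlarge j k' hk1' hk2'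
  have inv_eq : ∀ g k : X ≃ᵢ X, g * k⁻¹ * g⁻¹ = (g * k * g⁻¹)⁻¹ := fun g k => by group
  have m1 := le_gromovProduct_conj (c i * (a ^ n)⁻¹) k o
  have m2 := le_gromovProduct_conj (c j * (a ^ n)⁻¹) k' o
  have m1' := le_gromovProduct_conj (c i * (a ^ n)⁻¹) k⁻¹ o
  have m2' := le_gromovProduct_conj (c j * (a ^ n)⁻¹) k'⁻¹ o
  rw [inv_eq, dist_self_inv_apply, dist_self_inv_apply] at m1' m2'
  rw [gromovProduct_comm] at m1 m2 m1' m2'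
  have c1 := hX.le_of_lt₂ hq (lt_of_lt_of_le (by linarith) m1) (lt_of_lt_of_le (by linarith) m2')
  have c2 := hX.le_of_lt₂ hq (lt_of_lt_of_le (by linarith) m1') (lt_of_lt_of_le (by linarith) m2)
  exact HasLargeSquare.mul hX c1 c2 (by linarith) (by linarith)

/-- In a nonelementary isometry group without compact normal subgroup, which is not focal, a
nontrivial element has a neighbourhood `V` which can be conjugated so that products of elements of
different conjugates are hyperbolic. -/
theorem exists_nhds_conj_isHyperbolicIsometry [ProperSpace X] (hX : FourPoint X δ)
    (hrad : ellipticRadical X = ⊥)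
    {s : Fin 3 → ℕ → (X ≃ᵢ X)} (hs : ∀ i, ConvergesAtInfinity o fun n => s i n o)
    (hne : ∀ i j, i ≠ j → ¬ SameBoundaryPoint o (fun n => s i n o) (fun n => s j n o))
    (hF : ∀ (a : X ≃ᵢ X) (B : ℝ), IsLoxodromic o a B →
      (∀ g : X ≃ᵢ X, SameBoundaryPoint o (g ∘ orbitRay o a) (orbitRay o a)) →
      ∀ g : X ≃ᵢ X, SameBoundaryPoint o (g ∘ orbitRay o a⁻¹) (orbitRay o a⁻¹))
    {k₀ : X ≃ᵢ X} (hk₀ : k₀ ≠ 1) :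
    ∃ V : Set (X ≃ᵢ X), IsOpen V ∧ k₀ ∈ V ∧ (∃ R, ∀ k ∈ V, dist o (k o) ≤ R) ∧
      ∀ m : ℕ, ∃ g : Fin m → (X ≃ᵢ X), ∀ i j, i ≠ j → ∀ k ∈ V, ∀ k' ∈ V,
        IsHyperbolicIsometry ((g i * k * (g i)⁻¹) * (g j * k' * (g j)⁻¹)) := by
  obtain ⟨a, ha'⟩ := exists_hasLargeSquare hX (hs 0) (hs 1) (hne 0 1 (by decide))
  obtain ⟨B, ha⟩ := ha'.isLoxodromic hX
  obtain ⟨g₁, h1, h2⟩ := ha.exists_not_same hX hs hne (hF a B ha)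
  -- Used for the conjugators: g₂ a⁻ is not an end of a, so the points aⁱ g₂ a⁻ are pairwise
  -- distinct. The element g₁ plays this role for a⁺ in the argument on the radical.
  obtain ⟨g₂, h3, h4⟩ := ha.inv.exists_not_same hX hs hne (hF _ B ha.inv)
  rw [inv_inv] at h4
  obtain ⟨g, hg⟩ := ha.exists_conj_not_same hX hrad h1 h2 hk₀
  obtain ⟨V, hV, hkV, hVR, hVm⟩ := ha.exists_nhds_conj hX (c := fun i => a ^ i * g₂)
    (fun i j hij => ha.not_same_pow_mul hX (ha.inv.convergesAtInfinity.map g₂) h4 h3 hij) hg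
  refine ⟨(fun k => g⁻¹ * k * g) ⁻¹' V, hV.preimage (by fun_prop), hkV,
    ⟨2 * dist o (g o) + (dist o ((g⁻¹ * k₀ * g) o) + 1), fun k hk => ?_⟩, fun m => ?_⟩
  · have h5 := hVR _ hk
    have e : k = g * ((g⁻¹ * k * g) * g⁻¹) := by group
    rw [e]
    have h6 := dist_mul_apply_le g ((g⁻¹ * k * g) * g⁻¹) o
    have h7 := dist_mul_apply_le (g⁻¹ * k * g) g⁻¹ o
    rw [dist_self_inv_apply] at h7
    linarith
  · obtain ⟨f, hf⟩ := hVm m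
    refine ⟨fun i => f i * g⁻¹, fun i j hij k hk k' hk' => ?_⟩
    have h5 := (hf i j hij _ hk _ hk').isHyperbolicIsometry hX
    have e : ∀ i k, f i * g⁻¹ * k * (f i * g⁻¹)⁻¹ = f i * (g⁻¹ * k * g) * (f i)⁻¹ := fun i k => by
      group
    rwa [e, e]

end IndependentConjugates

/-! ### Unimodular groups, fundamental domains and quotient measures -/

section UnimodularGroup

variable {G : Type*} [Group G] [TopologicalSpace G] [IsTopologicalGroup G] [T2Space G]
  [LocallyCompactSpace G] [SecondCountableTopology G] [MeasurableSpace G] [BorelSpace G]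

instance Subgroup.instSecondCountableTopology {G : Type*} [Group G] [TopologicalSpace G]
    [SecondCountableTopology G] (H : Subgroup G) : SecondCountableTopology H :=
  Topology.IsInducing.subtypeVal.secondCountableTopology

theorem Subgroup.countable_of_discrete {G : Type*} [Group G] [TopologicalSpace G]
    [SecondCountableTopology G] (H : Subgroup G) [DiscreteTopology H] : Countable H :=
  TopologicalSpace.separableSpace_iff_countable.1 inferInstance

/-- A bi-invariant Haar measure is invariant under inversion. -/
theorem isInvInvariant_of_isMulRightInvariant (μ : Measure G) [μ.IsHaarMeasure]
    [μ.IsMulRightInvariant] : μ.IsInvInvariant := by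
  constructor
  have hmeas : Measurable (Inv.inv : G → G) := measurable_inv
  have hfin : IsFiniteMeasureOnCompacts μ.inv := ⟨fun K hK => by
    rw [Measure.inv_apply]
    exact hK.inv.measure_lt_top⟩
  let c : ℝ≥0∞ := ((Measure.haarScalarFactor μ.inv μ : ℝ≥0) : ℝ≥0∞)
  have hc : μ.inv = c • μ := Measure.isMulLeftInvariant_eq_smul μ.inv μ
  obtain ⟨K⟩ : Nonempty (TopologicalSpace.PositiveCompacts G) := inferInstance
  have hinv : μ.inv.inv = μ := Measure.inv_inv μ
  -- Inverting twice is the identity, so the scalar c satisfies c² = 1.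
  have h1 : μ.inv.inv = c ^ 2 • μ := by
    ext s hs
    rw [Measure.inv_apply, hc, Measure.smul_apply, Measure.smul_apply, ← Measure.inv_apply, hc,
      Measure.smul_apply, smul_eq_mul, smul_eq_mul, smul_eq_mul, pow_two, mul_assoc]
  have h2 : c ^ 2 * μ K = 1 ^ 2 * μ K := by
    conv_rhs => rw [← hinv, h1]
    simp
  have h3 : c ^ 2 = 1 ^ 2 :=
    (ENNReal.mul_left_inj (Measure.measure_pos_of_nonempty_interior _ K.interior_nonempty).ne'
      K.isCompact.measure_lt_top.ne).1 h2
  have h4 : c = 1 := (ENNReal.pow_right_strictMono two_ne_zero).injective h3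
  rw [hc, h4, one_smul]

theorem measure_mul_right_preimage (μ : Measure G) [μ.IsHaarMeasure] (g : G) {A : Set G}
    (hA : MeasurableSet A) :
    μ ((fun x => x * g) ⁻¹' A) = Measure.modularCharacter g * μ A := by
  rw [← Measure.map_apply (measurable_mul_const g) hA,
    Measure.map_right_mul_eq_modularCharacterFun_smul]
  rfl

theorem isMulRightInvariant_of_modularCharacter (μ : Measure G) [μ.IsHaarMeasure]
    (h : ∀ g : G, Measure.modularCharacter g = 1) : μ.IsMulRightInvariant :=
  ⟨fun g => by
    rw [Measure.map_right_mul_eq_modularCharacterFun_smul]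
    have : Measure.modularCharacterFun g = 1 := h g
    rw [this, one_smul]⟩

/-- Δ(g) is a ratio μ(K g⁻¹) / μ(K), that is, an integral depending measurably on the parameter g.
-/
theorem measurable_modularCharacter : Measurable (Measure.modularCharacter : G → ℝ≥0) := by
  obtain ⟨K⟩ : Nonempty (TopologicalSpace.PositiveCompacts G) := inferInstance
  set μ : Measure G := Measure.haar
  have hK : MeasurableSet (K : Set G) := K.isCompact.measurableSet
  have h0 : μ K ≠ 0 := (Measure.measure_pos_of_nonempty_interior _ K.interior_nonempty).ne'
  have hT : μ K ≠ ∞ := K.isCompact.measure_lt_top.ne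
  have key : ∀ g : G, (Measure.modularCharacter g : ℝ≥0∞) =
      (∫⁻ x, (K : Set G).indicator 1 (x * g) ∂μ) / μ K := by
    intro g
    have : ∫⁻ x, (K : Set G).indicator 1 (x * g) ∂μ = μ ((fun x => x * g) ⁻¹' K) := by
      rw [← lintegral_indicator_one (hK.preimage (measurable_mul_const g))]
      rfl
    rw [this, measure_mul_right_preimage μ g hK, ENNReal.mul_div_cancel_right h0 hT]
  have hm : Measurable fun g : G => ∫⁻ x, (K : Set G).indicator (1 : G → ℝ≥0∞) (x * g) ∂μ := by
    refine Measurable.lintegral_prod_right'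
      (f := fun p : G × G => (K : Set G).indicator (1 : G → ℝ≥0∞) (p.2 * p.1)) ?_
    exact (measurable_one.indicator hK).comp (measurable_snd.mul measurable_fst)
  have : Measurable fun g : G => (Measure.modularCharacter g : ℝ≥0∞) := by
    simp_rw [key]
    exact hm.div_const _
  simpa using this.ennreal_toNNReal

open scoped Pointwise in
/-- If `G = Z C` with `Z` central and `C` compact, then `G` is unimodular. -/
theorem isMulRightInvariant_of_central_cocompact (μ : Measure G) [μ.IsHaarMeasure] {C : Set G}
    (hC : IsCompact C) (h : ∀ g : G, ∃ z ∈ Subgroup.center G, ∃ c ∈ C, g = z * c) :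
    μ.IsMulRightInvariant := by
  refine isMulRightInvariant_of_modularCharacter μ ?_
  obtain ⟨K⟩ : Nonempty (TopologicalSpace.PositiveCompacts G) := inferInstance
  have hK : MeasurableSet (K : Set G) := K.isCompact.measurableSet
  have h0 : μ K ≠ 0 := (Measure.measure_pos_of_nonempty_interior _ K.interior_nonempty).ne'
  have hT : μ K ≠ ∞ := K.isCompact.measure_lt_top.ne
  -- Left and right translations by a central element coincide. The modular character is therefore
  -- determined on C, hence bounded, and a bounded character with values in the positive reals is
  -- trivial.
  have hcenter : ∀ z ∈ Subgroup.center G, Measure.modularCharacter z = 1 := by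
    intro z hz
    have h1 := measure_mul_right_preimage μ z hK
    have e : (fun x : G => x * z) = fun x => z * x := by
      funext x
      exact (Subgroup.mem_center_iff.1 hz x)
    rw [e, measure_preimage_mul] at h1
    have h2 : (1 : ℝ≥0∞) * μ K = Measure.modularCharacter z * μ K := by rw [one_mul]; exact h1
    have := (ENNReal.mul_left_inj h0 hT).1 h2
    exact_mod_cast this.symm
  have hbound : ∃ M : ℝ≥0, ∀ g : G, Measure.modularCharacter g ≤ M := by
    have hKC : IsCompact ((K : Set G) * C⁻¹) := K.isCompact.mul hC.inv
    refine ⟨(μ ((K : Set G) * C⁻¹) / μ K).toNNReal, fun g => ?_⟩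
    obtain ⟨z, hz, c, hc, rfl⟩ := h g
    rw [map_mul, hcenter z hz, one_mul]
    have hne : μ ((K : Set G) * C⁻¹) / μ K ≠ ∞ :=
      ENNReal.div_ne_top hKC.measure_lt_top.ne h0
    refine ENNReal.le_toNNReal_of_coe_le ?_ hne
    rw [ENNReal.le_div_iff_mul_le (Or.inl h0) (Or.inl hT), ← measure_mul_right_preimage μ c hK]
    refine measure_mono fun x hx => ⟨x * c, hx, c⁻¹, Set.inv_mem_inv.2 hc, by group⟩
  obtain ⟨M, hM⟩ := hbound
  have hle : ∀ g : G, Measure.modularCharacter g ≤ 1 := by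
    intro g
    by_contra hlt
    push Not at hlt
    obtain ⟨n, hn⟩ := pow_unbounded_of_one_lt M hlt
    have := hM (g ^ n)
    rw [map_pow] at this
    exact absurd this (not_le.2 hn)
  intro g
  refine le_antisymm (hle g) ?_
  have h1 := hle g⁻¹
  have h2 : Measure.modularCharacter g * Measure.modularCharacter g⁻¹ = (1 : ℝ≥0) := by
    rw [← map_mul, mul_inv_cancel, map_one]
  calc (1 : ℝ≥0) = Measure.modularCharacter g * Measure.modularCharacter g⁻¹ := h2.symm
    _ ≤ Measure.modularCharacter g * 1 := by gcongr
    _ = _ := mul_one _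

end UnimodularGroup

/-! ### Strict fundamental domains of discrete subgroups -/

section FundamentalDomain

variable {G : Type*} [Group G] [TopologicalSpace G] [IsTopologicalGroup G]
  [SecondCountableTopology G] [MeasurableSpace G] [BorelSpace G]

/-- A discrete subgroup has a Borel strict fundamental domain for right translations. -/
theorem exists_measurableSet_existsUnique_mul_mem (Λ : Subgroup G) [DiscreteTopology Λ] :
    ∃ E : Set G, MeasurableSet E ∧ ∀ g : G, ∃! z : Λ, g * z ∈ E := by
  have hcount := Λ.countable_of_discrete
  obtain ⟨O, hO, hOΛ⟩ := isOpen_induced_iff.1 (isOpen_discrete ({1} : Set Λ))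
  have h1O : (1 : G) ∈ O := by
    have : (1 : Λ) ∈ (Subtype.val ⁻¹' O : Set Λ) := by rw [hOΛ]; rfl
    exact this
  have hcont : Continuous fun p : G × G => p.1⁻¹ * p.2 := by fun_prop
  have hnhds : (fun p : G × G => p.1⁻¹ * p.2) ⁻¹' O ∈ 𝓝 ((1 : G), (1 : G)) :=
    (hO.preimage hcont).mem_nhds (by simpa using h1O)
  obtain ⟨u, v, hu, h1u, hv, h1v, huv⟩ := mem_nhds_prod_iff'.1 hnhds
  set W := u ∩ v
  have hW : IsOpen W := hu.inter hv
  have hWO : ∀ x ∈ W, ∀ y ∈ W, x⁻¹ * y ∈ O := fun x hx y hy =>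
    huv (Set.mk_mem_prod hx.1 hy.2)
  obtain ⟨s, hs, hsU⟩ := TopologicalSpace.countable_cover_nhds
    (f := fun x : G => (fun g => x⁻¹ * g) ⁻¹' W) fun x =>
      (hW.preimage (by fun_prop)).mem_nhds (by simpa using ⟨h1u, h1v⟩)
  have hsne : s.Nonempty := by
    by_contra hempty
    rw [Set.not_nonempty_iff_eq_empty] at hempty
    rw [hempty] at hsU
    simp only [Set.mem_empty_iff_false, Set.iUnion_of_empty, Set.iUnion_empty] at hsU
    exact Set.notMem_empty (1 : G) (hsU ▸ Set.mem_univ _)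
  obtain ⟨t, ht⟩ := hs.exists_eq_range hsne
  have hcover : ∀ g : G, ∃ n, (t n)⁻¹ * g ∈ W := by
    intro g
    have : g ∈ ⋃ x ∈ s, (fun g => x⁻¹ * g) ⁻¹' W := hsU ▸ Set.mem_univ g
    obtain ⟨x, hx, hg⟩ := Set.mem_iUnion₂.1 this
    rw [ht] at hx
    obtain ⟨n, rfl⟩ := hx
    exact ⟨n, hg⟩
  -- Each translate t n W contains at most one point of every coset gΛ, because W⁻¹W meets Λ only in
  -- 1. The domain takes, in each coset, its point in the first translate which the coset meets; S n
  -- is the saturation of t n W.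
  let S : ℕ → Set G := fun n => ⋃ z : Λ, (fun g => (t n)⁻¹ * (g * z)) ⁻¹' W
  have hS : ∀ n, IsOpen (S n) := fun n => isOpen_iUnion fun z => hW.preimage (by fun_prop)
  have hSmul : ∀ n (g : G) (z : Λ), g * z ∈ S n ↔ g ∈ S n := by
    intro n g z
    simp only [S, Set.mem_iUnion, Set.mem_preimage]
    constructor
    · rintro ⟨y, hy⟩
      exact ⟨z * y, by simpa [mul_assoc] using hy⟩
    · rintro ⟨y, hy⟩
      exact ⟨z⁻¹ * y, by simpa [mul_assoc] using hy⟩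
  refine ⟨⋃ n, ((fun g => (t n)⁻¹ * g) ⁻¹' W) ∩ ⋂ m, ⋂ _ : m < n, (S m)ᶜ, ?_, ?_⟩
  · refine MeasurableSet.iUnion fun n => ?_
    refine (hW.preimage (by fun_prop)).measurableSet.inter ?_
    exact MeasurableSet.iInter fun m => MeasurableSet.iInter fun _ => (hS m).measurableSet.compl
  · intro g
    classical
    have hex : ∃ n, g ∈ S n := by
      obtain ⟨n, hn⟩ := hcover g
      exact ⟨n, Set.mem_iUnion.2 ⟨1, by simpa using hn⟩⟩
    have hiff : ∀ z : Λ, (g * z ∈ ⋃ n, ((fun g => (t n)⁻¹ * g) ⁻¹' W) ∩ ⋂ m, ⋂ _ : m < n, (S m)ᶜ) ↔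
        (t (Nat.find hex))⁻¹ * (g * z) ∈ W := by
      intro z
      simp only [Set.mem_iUnion, Set.mem_inter_iff, Set.mem_preimage, Set.mem_iInter,
        Set.mem_compl_iff, hSmul]
      constructor
      · rintro ⟨n, hn, hmin⟩
        have : n = Nat.find hex := by
          refine ((Nat.find_eq_iff hex).2 ⟨?_, hmin⟩).symm
          exact Set.mem_iUnion.2 ⟨z, hn⟩
        rwa [← this]
      · intro h
        exact ⟨_, h, fun m hm => Nat.find_min hex hm⟩
    obtain ⟨z, hz⟩ := Set.mem_iUnion.1 (Nat.find_spec hex)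
    refine ⟨z, (hiff z).2 hz, fun y hy => ?_⟩
    have h2 := hWO _ hz _ ((hiff y).1 hy)
    have h3 : z⁻¹ * y ∈ (Subtype.val ⁻¹' O : Set Λ) := by
      have e : ((t (Nat.find hex))⁻¹ * (g * z))⁻¹ * ((t (Nat.find hex))⁻¹ * (g * y)) =
          ((z⁻¹ * y : Λ) : G) := by
        push_cast
        group
      rw [e] at h2
      exact h2
    rw [hOΛ] at h3
    exact (inv_mul_eq_one.1 h3).symm

/-- Inverting a strict fundamental domain for right translations gives a fundamental domain for
left translations. -/
theorem isFundamentalDomain_inv (Λ : Subgroup G) (μ : Measure G) {E : Set G} (hE : MeasurableSet E)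
    (h : ∀ g : G, ∃! z : Λ, g * z ∈ E) : IsFundamentalDomain Λ E⁻¹ μ := by
  refine IsFundamentalDomain.mk' hE.inv.nullMeasurableSet fun x => ?_
  obtain ⟨z, hz, huniq⟩ := h x⁻¹
  refine ⟨z⁻¹, ?_, fun y hy => ?_⟩
  · simpa [Subgroup.smul_def] using hz
  · have := huniq y⁻¹ (by simpa [Subgroup.smul_def] using hy)
    rw [← this, inv_inv]

/-- `covolume` refers to the left action, so the domain is E⁻¹, and invariance under inversion
brings the measure back to E. -/
theorem covolume_eq_measure (Λ : Subgroup G) [DiscreteTopology Λ] (μ : Measure G)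
    [μ.IsMulLeftInvariant] [μ.IsInvInvariant] {E : Set G} (hE : MeasurableSet E)
    (h : ∀ g : G, ∃! z : Λ, g * z ∈ E) : covolume Λ G μ = μ E := by
  have := Λ.countable_of_discrete
  rw [(isFundamentalDomain_inv Λ μ hE h).covolume_eq_volume, Measure.measure_inv]

end FundamentalDomain

/-! ### Weil's integration formula -/

section QuotientMeasure

variable {G : Type*} [Group G]

/-- A right `H`-invariant function descends to `G ⧸ H` through the chosen representatives. -/
theorem apply_out_mk {α : Type*} {H : Subgroup G} {φ : G → α}
    (hφ : ∀ (g : G) (h : H), φ (g * h) = φ g) (g : G) : φ ((g : G ⧸ H).out) = φ g := by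
  obtain ⟨h, hh⟩ := QuotientGroup.mk_out_eq_mul H g
  rw [hh, hφ]

/-- The section `out` need not be measurable. For invariant φ the choice of representatives is
irrelevant, so measurability can be tested on G. -/
theorem measurable_apply_out {α : Type*} [MeasurableSpace α] [MeasurableSpace G] {H : Subgroup G}
    {φ : G → α} (hφ : ∀ (g : G) (h : H), φ (g * h) = φ g) (hm : Measurable φ) :
    Measurable fun x : G ⧸ H => φ x.out := by
  refine measurable_from_quotient.2 ?_
  have : (fun x : G ⧸ H => φ x.out) ∘ Quotient.mk'' = φ := by
    funext g
    exact apply_out_mk hφ g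
  rw [this]
  exact hm

variable [TopologicalSpace G] [IsTopologicalGroup G] [T2Space G]
  [LocallyCompactSpace G] [SecondCountableTopology G] [MeasurableSpace G] [BorelSpace G]

open scoped Pointwise in
/-- A Bruhat function: a function on `G` whose integral over each coset of `H` is `1`. -/
theorem exists_measurable_lintegral_mul_eq_one {H : Subgroup G} (hH : IsClosed (H : Set G))
    (η : Measure H) [η.IsHaarMeasure] :
    ∃ w : G → ℝ≥0∞, Measurable w ∧ ∀ g, ∫⁻ h : H, w (g * h) ∂η = 1 := by
  have : LocallyCompactSpace H := hH.isClosedEmbedding_subtypeVal.locallyCompactSpace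
  obtain ⟨K⟩ : Nonempty (TopologicalSpace.PositiveCompacts G) := inferInstance
  obtain ⟨p, hp⟩ := K.interior_nonempty
  obtain ⟨s, hs, hsU⟩ := TopologicalSpace.countable_cover_nhds
    (f := fun x : G => (fun g => p * x⁻¹ * g) ⁻¹' interior (K : Set G)) fun x =>
      (isOpen_interior.preimage (by fun_prop)).mem_nhds (by simpa using hp)
  have hsne : s.Nonempty := by
    by_contra hempty
    rw [Set.not_nonempty_iff_eq_empty] at hempty
    rw [hempty] at hsU
    simp only [Set.mem_empty_iff_false, Set.iUnion_of_empty, Set.iUnion_empty] at hsU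
    exact Set.notMem_empty (1 : G) (hsU ▸ Set.mem_univ _)
  obtain ⟨t, ht⟩ := hs.exists_eq_range hsne
  let A : ℕ → Set G := fun n => (fun g => p * (t n)⁻¹ * g) ⁻¹' (K : Set G)
  have hKm : MeasurableSet (K : Set G) := K.isCompact.measurableSet
  have hA : ∀ n, MeasurableSet (A n) := fun n => hKm.preimage (measurable_const_mul _)
  -- Two points of A n in the same coset of H differ by an element of Q, so η Q bounds the mass of A
  -- n on all cosets at once. This makes the weighted sum below finite; positivity holds because the
  -- interiors of the A n cover G.
  let Q : Set H := Subtype.val ⁻¹' ((K : Set G)⁻¹ * (K : Set G))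
  have hQ : IsCompact Q :=
    hH.isClosedEmbedding_subtypeVal.isCompact_preimage (K.isCompact.inv.mul K.isCompact)
  have hAQ : ∀ (n : ℕ) (g : G), ∫⁻ h : H, (A n).indicator 1 (g * h) ∂η ≤ η Q := by
    intro n g
    have hms : MeasurableSet ((fun h : H => g * h) ⁻¹' A n) :=
      (hA n).preimage (measurable_subtype_coe.const_mul g)
    have e : ∫⁻ h : H, (A n).indicator 1 (g * h) ∂η = η ((fun h : H => g * h) ⁻¹' A n) := by
      rw [← lintegral_indicator_one hms]
      rfl
    rw [e]
    rcases Set.eq_empty_or_nonempty ((fun h : H => g * h) ⁻¹' A n) with h0 | ⟨h₀, hh₀⟩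
    · rw [h0, measure_empty]
      exact zero_le
    · rw [← measure_preimage_mul η h₀]
      refine measure_mono fun h hh => ?_
      refine ⟨(p * (t n)⁻¹ * (g * h₀))⁻¹, Set.inv_mem_inv.2 hh₀,
        p * (t n)⁻¹ * (g * (h₀ * h : H)), hh, ?_⟩
      push_cast
      group
  let φ : G → ℝ≥0∞ := fun g => ∑' n, (2⁻¹ : ℝ≥0∞) ^ n * (A n).indicator 1 g
  have hind : ∀ n, Measurable ((A n).indicator (1 : G → ℝ≥0∞)) := fun n =>
    measurable_one.indicator (hA n)
  have hφ : Measurable φ := Measurable.tsum fun n => (hind n).const_mul _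
  let I : G → ℝ≥0∞ := fun g => ∫⁻ h : H, φ (g * h) ∂η
  have hcoe : Measurable fun q : G × H => q.1 * (q.2 : G) :=
    measurable_fst.mul (measurable_subtype_coe.comp measurable_snd)
  have hI : Measurable I :=
    Measurable.lintegral_prod_right' (f := fun q : G × H => φ (q.1 * q.2)) (hφ.comp hcoe)
  have hIeq : ∀ g, I g = ∑' n, (2⁻¹ : ℝ≥0∞) ^ n * ∫⁻ h : H, (A n).indicator 1 (g * h) ∂η := by
    intro g
    have hm : ∀ n, Measurable fun h : H => (A n).indicator (1 : G → ℝ≥0∞) (g * h) := fun n =>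
      (hind n).comp (measurable_subtype_coe.const_mul g)
    calc I g = ∫⁻ h : H, ∑' n, (2⁻¹ : ℝ≥0∞) ^ n * (A n).indicator 1 (g * h) ∂η := rfl
      _ = ∑' n, ∫⁻ h : H, (2⁻¹ : ℝ≥0∞) ^ n * (A n).indicator 1 (g * h) ∂η :=
        lintegral_tsum fun n => ((hm n).const_mul _).aemeasurable
      _ = _ := tsum_congr fun n => lintegral_const_mul _ (hm n)
  have hIT : ∀ g, I g ≠ ∞ := by
    intro g
    rw [hIeq]
    have : ∑' n, (2⁻¹ : ℝ≥0∞) ^ n * ∫⁻ h : H, (A n).indicator 1 (g * h) ∂η ≤ 2 * η Q := by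
      calc _ ≤ ∑' n, (2⁻¹ : ℝ≥0∞) ^ n * η Q :=
            ENNReal.tsum_le_tsum fun n => by gcongr; exact hAQ n g
        _ = 2 * η Q := by
          rw [ENNReal.tsum_mul_right, ENNReal.tsum_geometric, ENNReal.one_sub_inv_two, inv_inv]
    exact ne_top_of_le_ne_top (ENNReal.mul_ne_top (by simp) hQ.measure_lt_top.ne) this
  have hI0 : ∀ g, I g ≠ 0 := by
    intro g
    rw [hIeq]
    have hg : g ∈ ⋃ x ∈ s, (fun g => p * x⁻¹ * g) ⁻¹' interior (K : Set G) := hsU ▸ Set.mem_univ g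
    obtain ⟨x, hx, hgx⟩ := Set.mem_iUnion₂.1 hg
    rw [ht] at hx
    obtain ⟨n, rfl⟩ := hx
    intro h0
    have h1 := ENNReal.tsum_eq_zero.1 h0 n
    have hms : MeasurableSet ((fun h : H => g * h) ⁻¹' A n) :=
      (hA n).preimage (measurable_subtype_coe.const_mul g)
    have e : ∫⁻ h : H, (A n).indicator 1 (g * h) ∂η = η ((fun h : H => g * h) ⁻¹' A n) := by
      rw [← lintegral_indicator_one hms]
      rfl
    rw [e] at h1
    have hopen : IsOpen ((fun h : H => p * (t n)⁻¹ * (g * h)) ⁻¹' interior (K : Set G)) :=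
      isOpen_interior.preimage (by fun_prop)
    have hpos : 0 < η ((fun h : H => g * h) ⁻¹' A n) :=
      (hopen.measure_pos η ⟨1, by simpa using hgx⟩).trans_le
        (measure_mono fun h hh => interior_subset (s := (K : Set G)) hh)
    rcases mul_eq_zero.1 h1 with h2 | h2
    · simp at h2
    · exact hpos.ne' h2
  have hIinv : ∀ (g : G) (h : H), I (g * h) = I g := by
    intro g h
    have := lintegral_mul_left_eq_self (μ := η) (fun h' : H => φ (g * h')) h
    simp only [Subgroup.coe_mul, ← mul_assoc] at this
    exact this
  refine ⟨fun g => φ g / I g, hφ.div hI, fun g => ?_⟩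
  simp only [hIinv]
  simp only [div_eq_mul_inv]
  have hm : Measurable fun h : H => φ (g * h) := hφ.comp (measurable_subtype_coe.const_mul g)
  rw [lintegral_mul_const _ hm]
  exact ENNReal.mul_inv_cancel (hI0 g) (hIT g)

/-- Weil's formula: the quotient measure exists for a closed unimodular subgroup of a unimodular
group. -/
theorem exists_isQuotientMeasure (μ : Measure G) [μ.IsHaarMeasure] [μ.IsMulRightInvariant]
    {H : Subgroup G} (hH : IsClosed (H : Set G)) (η : Measure H) [η.IsHaarMeasure]
    [η.IsInvInvariant] : ∃ ν : Measure (G ⧸ H), IsQuotientMeasure μ η ν := by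
  have : LocallyCompactSpace H := hH.isClosedEmbedding_subtypeVal.locallyCompactSpace
  obtain ⟨w, hw, hw1⟩ := exists_measurable_lintegral_mul_eq_one hH η
  have hmk : Measurable (fun g : G => (g : G ⧸ H)) := measurable_quotient_mk''
  -- The weight w has mass 1 on each coset, so pushing w μ forward counts every coset once.
  refine ⟨(μ.withDensity w).map (fun g : G => (g : G ⧸ H)), fun f hf => ?_⟩
  have hcoe : Measurable fun q : G × H => q.1 * (q.2 : G) :=
    measurable_fst.mul (measurable_subtype_coe.comp measurable_snd)
  have hcoe' : Measurable fun q : G × H => q.1 * ((q.2)⁻¹ : G) :=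
    measurable_fst.mul (measurable_subtype_coe.comp measurable_snd).inv
  let J : G → ℝ≥0∞ := fun g => ∫⁻ h : H, f (g * h) ∂η
  have hJ : Measurable J :=
    Measurable.lintegral_prod_right' (f := fun q : G × H => f (q.1 * q.2)) (hf.comp hcoe)
  have hJinv : ∀ (g : G) (h : H), J (g * h) = J g := by
    intro g h
    have := lintegral_mul_left_eq_self (μ := η) (fun h' : H => f (g * h')) h
    simp only [Subgroup.coe_mul, ← mul_assoc] at this
    exact this
  have hJo : Measurable fun x : G ⧸ H => J x.out := measurable_apply_out hJinv hJ
  symm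
  calc ∫⁻ x : G ⧸ H, J x.out ∂((μ.withDensity w).map fun g : G => (g : G ⧸ H))
      = ∫⁻ g, J ((g : G ⧸ H).out) ∂(μ.withDensity w) := lintegral_map hJo hmk
    _ = ∫⁻ g, J g ∂(μ.withDensity w) := by simp_rw [apply_out_mk hJinv]
    _ = ∫⁻ g, w g * J g ∂μ := lintegral_withDensity_eq_lintegral_mul μ hw hJ
    _ = ∫⁻ g, ∫⁻ h : H, w g * f (g * h) ∂η ∂μ := by
      refine lintegral_congr fun g => ?_
      have hm : Measurable fun h : H => f (g * h) := hf.comp (measurable_subtype_coe.const_mul g)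
      rw [lintegral_const_mul _ hm]
    _ = ∫⁻ h : H, ∫⁻ g, w g * f (g * h) ∂μ ∂η :=
      lintegral_lintegral_swap ((hw.comp measurable_fst).mul (hf.comp hcoe)).aemeasurable
    -- Right invariance of μ moves h from f to w; inversion invariance of η then makes the integral
    -- of w over the coset equal to 1.
    _ = ∫⁻ h : H, ∫⁻ g, w (g * (h : G)⁻¹) * f g ∂μ ∂η := by
      refine lintegral_congr fun h => ?_
      rw [← lintegral_mul_right_eq_self (fun g => w (g * (h : G)⁻¹) * f g) (h : G)]
      simp only [mul_inv_cancel_right]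
    _ = ∫⁻ g, ∫⁻ h : H, w (g * (h : G)⁻¹) * f g ∂η ∂μ :=
      (lintegral_lintegral_swap
        ((hw.comp hcoe').mul (hf.comp measurable_fst)).aemeasurable).symm
    _ = ∫⁻ g, f g ∂μ := by
      refine lintegral_congr fun g => ?_
      have hm : Measurable fun h : H => w (g * (h : G)⁻¹) :=
        hw.comp (measurable_subtype_coe.inv.const_mul g)
      rw [lintegral_mul_const _ hm]
      have := lintegral_inv_eq_self (μ := η) (fun h : H => w (g * h))
      simp only [Subgroup.coe_inv] at this
      rw [this, hw1, one_mul]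

/-- Shows that `quotientMeasure` is not its default value 0 by failure of existence. -/
theorem isQuotientMeasure_quotientMeasure (μ : Measure G) [μ.IsHaarMeasure]
    [μ.IsMulRightInvariant] {H : Subgroup G} (hH : IsClosed (H : Set G)) (η : Measure H)
    [η.IsHaarMeasure] [η.IsInvInvariant] : IsQuotientMeasure μ η (quotientMeasure μ η) := by
  have h := exists_isQuotientMeasure μ hH η
  unfold quotientMeasure
  rw [dif_pos h]
  exact h.choose_spec

end QuotientMeasure

/-! ### Lattices -/

section Lattice

variable {G : Type*} [Group G] [TopologicalSpace G] [IsTopologicalGroup G] [T2Space G]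
  [LocallyCompactSpace G] [SecondCountableTopology G] [MeasurableSpace G] [BorelSpace G]
  {Γ : Subgroup G}

theorem tsum_mul_right_subgroup (F : G → ℝ≥0∞) (g : G) (h : Γ) :
    ∑' γ : Γ, F (g * h * γ) = ∑' γ : Γ, F (g * γ) := by
  rw [← (Equiv.mulLeft h).tsum_eq fun γ : Γ => F (g * γ)]
  simp [mul_assoc]

theorem measurable_tsum_subgroup [Countable Γ] {F : G → ℝ≥0∞} (hF : Measurable F) :
    Measurable fun g => ∑' γ : Γ, F (g * γ) :=
  Measurable.tsum fun _ => hF.comp (measurable_mul_const _)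

theorem smul_mk_eq (g x : G) : g • (x : G ⧸ Γ) = ((g * x : G) : G ⧸ Γ) := rfl

theorem measurable_smul_quotient (g : G) : Measurable fun x : G ⧸ Γ => g • x := by
  refine measurable_from_quotient.2 ?_
  exact measurable_quotient_mk''.comp (measurable_const_mul g)

namespace IsLattice

theorem lintegral_smul (h : IsLattice Γ) {φ : G ⧸ Γ → ℝ≥0∞} (hφ : Measurable φ) (g : G) :
    ∫⁻ x, φ (g • x) ∂h.invariantProbability = ∫⁻ x, φ x ∂h.invariantProbability := by
  have hinv : SMulInvariantMeasure G (G ⧸ Γ) h.invariantProbability :=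
    h.exists_invariant.choose_spec.2
  have hmap : h.invariantProbability.map (fun x => g • x) = h.invariantProbability := by
    ext s hs
    rw [Measure.map_apply (measurable_smul_quotient g) hs]
    exact hinv.measure_preimage_smul g hs
  conv_rhs => rw [← hmap]
  rw [lintegral_map hφ (measurable_smul_quotient g)]

/-- The measure on `G` which is the counting measure on the cosets of `Γ` and the invariant
probability measure transversally. -/
noncomputable def cosetMeasure (h : IsLattice Γ) : Measure G :=
  h.invariantProbability.bind fun x => Measure.sum fun γ : Γ => Measure.dirac (x.out * γ)

theorem lintegral_cosetMeasure (h : IsLattice Γ) {F : G → ℝ≥0∞} (hF : Measurable F) :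
    ∫⁻ g, F g ∂h.cosetMeasure = ∫⁻ x, ∑' γ : Γ, F (x.out * γ) ∂h.invariantProbability := by
  have := h.discrete
  have := Γ.countable_of_discrete
  have hκ : Measurable fun x : G ⧸ Γ =>
      Measure.sum fun γ : Γ => Measure.dirac (x.out * (γ : G)) := by
    refine Measure.measurable_of_measurable_coe _ fun s hs => ?_
    have e : (fun x : G ⧸ Γ => (Measure.sum fun γ : Γ => Measure.dirac (x.out * (γ : G))) s) =
        fun x : G ⧸ Γ => ∑' γ : Γ, s.indicator 1 (x.out * (γ : G)) := by
      funext x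
      rw [Measure.sum_apply _ hs]
      exact tsum_congr fun γ => Measure.dirac_apply' _ hs
    rw [e]
    exact measurable_apply_out (φ := fun g => ∑' γ : Γ, s.indicator 1 (g * (γ : G)))
      (fun g γ => tsum_mul_right_subgroup _ g γ)
      (measurable_tsum_subgroup (measurable_one.indicator hs))
  unfold cosetMeasure
  rw [Measure.lintegral_bind hκ.aemeasurable hF.aemeasurable]
  refine lintegral_congr fun x => ?_
  rw [lintegral_sum_measure]
  exact tsum_congr fun γ => lintegral_dirac' _ hF

instance isMulLeftInvariant_cosetMeasure (h : IsLattice Γ) : h.cosetMeasure.IsMulLeftInvariant := by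
  have := h.discrete
  have := Γ.countable_of_discrete
  refine (forall_measure_preimage_mul_iff _).1 fun g A hA => ?_
  have hm : Measurable (A.indicator (1 : G → ℝ≥0∞)) := measurable_one.indicator hA
  rw [← lintegral_indicator_one hA, ← lintegral_indicator_one (hA.preimage (measurable_const_mul g)),
    h.lintegral_cosetMeasure hm,
    h.lintegral_cosetMeasure (measurable_one.indicator (hA.preimage (measurable_const_mul g)))]
  rw [← h.lintegral_smul (measurable_apply_out (φ := fun g => ∑' γ : Γ, A.indicator 1 (g * (γ : G)))
      (fun g γ => tsum_mul_right_subgroup _ g γ) (measurable_tsum_subgroup hm)) g]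
  refine lintegral_congr fun x => ?_
  induction x using QuotientGroup.induction_on with
  | H y =>
    rw [smul_mk_eq, apply_out_mk (φ := fun g => ∑' γ : Γ, A.indicator 1 (g * (γ : G)))
      (fun g γ => tsum_mul_right_subgroup _ g γ) (g * y),
      apply_out_mk (φ := fun y => ∑' γ : Γ,
        ((fun h => g * h) ⁻¹' A).indicator 1 (y * (γ : G)))
      (fun g γ => tsum_mul_right_subgroup _ g γ) y]
    refine tsum_congr fun γ => ?_
    rw [mul_assoc]
    rfl

theorem finite_inter_isCompact [DiscreteTopology Γ] {K : Set G} (hK : IsCompact K) :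
    {γ : Γ | (γ : G) ∈ K}.Finite := by
  have hcl : IsClosed (Γ : Set G) := Subgroup.isClosed_of_discrete
  have : IsCompact (Subtype.val ⁻¹' K : Set Γ) := hcl.isClosedEmbedding_subtypeVal.isCompact_preimage hK
  exact this.finite_of_discrete

-- If a coset gΓ meets K, it can be recentred at a point of K, after which all its points in K
-- correspond to elements of Γ ∩ K⁻¹K. This finite set bounds the count uniformly.
open scoped Pointwise in
instance isFiniteMeasureOnCompacts_cosetMeasure (h : IsLattice Γ) :
    IsFiniteMeasureOnCompacts h.cosetMeasure := by
  have := h.discrete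
  refine ⟨fun K hK => ?_⟩
  have hKm := hK.measurableSet
  have hfin : {γ : Γ | (γ : G) ∈ K⁻¹ * K}.Finite := finite_inter_isCompact (hK.inv.mul hK)
  have hbound : ∀ g : G, ∑' γ : Γ, K.indicator (1 : G → ℝ≥0∞) (g * γ) ≤
      ∑' γ : Γ, (K⁻¹ * K).indicator (1 : G → ℝ≥0∞) γ := by
    intro g
    by_cases hg : ∃ γ₀ : Γ, g * γ₀ ∈ K
    · obtain ⟨γ₀, hγ₀⟩ := hg
      rw [← tsum_mul_right_subgroup _ g γ₀]
      refine ENNReal.tsum_le_tsum fun γ => ?_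
      by_cases hγ : g * γ₀ * γ ∈ K
      · have hmem : (γ : G) ∈ K⁻¹ * K :=
          ⟨(g * γ₀)⁻¹, Set.inv_mem_inv.2 hγ₀, g * γ₀ * γ, hγ, by group⟩
        rw [Set.indicator_of_mem hγ, Set.indicator_of_mem hmem]
        rfl
      · rw [Set.indicator_of_notMem hγ]
        exact zero_le
    · push Not at hg
      have : ∀ γ : Γ, K.indicator (1 : G → ℝ≥0∞) (g * γ) = 0 := fun γ =>
        Set.indicator_of_notMem (hg γ) _
      simp [this]
  rw [← lintegral_indicator_one hKm, h.lintegral_cosetMeasure (measurable_one.indicator hKm)]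
  refine (lintegral_mono fun x : G ⧸ Γ => hbound (Quotient.out x)).trans_lt ?_
  rw [lintegral_const, measure_univ, mul_one]
  rw [tsum_eq_sum (s := hfin.toFinset) (fun γ hγ =>
    Set.indicator_of_notMem (by simpa using hγ) _)]
  exact ENNReal.sum_lt_top.2 fun γ _ => (Set.indicator_le_self _ _ _).trans_lt (by simp)

variable (μ : Measure G) [μ.IsHaarMeasure]

/-- The normalising constant between the coset measure and the Haar measure. -/
theorem exists_lintegral_eq (h : IsLattice Γ) : ∃ c : ℝ≥0∞, c ≠ 0 ∧ c ≠ ∞ ∧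
    ∀ F : G → ℝ≥0∞, Measurable F →
      ∫⁻ x, ∑' γ : Γ, F (x.out * γ) ∂h.invariantProbability = c * ∫⁻ g, F g ∂μ := by
  have hc := Measure.isMulLeftInvariant_eq_smul h.cosetMeasure μ
  refine ⟨(h.cosetMeasure.haarScalarFactor μ : ℝ≥0), ?_, ENNReal.coe_ne_top, fun F hF => ?_⟩
  · intro h0
    have h0' : h.cosetMeasure.haarScalarFactor μ = 0 := by exact_mod_cast h0
    rw [h0', zero_smul] at hc
    have h1 := h.lintegral_cosetMeasure (F := fun _ => 1) measurable_const
    rw [hc, lintegral_zero_measure] at h1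
    have h2 : (1 : ℝ≥0∞) ≤ ∫⁻ x, ∑' γ : Γ, 1 ∂h.invariantProbability := by
      calc (1 : ℝ≥0∞) = ∫⁻ x, 1 ∂h.invariantProbability := by simp
        _ ≤ _ := lintegral_mono fun x => ENNReal.le_tsum (f := fun _ : Γ => (1 : ℝ≥0∞)) 1
    rw [← h1] at h2
    simp at h2
  · rw [← h.lintegral_cosetMeasure hF]
    conv_lhs => rw [hc]
    rw [lintegral_smul_measure]
    rfl

/-- Right translation by γ permutes the points of each coset gΓ. The sum over a coset, and hence
Haar measure, does not notice it. -/
theorem modularCharacter_eq_one_of_mem (h : IsLattice Γ) (γ : Γ) :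
    Measure.modularCharacter (γ : G) = 1 := by
  obtain ⟨K⟩ : Nonempty (TopologicalSpace.PositiveCompacts G) := inferInstance
  set μ : Measure G := Measure.haar
  have hK : MeasurableSet (K : Set G) := K.isCompact.measurableSet
  have h0 : μ K ≠ 0 := (Measure.measure_pos_of_nonempty_interior _ K.interior_nonempty).ne'
  have hT : μ K ≠ ∞ := K.isCompact.measure_lt_top.ne
  obtain ⟨c, hc0, hcT, hc⟩ := h.exists_lintegral_eq μ
  have h1 := hc _ (measurable_one.indicator hK)
  have h2 := hc _ (measurable_one.indicator (hK.preimage (measurable_mul_const (γ : G))))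
  rw [lintegral_indicator_one hK] at h1
  rw [lintegral_indicator_one (hK.preimage (measurable_mul_const (γ : G))),
    measure_mul_right_preimage μ _ hK] at h2
  have h3 : ∀ x : G ⧸ Γ, ∑' γ' : Γ, ((fun x => x * (γ : G)) ⁻¹' (K : Set G)).indicator
      (1 : G → ℝ≥0∞) (x.out * γ') = ∑' γ' : Γ, (K : Set G).indicator (1 : G → ℝ≥0∞) (x.out * γ') := by
    intro x
    rw [← (Equiv.mulRight γ).tsum_eq fun γ' : Γ => (K : Set G).indicator (1 : G → ℝ≥0∞) (x.out * γ')]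
    refine tsum_congr fun γ' => ?_
    rw [Equiv.coe_mulRight, Subgroup.coe_mul, ← mul_assoc]
    rfl
  simp_rw [h3] at h2
  rw [h1] at h2
  have h4 := (ENNReal.mul_right_inj hc0 hcT).1 h2
  have h5 : (1 : ℝ≥0∞) * μ K = Measure.modularCharacter (γ : G) * μ K := by rwa [one_mul]
  have := (ENNReal.mul_left_inj h0 hT).1 h5
  exact_mod_cast this.symm

/-- A group which contains a lattice is unimodular. -/
theorem isMulRightInvariant (h : IsLattice Γ) : μ.IsMulRightInvariant := by
  refine isMulRightInvariant_of_modularCharacter μ ?_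
  have hinv : ∀ (g : G) (γ : Γ), Measure.modularCharacter (g * γ : G) = Measure.modularCharacter g :=
    fun g γ => by rw [map_mul, h.modularCharacter_eq_one_of_mem, mul_one]
  have hle : ∀ g : G, Measure.modularCharacter g ≤ 1 := by
    intro g
    by_contra hlt
    push Not at hlt
    -- Δ descends to G ⧸ Γ. If Δ(g) > 1, translation by g strictly decreases the integral of ψ ∘ Δ,
    -- contradicting invariance; ψ serves to have a bounded, strictly decreasing function.
    let ψ : ℝ≥0 → ℝ≥0∞ := fun t => (1 + (t : ℝ≥0∞))⁻¹
    have hψ : Measurable ψ := (measurable_coe_nnreal_ennreal.const_add 1).inv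
    have hm : Measurable fun x : G ⧸ Γ => ψ (Measure.modularCharacter x.out) :=
      measurable_apply_out (φ := fun g => ψ (Measure.modularCharacter g))
        (fun g γ => by rw [hinv]) (hψ.comp measurable_modularCharacter)
    have h1 := h.lintegral_smul hm g
    refine (lintegral_strict_mono (μ := h.invariantProbability)
      (f := fun x : G ⧸ Γ => ψ (Measure.modularCharacter (g • x).out))
      (g := fun x : G ⧸ Γ => ψ (Measure.modularCharacter x.out))
      (IsProbabilityMeasure.ne_zero _) hm.aemeasurable ?_ ?_).ne h1
    · refine ((lintegral_mono (g := fun _ => 1) fun x => ?_).trans_lt (by simp)).ne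
      exact ENNReal.inv_le_one.2 le_self_add
    · refine ae_of_all _ fun x => ?_
      induction x using QuotientGroup.induction_on with
      | H y =>
        rw [smul_mk_eq, apply_out_mk hinv, apply_out_mk hinv, map_mul]
        refine ENNReal.inv_lt_inv.2 (ENNReal.add_lt_add_left ENNReal.one_ne_top ?_)
        have hpos : 0 < (Measure.modularCharacter y : ℝ≥0) := Measure.modularCharacterFun_pos y
        exact_mod_cast lt_mul_of_one_lt_left hpos hlt
  intro g
  refine le_antisymm (hle g) ?_
  have h2 : Measure.modularCharacter g * Measure.modularCharacter g⁻¹ = (1 : ℝ≥0) := by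
    rw [← map_mul, mul_inv_cancel, map_one]
  calc (1 : ℝ≥0) = Measure.modularCharacter g * Measure.modularCharacter g⁻¹ := h2.symm
    _ ≤ Measure.modularCharacter g * 1 := by gcongr; exact hle _
    _ = _ := mul_one _

/-- The unfolding formula for a lattice. -/
theorem covolume_mul_lintegral (h : IsLattice Γ) :
    covolume Γ G μ ≠ 0 ∧ covolume Γ G μ ≠ ∞ ∧ ∀ F : G → ℝ≥0∞, Measurable F →
      ∫⁻ x, ∑' γ : Γ, F (x.out * γ) ∂h.invariantProbability =
        (∫⁻ g, F g ∂μ) / covolume Γ G μ := by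
  have := h.discrete
  have := h.isMulRightInvariant μ
  have := isInvInvariant_of_isMulRightInvariant μ
  obtain ⟨E, hE, hEu⟩ := exists_measurableSet_existsUnique_mul_mem Γ
  obtain ⟨c, hc0, hcT, hc⟩ := h.exists_lintegral_eq μ
  -- Testing on a strict fundamental domain identifies the constant as the inverse covolume.
  have h1 := hc _ (measurable_one.indicator hE)
  have h2 : ∀ g : G, ∑' γ : Γ, E.indicator (1 : G → ℝ≥0∞) (g * γ) = 1 := by
    intro g
    obtain ⟨z, hz, huniq⟩ := hEu g
    rw [tsum_eq_single z fun y hy => Set.indicator_of_notMem (fun hy' => hy (huniq y hy')) _,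
      Set.indicator_of_mem hz]
    rfl
  simp_rw [h2] at h1
  rw [lintegral_one, measure_univ, lintegral_indicator_one hE, ← covolume_eq_measure Γ μ hE hEu] at h1
  have h3 : covolume Γ G μ = c⁻¹ :=
    ENNReal.eq_inv_of_mul_eq_one_left (by rw [mul_comm]; exact h1.symm)
  refine ⟨?_, ?_, fun F hF => ?_⟩
  · rw [h3]
    exact ENNReal.inv_ne_zero.2 hcT
  · rw [h3]
    exact ENNReal.inv_ne_top.2 hc0
  · rw [hc F hF, h3, div_eq_mul_inv, inv_inv, mul_comm]

end IsLattice

end Lattice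

/-! ### Unfolding and orbital integrals -/

section OrbitalSum

variable {G : Type*} [Group G] [TopologicalSpace G] [IsTopologicalGroup G] [T2Space G]
  [LocallyCompactSpace G] [SecondCountableTopology G] [MeasurableSpace G] [BorelSpace G]
  {Γ : Subgroup G}

theorem isClosed_centraliser (γ : G) : IsClosed (centraliser γ : Set G) := by
  have : (centraliser γ : Set G) = {g | γ * g = g * γ} := by
    ext g
    simp [Subgroup.mem_centralizer_iff]
  rw [this]
  exact isClosed_eq (by fun_prop) (by fun_prop)

theorem conj_mul_of_mem_centraliser {γ h : G} (hh : h ∈ centraliser γ) (g : G) :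
    g * h * γ * (g * h)⁻¹ = g * γ * g⁻¹ := by
  have : γ * h = h * γ := Subgroup.mem_centralizer_iff.1 hh γ rfl
  rw [mul_assoc g h γ, ← this]
  group

theorem discreteTopology_of_le {Γ Λ : Subgroup G} [DiscreteTopology Γ] (h : Λ ≤ Γ) :
    DiscreteTopology Λ :=
  DiscreteTopology.of_subset (s := (Γ : Set G)) (t := (Λ : Set G)) inferInstance h

theorem discreteTopology_subgroupOf (Γ H : Subgroup G) [DiscreteTopology Γ] :
    DiscreteTopology (Γ.subgroupOf H) := by
  have hinj : Function.Injective fun x : Γ.subgroupOf H => (⟨(x : H), x.2⟩ : Γ) := fun x y hxy =>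
    Subtype.ext (Subtype.ext (congrArg (Subtype.val : Γ → G) hxy))
  exact DiscreteTopology.of_continuous_injective (by fun_prop) hinj

variable (μ : Measure G) [μ.IsHaarMeasure] [μ.IsMulRightInvariant]

/-- Integrating over `G` the conjugates of `γ` cut off by a fundamental domain of `Γ_γ`. -/
theorem lintegral_indicator_mul_conj [DiscreteTopology Γ] {γ : G} (η : Measure (centraliser γ))
    [η.IsHaarMeasure] [η.IsMulRightInvariant] {E : Set G} (hE : MeasurableSet E)
    (hEu : ∀ g : G, ∃! z : (Γ ⊓ centraliser γ : Subgroup G), g * z ∈ E)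
    {f : G → ℝ≥0∞} (hf : Measurable f) :
    ∫⁻ g, E.indicator 1 g * f (g * γ * g⁻¹) ∂μ =
      centraliserCovolume Γ γ η * orbitalIntegral μ γ η f := by
  have hcl := isClosed_centraliser γ
  have : LocallyCompactSpace (centraliser γ) := hcl.isClosedEmbedding_subtypeVal.locallyCompactSpace
  have := isInvInvariant_of_isMulRightInvariant η
  have := discreteTopology_subgroupOf Γ (centraliser γ)
  have hconj : Measurable fun g : G => f (g * γ * g⁻¹) :=
    hf.comp ((measurable_id.mul_const γ).mul measurable_inv)
  -- Each slice of E along a coset of G_γ is a fundamental domain for Γ_γ in G_γ, so the inner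
  -- integral in Weil's formula is a constant covolume.
  have hcov : ∀ g : G, ∫⁻ h : centraliser γ, E.indicator 1 (g * h) ∂η =
      centraliserCovolume Γ γ η := by
    intro g
    have hE' : MeasurableSet ((fun h : centraliser γ => g * (h : G)) ⁻¹' E) :=
      hE.preimage (measurable_subtype_coe.const_mul g)
    unfold centraliserCovolume
    rw [covolume_eq_measure (Γ.subgroupOf (centraliser γ)) η hE' ?_, ← lintegral_indicator_one hE']
    · rfl
    · intro h
      obtain ⟨⟨z, hz1, hz2⟩, hz, huniq⟩ := hEu (g * h)
      refine ⟨⟨⟨z, hz2⟩, Subgroup.mem_subgroupOf.2 hz1⟩, ?_, fun y hy => ?_⟩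
      · have hz' : g * ((h : G) * z) ∈ E := by
          rw [← mul_assoc]
          exact hz
        exact hz'
      · have hy' : g * (h : G) * ((y : centraliser γ) : G) ∈ E := by
          rw [mul_assoc]
          exact hy
        have := huniq ⟨((y : centraliser γ) : G), y.2, (y : centraliser γ).2⟩ hy'
        have hyz : ((y : centraliser γ) : G) = z := congrArg Subtype.val this
        exact Subtype.ext (Subtype.ext hyz)
  have hm : Measurable fun g : G => E.indicator 1 g * f (g * γ * g⁻¹) :=
    (measurable_one.indicator hE).mul hconj
  rw [isQuotientMeasure_quotientMeasure μ hcl η _ hm]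
  unfold orbitalIntegral
  have hF : Measurable fun x : G ⧸ centraliser γ => f (x.out * γ * x.out⁻¹) :=
    measurable_apply_out (φ := fun g => f (g * γ * g⁻¹))
      (fun g h => by rw [conj_mul_of_mem_centraliser h.2]) hconj
  rw [← lintegral_const_mul _ hF]
  refine lintegral_congr fun x => ?_
  have hind : Measurable fun h : centraliser γ => E.indicator (1 : G → ℝ≥0∞) (x.out * (h : G)) :=
    (measurable_one.indicator hE).comp (measurable_subtype_coe.const_mul x.out)
  rw [← hcov x.out, ← lintegral_mul_const _ hind]
  refine lintegral_congr fun h => ?_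
  simp only [conj_mul_of_mem_centraliser h.2]

theorem exists_conj_classRep (γ : Γ) :
    ∃ δ : Γ, (δ : G) * classRep (ConjClasses.mk γ) * (δ : G)⁻¹ = γ := by
  have h : IsConj (Quotient.out (s := IsConj.setoid Γ) (ConjClasses.mk γ)) γ :=
    Quotient.mk_out (s := IsConj.setoid Γ) γ
  obtain ⟨δ, hδ⟩ := isConj_iff.1 h
  exact ⟨δ, congrArg (Subtype.val : Γ → G) hδ⟩

/-- The geometric side of the trace formula bounds the average number of elements of a random
conjugate of `Γ`, weighted by `f`. -/
theorem IsLattice.lintegral_tsum_conj_le (hΓ : IsLattice Γ) (η : ∀ γ : G, Measure (centraliser γ))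
    [∀ γ, (η γ).IsHaarMeasure] {p : G → Prop} (hp : ∀ g γ : G, p (g * γ * g⁻¹) → p γ)
    (hη : ∀ γ, p γ → (η γ).IsMulRightInvariant) {f : G → ℝ≥0∞} (hf : Measurable f) :
    ∫⁻ x, ∑' γ : {γ : Γ // p γ}, f (x.out * (γ.1 : G) * x.out⁻¹) ∂hΓ.invariantProbability ≤
      (∑' c : {c : ConjClasses Γ // p (classRep c)},
        centraliserCovolume Γ (classRep c.1) (η (classRep c.1)) *
          orbitalIntegral μ (classRep c.1) (η (classRep c.1)) f) / covolume Γ G μ := by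
  have := hΓ.discrete
  have := Γ.countable_of_discrete
  have hcount : Countable (ConjClasses Γ) :=
    Function.Surjective.countable (f := ConjClasses.mk) ConjClasses.mk_surjective
  have hdom : ∀ c : {c : ConjClasses Γ // p (classRep c)}, ∃ E : Set G, MeasurableSet E ∧
      ∀ g : G, ∃! z : (Γ ⊓ centraliser (classRep c.1) : Subgroup G), g * z ∈ E := fun c =>
    have := discreteTopology_of_le (Γ := Γ) (Λ := Γ ⊓ centraliser (classRep c.1)) inf_le_left
    exists_measurableSet_existsUnique_mul_mem _
  choose E hE hEu using hdom
  let Φ : {c : ConjClasses Γ // p (classRep c)} → G → ℝ≥0∞ := fun c g =>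
    (E c).indicator 1 g * f (g * classRep c.1 * g⁻¹)
  have hΦ : ∀ c, Measurable (Φ c) := fun c => (measurable_one.indicator (hE c)).mul
    (hf.comp ((measurable_id.mul_const _).mul measurable_inv))
  have hle : ∀ g : G, ∑' γ : {γ : Γ // p γ}, f (g * (γ.1 : G) * g⁻¹) ≤
      ∑' c, ∑' δ : Γ, Φ c (g * δ) := by
    intro g
    -- Write γ = δ r δ⁻¹ with r the representative of its class. Since δ is free modulo Γ ∩ G_r, it
    -- can be chosen with gδ in the fundamental domain. The pair (class, δ) determines γ, and this
    -- injectivity suffices for the inequality.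
    have hex : ∀ γ : {γ : Γ // p γ}, ∃ q : {c : ConjClasses Γ // p (classRep c)} × Γ,
        (q.2 : G) * classRep q.1.1 * (q.2 : G)⁻¹ = γ.1 ∧ g * q.2 ∈ E q.1 := by
      rintro ⟨γ, hγ⟩
      obtain ⟨δ, hδ⟩ := exists_conj_classRep γ
      let c : {c : ConjClasses Γ // p (classRep c)} :=
        ⟨ConjClasses.mk γ, hp δ _ (by rw [hδ]; exact hγ)⟩
      obtain ⟨z, hz, -⟩ := hEu c (g * δ)
      refine ⟨(c, δ * ⟨z, z.2.1⟩), ?_, ?_⟩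
      · rw [Subgroup.coe_mul, conj_mul_of_mem_centraliser z.2.2]
        exact hδ
      · rw [Subgroup.coe_mul, ← mul_assoc]
        exact hz
    choose q hq1 hq2 using hex
    have hinj : Function.Injective q := fun γ γ' h =>
      Subtype.ext (Subtype.ext (by rw [← hq1 γ, ← hq1 γ', h]))
    rw [← ENNReal.tsum_prod]
    calc ∑' γ : {γ : Γ // p γ}, f (g * (γ.1 : G) * g⁻¹)
        = ∑' γ, (fun r : {c : ConjClasses Γ // p (classRep c)} × Γ => Φ r.1 (g * r.2)) (q γ) := by
          refine tsum_congr fun γ => ?_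
          simp only [Φ]
          rw [Set.indicator_of_mem (hq2 γ), Pi.one_apply, one_mul, ← hq1 γ]
          congr 1
          group
      _ ≤ _ := ENNReal.tsum_comp_le_tsum_of_injective hinj _
  have hm : ∀ c, Measurable fun x : G ⧸ Γ => ∑' δ : Γ, Φ c (x.out * δ) := fun c =>
    measurable_apply_out (φ := fun g => ∑' δ : Γ, Φ c (g * δ))
      (fun g γ => tsum_mul_right_subgroup _ g γ) (measurable_tsum_subgroup (hΦ c))
  calc _ ≤ ∫⁻ x : G ⧸ Γ, ∑' c, ∑' δ : Γ, Φ c (x.out * δ) ∂hΓ.invariantProbability :=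
        lintegral_mono fun x => hle x.out
    _ = ∑' c, ∫⁻ x : G ⧸ Γ, ∑' δ : Γ, Φ c (x.out * δ) ∂hΓ.invariantProbability :=
        lintegral_tsum fun c => (hm c).aemeasurable
    _ = ∑' c : {c : ConjClasses Γ // p (classRep c)},
          (centraliserCovolume Γ (classRep c.1) (η (classRep c.1)) *
          orbitalIntegral μ (classRep c.1) (η (classRep c.1)) f) / covolume Γ G μ := by
        refine tsum_congr fun c => ?_
        have := hη _ c.2
        rw [(hΓ.covolume_mul_lintegral μ).2.2 _ (hΦ c),
          lintegral_indicator_mul_conj μ (η (classRep c.1)) (hE c) (hEu c) hf]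
    _ = _ := by simp_rw [div_eq_mul_inv, ENNReal.tsum_mul_right]

end OrbitalSum

/-! ### Unimodularity: centralisers and exclusion of the focal case -/

section UnimodularIsometryGroup

variable {X : Type*} [MetricSpace X] {δ : ℝ} {o : X} {a : X ≃ᵢ X} {B : ℝ}

/-- The centraliser of a hyperbolic isometry is unimodular. -/
theorem IsHyperbolicIsometry.isMulRightInvariant_centraliser [ProperSpace X] (hX : FourPoint X δ)
    (o : X) {γ : X ≃ᵢ X} (hγ : IsHyperbolicIsometry γ) (η : Measure (centraliser γ))
    [η.IsHaarMeasure] : η.IsMulRightInvariant := by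
  have hcl := isClosed_centraliser γ
  have : LocallyCompactSpace (centraliser γ) := hcl.isClosedEmbedding_subtypeVal.locallyCompactSpace
  obtain ⟨N, hN⟩ := hγ.exists_pow_hasLargeSquare o δ
  obtain ⟨B, hB⟩ := hN.isLoxodromic hX
  set b := γ ^ N with hb
  have hcomm : ∀ z ∈ centraliser γ, Commute z b := fun z hz => by
    have : γ * z = z * γ := Subgroup.mem_centralizer_iff.1 hz γ rfl
    exact (show Commute z γ from this.symm).pow_right N
  have hbc : b ∈ centraliser γ := Subgroup.mem_centralizer_iff.2 fun h hh => by
    rw [Set.mem_singleton_iff.1 hh, hb]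
    exact (Commute.refl γ).pow_right N
  -- An isometry commuting with b fixes both ends of b, so it carries o near the orbit of o under
  -- ⟨b⟩. The centraliser is thus the central ⟨b⟩ times a compact set.
  have key : ∀ z ∈ centraliser γ, ∃ k : ℤ, dist (z o) ((b ^ k) o) ≤ 4 * B + 6 * δ + dist o (b o) := by
    intro z hz
    have hsame : ∀ c : X ≃ᵢ X, Commute z c → ConvergesAtInfinity o (orbitRay o c) →
        SameBoundaryPoint o (z ∘ orbitRay o c) (orbitRay o c) := fun c hc hconv => by
      refine (SameBoundaryPoint.of_dist_le (C := dist o (z o)) hconv fun n => ?_).symm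
      rw [Function.comp_apply, orbitRay_apply, ← IsometryEquiv.mul_apply, (hc.pow_right n).eq,
        IsometryEquiv.mul_apply, (c ^ n).dist_eq]
    refine hB.exists_dist_zpow_le hX (hsame b (hcomm z hz) hB.convergesAtInfinity)
      (hsame b⁻¹ (hcomm z hz).inv_right hB.inv.convergesAtInfinity) fun i => ?_
    rw [Function.comp_apply, Function.comp_apply, gromovProduct_isometry]
    exact hB.gromovProduct_orbitRay_le i i
  refine isMulRightInvariant_of_central_cocompact η
    (hcl.isClosedEmbedding_subtypeVal.isCompact_preimage
      (isCompact_setOf_dist_le o (4 * B + 6 * δ + dist o (b o)))) fun z => ?_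
  obtain ⟨k, hk⟩ := key z z.2
  refine ⟨⟨b, hbc⟩ ^ k, ?_, (⟨b, hbc⟩ ^ k)⁻¹ * z, ?_, by group⟩
  · refine Subgroup.zpow_mem _ ?_ k
    exact Subgroup.mem_center_iff.2 fun g => Subtype.ext (hcomm g g.2)
  · have e : (((⟨b, hbc⟩ ^ k)⁻¹ * z : centraliser γ) : X ≃ᵢ X) = (b ^ k)⁻¹ * z := by
      push_cast
      rfl
    rw [Set.mem_preimage, e]
    change dist o (((b ^ k)⁻¹ * z : X ≃ᵢ X) o) ≤ _
    rw [IsometryEquiv.mul_apply, dist_apply_inv, dist_comm]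
    exact hk

/-- An isometry which fixes the attracting end of `a` moves the points of the ray `aⁿ o` by a bounded
amount. -/
theorem IsLoxodromic.dist_apply_orbitRay_le (hX : FourPoint X δ) (ha : IsLoxodromic o a B)
    {g : X ≃ᵢ X} (hg : SameBoundaryPoint o (g ∘ orbitRay o a) (orbitRay o a)) (n : ℕ) :
    dist (g ((a ^ n) o)) ((a ^ n) o) ≤ 2 * B + 3 * dist o (g o) + 4 * δ := by
  have hδ := hX.nonneg o
  have hB : 0 ≤ B := (gromovProduct_nonneg _ _ _).trans (ha.gromovProduct_le 0 0)
  obtain ⟨N, hN⟩ := sameBoundaryPoint_iff.1 hg (dist o ((a ^ n) o))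
  set i := max N n
  have h1 := hN i (le_max_left _ _) i (le_max_left _ _)
  rw [Function.comp_apply, orbitRay_apply] at h1
  have h2 := ha.le_gromovProduct (le_max_right N n)
  have h3 := gromovProduct_isometry_ge g o ((a ^ n) o) ((a ^ i) o)
  have hgo : 0 ≤ dist o (g o) := dist_nonneg
  have h2' : dist o ((a ^ n) o) - B ≤ gromovProduct o ((a ^ n) o) ((a ^ i) o) := h2
  -- The comparison runs from g aⁿ o via g aⁱ o and aⁱ o to aⁿ o, all in the direction of a⁺. Two
  -- points at nearly equal distance from o with nearly maximal product are close.
  have h4 : dist o ((a ^ n) o) - B - dist o (g o) - δ ≤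
      gromovProduct o (g ((a ^ n) o)) ((a ^ i) o) := by
    rcases hX.gromovProduct_or o (g ((a ^ n) o)) ((a ^ i) o) (g ((a ^ i) o)) with h | h <;> linarith
  have h5 : dist o ((a ^ n) o) - B - dist o (g o) - 2 * δ ≤
      gromovProduct o (g ((a ^ n) o)) ((a ^ n) o) := by
    rw [gromovProduct_comm] at h2'
    rcases hX.gromovProduct_or o (g ((a ^ n) o)) ((a ^ n) o) ((a ^ i) o) with h | h <;> linarith
  have h6 := dist_triangle (g ((a ^ n) o)) (g o) o
  rw [g.dist_eq] at h6
  unfold gromovProduct at h5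
  linarith [dist_comm (g o) o, dist_comm ((a ^ n) o) o]

/-- A unimodular isometry group which fixes one end of a loxodromic isometry fixes the other one. -/
theorem IsLoxodromic.same_inv_of_forall_same [ProperSpace X] (hX : FourPoint X δ)
    (μ : Measure (X ≃ᵢ X)) [μ.IsHaarMeasure] [μ.IsMulRightInvariant] (ha : IsLoxodromic o a B)
    (hfix : ∀ g : X ≃ᵢ X, SameBoundaryPoint o (g ∘ orbitRay o a) (orbitRay o a)) (k : X ≃ᵢ X) :
    SameBoundaryPoint o (k ∘ orbitRay o a⁻¹) (orbitRay o a⁻¹) := by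
  by_contra hk
  have hconv := ha.inv.convergesAtInfinity
  obtain ⟨C, N, hC⟩ := exists_gromovProduct_le hX (hconv.map k) hconv hk
  -- As k moves a⁻, the displacements of the y i are unbounded. This yields arbitrarily many
  -- disjoint translates S i of a neighbourhood of 1, all of the same Haar measure.
  let y : ℕ → X ≃ᵢ X := fun i => a ^ i * k * (a ^ i)⁻¹
  have hy : ∀ T : ℝ, ∃ i, T ≤ dist o (y i o) := by
    intro T
    obtain ⟨M, hM⟩ := ha.exists_dist_ge (T + dist o (k o) + 2 * C)
    set i := max M N
    have h1 := hC i (le_max_right _ _) i (le_max_right _ _)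
    have h2 := hM i (le_max_left _ _)
    refine ⟨i, ?_⟩
    have e : dist o (y i o) = dist ((orbitRay o a⁻¹) i) (k (orbitRay o a⁻¹ i)) := by
      rw [orbitRay_inv_apply, dist_inv_apply]
      rfl
    rw [Function.comp_apply] at h1
    have h3 : dist o ((orbitRay o a⁻¹) i) = dist o ((a ^ i) o) := by
      rw [orbitRay_inv_apply, dist_self_inv_apply]
    have h4 := dist_triangle (k o) o (k (orbitRay o a⁻¹ i))
    rw [k.dist_eq] at h4
    have h5 : 0 ≤ dist o ((a ^ i) o) := dist_nonneg
    have h6 : 0 ≤ gromovProduct o (k (orbitRay o a⁻¹ i)) (orbitRay o a⁻¹ i) :=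
      gromovProduct_nonneg _ _ _
    have h7 : 0 ≤ dist o (k o) := dist_nonneg
    rw [e]
    have h8 := dist_comm (k (orbitRay o a⁻¹ i)) (orbitRay o a⁻¹ i)
    unfold gromovProduct at h1 h6
    linarith [dist_comm (k (orbitRay o a⁻¹ i)) o, dist_comm (orbitRay o a⁻¹ i) o,
      dist_comm (k o) o]
  set D := (2 * B + 3 * dist o (k o) + 4 * δ) + (2 * B + 3 + 4 * δ) with hD
  set K₀ : Set (X ≃ᵢ X) := {g | dist o (g o) ≤ D} with hK₀
  have hK₀c : IsCompact K₀ := isCompact_setOf_dist_le o D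
  let S : ℕ → Set (X ≃ᵢ X) := fun i => (fun g => (y i)⁻¹ * g) ⁻¹' {g | dist (g o) o < 1}
  have hU : IsOpen {g : X ≃ᵢ X | dist (g o) o < 1} := isOpen_setOf_dist_lt o o 1
  have hS : ∀ i, μ (S i) = μ {g | dist (g o) o < 1} := fun i => measure_preimage_mul μ _ _
  have hSm : ∀ i, MeasurableSet (S i) := fun i => (hU.preimage (by fun_prop)).measurableSet
  have hSy : ∀ i, ∀ g ∈ S i, dist (g o) (y i o) < 1 := fun i g hg => by
    have : dist (((y i)⁻¹ * g : X ≃ᵢ X) o) o < 1 := hg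
    rwa [IsometryEquiv.mul_apply, dist_inv_apply] at this
  have hfam : ∀ M : ℕ, ∃ T : Finset ℕ, T.card = M ∧ (T : Set ℕ).PairwiseDisjoint S := by
    intro M
    induction M with
    | zero => exact ⟨∅, rfl, by simp⟩
    | succ M ih =>
      obtain ⟨T, hT, hTd⟩ := ih
      obtain ⟨b, hb⟩ := (T.finite_toSet.image fun i => dist o (y i o)).bddAbove
      obtain ⟨i, hi⟩ := hy (b + 2)
      have hdist : ∀ j ∈ T, dist o (y j o) + 2 ≤ dist o (y i o) := fun j hj => by
        have := hb ⟨j, hj, rfl⟩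
        simp only at this
        linarith
      have hiT : i ∉ T := fun h => by linarith [hdist i h]
      refine ⟨insert i T, by rw [Finset.card_insert_of_notMem hiT, hT], ?_⟩
      rw [Finset.coe_insert]
      refine hTd.insert fun j hj _ => Set.disjoint_left.2 fun g hg hg' => ?_
      have h1 := hSy i g hg
      have h2 := hSy j g hg'
      linarith [hdist j hj, dist_triangle4 o (y j o) (g o) (y i o), dist_comm (g o) (y j o)]
  -- Everything fixes a⁺, so points of the forward ray move boundedly: y i moves aⁿ o as much as k
  -- moves aⁿ⁻ⁱ o, which is why i ≤ n is needed. Conjugation by a⁻ⁿ thus packs all these S i into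
  -- the compact K₀; it preserves a bi-invariant measure, whence the contradiction.
  have hsub : ∀ n : ℕ, ∀ i ≤ n, S i ⊆ (fun g => (a ^ n)⁻¹ * g * a ^ n) ⁻¹' K₀ := by
    intro n i hi g hg
    have hb : dist (((y i)⁻¹ * g : X ≃ᵢ X) o) o < 1 := hg
    set b := (y i)⁻¹ * g with hbdef
    have hgb : g = y i * b := by rw [hbdef]; group
    change dist o (((a ^ n)⁻¹ * g * a ^ n : X ≃ᵢ X) o) ≤ D
    rw [mul_assoc, IsometryEquiv.mul_apply, dist_apply_inv, IsometryEquiv.mul_apply, hgb,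
      IsometryEquiv.mul_apply]
    have h1 := ha.dist_apply_orbitRay_le hX (hfix b) n
    have h2 := ha.dist_apply_orbitRay_le hX (hfix k) (n - i)
    have h3 : dist (y i ((a ^ n) o)) ((a ^ n) o) =
        dist (k ((a ^ (n - i)) o)) ((a ^ (n - i)) o) := by
      have e : a ^ n = a ^ i * a ^ (n - i) := by rw [← pow_add, Nat.add_sub_cancel' hi]
      have e2 : y i ((a ^ n) o) = (a ^ i) (k ((a ^ (n - i)) o)) := by
        rw [← IsometryEquiv.mul_apply, ← IsometryEquiv.mul_apply, ← IsometryEquiv.mul_apply, e]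
        congr 1
        simp only [y]
        group
      rw [e2, e, IsometryEquiv.mul_apply, (a ^ i).dist_eq]
    have h4 := dist_triangle (y i (b ((a ^ n) o))) (y i ((a ^ n) o)) ((a ^ n) o)
    rw [(y i).dist_eq] at h4
    rw [dist_comm]
    linarith [dist_comm (b o) o]
  have hpos : 0 < μ {g : X ≃ᵢ X | dist (g o) o < 1} :=
    hU.measure_pos μ ⟨1, by simp⟩
  have hfin : μ K₀ ≠ ∞ := hK₀c.measure_lt_top.ne
  obtain ⟨M, hM⟩ := ENNReal.exists_nat_mul_gt hpos.ne' hfin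
  obtain ⟨T, hT, hTd⟩ := hfam M
  set n := T.sup id
  have h1 : μ (⋃ i ∈ T, S i) = M * μ {g | dist (g o) o < 1} := by
    rw [measure_biUnion_finset hTd fun i _ => hSm i]
    simp [hS, hT]
  have h2 : μ ((fun g => (a ^ n)⁻¹ * g * a ^ n) ⁻¹' K₀) = μ K₀ := by
    have e : (fun g => (a ^ n)⁻¹ * g * a ^ n) ⁻¹' K₀ =
        (fun g => (a ^ n)⁻¹ * g) ⁻¹' ((fun g => g * a ^ n) ⁻¹' K₀) := rfl
    rw [e, measure_preimage_mul, measure_preimage_mul_right]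
  have h3 : μ (⋃ i ∈ T, S i) ≤ μ K₀ := by
    rw [← h2]
    exact measure_mono (Set.iUnion₂_subset fun i hi => hsub n i (Finset.le_sup (f := id) hi))
  rw [h1] at h3
  exact absurd hM (not_lt.2 h3)

end UnimodularIsometryGroup

/-! ### Second moment estimates -/

section SecondMoment

/-- Remove from each event its overlaps with the others, of total measure at most mτ. The remainders
are disjoint and have total measure at most 1. -/
theorem sum_measure_le_one_add {Ω : Type*} [MeasurableSpace Ω] (P : Measure Ω)
    [IsProbabilityMeasure P] {m : ℕ} {E : Fin m → Set Ω} (hE : ∀ i, MeasurableSet (E i))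
    {τ : ℝ≥0∞} (hτ : ∀ i j, i ≠ j → P (E i ∩ E j) ≤ τ) :
    ∑ i, P (E i) ≤ 1 + m * m * τ := by
  let D : Fin m → Set Ω := fun i => ⋃ j ∈ ({i}ᶜ : Set (Fin m)), E i ∩ E j
  have hD : ∀ i, P (D i) ≤ m * τ := by
    intro i
    calc P (D i) ≤ ∑ j, τ := by
          refine (measure_mono (t := ⋃ j, if j = i then ∅ else E i ∩ E j) ?_).trans
            ((measure_iUnion_fintype_le _ _).trans (Finset.sum_le_sum fun j _ => ?_))
          · refine Set.iUnion₂_subset fun j hj => ?_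
            refine Set.subset_iUnion_of_subset j ?_
            rw [if_neg (by simpa using hj)]
          · split_ifs with h
            · simp
            · exact hτ i j (Ne.symm h)
      _ = m * τ := by simp
  have hDm : ∀ i, MeasurableSet (D i) := fun i =>
    MeasurableSet.biUnion (Set.to_countable _) fun j _ => (hE i).inter (hE j)
  have hdisj : Pairwise (Function.onFun Disjoint fun i => E i \ D i) := by
    intro i j hij
    refine Set.disjoint_left.2 fun x hx hx' => hx.2 ?_
    exact Set.mem_biUnion (Ne.symm hij : j ∈ ({i}ᶜ : Set (Fin m))) ⟨hx.1, hx'.1⟩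
  calc ∑ i, P (E i) ≤ ∑ i, (P (E i \ D i) + m * τ) := by
        refine Finset.sum_le_sum fun i _ => ?_
        calc P (E i) ≤ P (E i \ D i ∪ D i) :=
              measure_mono fun x hx => by by_cases h : x ∈ D i <;> simp [hx, h]
          _ ≤ P (E i \ D i) + P (D i) := measure_union_le _ _
          _ ≤ _ := by gcongr; exact hD i
    _ = P (⋃ i, E i \ D i) + m * m * τ := by
        rw [Finset.sum_add_distrib, measure_iUnion hdisj fun i => (hE i).diff (hDm i),
          tsum_fintype]
        simp [mul_assoc]
    _ ≤ 1 + m * m * τ := by gcongr; exact prob_le_one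

/-- Amounts to a_n ≤ 1/m + m τ_n. The sequence τ may depend on m, since n tends to infinity before m
is increased. -/
theorem ENNReal.tendsto_zero_of_nat_mul_le {a : ℕ → ℝ≥0∞}
    (h : ∀ m : ℕ, ∃ τ : ℕ → ℝ≥0∞, Tendsto τ atTop (𝓝 0) ∧ ∀ n, m * a n ≤ 1 + m * m * τ n) :
    Tendsto a atTop (𝓝 0) := by
  refine ENNReal.tendsto_nhds_zero.2 fun ε hε => ?_
  obtain ⟨m, hm⟩ := ENNReal.exists_nat_mul_gt hε.ne' (ENNReal.ofNat_ne_top (n := 2))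
  obtain ⟨τ, hτ, hle⟩ := h m
  have hτ' : Tendsto (fun n => (m * m : ℝ≥0∞) * τ n) atTop (𝓝 0) := by
    have := ENNReal.Tendsto.const_mul (a := (m * m : ℝ≥0∞)) hτ
      (Or.inr (ENNReal.mul_ne_top (ENNReal.natCast_ne_top m) (ENNReal.natCast_ne_top m)))
    rwa [mul_zero] at this
  filter_upwards [ENNReal.tendsto_nhds_zero.1 hτ' 1 one_pos] with n hn
  by_contra hlt
  have h2 : m * a n ≤ 2 := (hle n).trans (by rw [← one_add_one_eq_two]; gcongr)
  exact absurd (hm.trans_le ((by gcongr; exact (not_le.1 hlt).le : m * ε ≤ m * a n).trans h2))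
    (lt_irrefl _)

end SecondMoment

/-! ### The event that a random conjugate of a lattice meets a given set -/

section HittingEvent

variable {G : Type*} [Group G]

/-- The cosets `g Γ` such that `g Γ g⁻¹` meets `A`. -/
def hitSet (Γ : Subgroup G) (A : Set G) : Set (G ⧸ Γ) :=
  {x | ∃ γ ∈ Γ, x.out * γ * x.out⁻¹ ∈ A}

variable {Γ : Subgroup G} {A B : Set G}

theorem mk_mem_hitSet {g : G} : (g : G ⧸ Γ) ∈ hitSet Γ A ↔ ∃ γ ∈ Γ, g * γ * g⁻¹ ∈ A := by
  refine iff_of_eq (apply_out_mk (H := Γ) (φ := fun g : G => ∃ γ ∈ Γ, g * γ * g⁻¹ ∈ A)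
    (fun g h => propext ?_) g)
  constructor
  · rintro ⟨γ, hγ, hA⟩
    exact ⟨h * γ * (h : G)⁻¹, Γ.mul_mem (Γ.mul_mem h.2 hγ) (Γ.inv_mem h.2), by
      convert hA using 1; group⟩
  · rintro ⟨γ, hγ, hA⟩
    exact ⟨(h : G)⁻¹ * γ * h, Γ.mul_mem (Γ.mul_mem (Γ.inv_mem h.2) hγ) h.2, by
      convert hA using 1; group⟩

theorem hitSet_mono (h : A ⊆ B) : hitSet Γ A ⊆ hitSet Γ B := fun _ ⟨γ, hγ, hA⟩ => ⟨γ, hγ, h hA⟩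

theorem hitSet_union : hitSet Γ (A ∪ B) = hitSet Γ A ∪ hitSet Γ B := by
  ext x
  constructor
  · rintro ⟨γ, hγ, hA | hB⟩
    · exact Or.inl ⟨γ, hγ, hA⟩
    · exact Or.inr ⟨γ, hγ, hB⟩
  · rintro (⟨γ, hγ, hA⟩ | ⟨γ, hγ, hB⟩)
    · exact ⟨γ, hγ, Or.inl hA⟩
    · exact ⟨γ, hγ, Or.inr hB⟩

theorem hitSet_empty : hitSet Γ (∅ : Set G) = ∅ := by
  ext x
  simp [hitSet]

theorem hitSet_conj (g : G) :
    hitSet Γ {k | g⁻¹ * k * g ∈ A} = (fun x : G ⧸ Γ => g⁻¹ • x) ⁻¹' hitSet Γ A := by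
  ext x
  induction x using QuotientGroup.induction_on with
  | H y =>
    change (y : G ⧸ Γ) ∈ hitSet Γ _ ↔ ((g⁻¹ * y : G) : G ⧸ Γ) ∈ hitSet Γ A
    rw [mk_mem_hitSet, mk_mem_hitSet]
    refine exists_congr fun γ => and_congr_right fun _ => ?_
    rw [Set.mem_ofPred_eq]
    have e : g⁻¹ * (y * γ * y⁻¹) * g = g⁻¹ * y * γ * (g⁻¹ * y)⁻¹ := by group
    rw [e]

variable [TopologicalSpace G] [IsTopologicalGroup G] [T2Space G]
  [LocallyCompactSpace G] [SecondCountableTopology G] [MeasurableSpace G] [BorelSpace G]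

theorem measurableSet_hitSet (hA : IsOpen A) : MeasurableSet (hitSet Γ A) := by
  refine measurableSet_quotient.2 (IsOpen.measurableSet ?_)
  have e : (Quotient.mk'' ⁻¹' hitSet Γ A : Set G) = ⋃ γ ∈ Γ, (fun g => g * γ * g⁻¹) ⁻¹' A := by
    ext g
    refine mk_mem_hitSet.trans ?_
    simp
  rw [e]
  exact isOpen_biUnion fun γ _ => hA.preimage (by fun_prop)

namespace IsLattice

/-- Translating the coset by g⁻¹ conjugates the random subgroup, and the probability measure is
invariant. -/
theorem measure_hitSet_conj (hΓ : IsLattice Γ) (hA : IsOpen A) (g : G) :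
    hΓ.invariantProbability (hitSet Γ {k | g⁻¹ * k * g ∈ A}) =
      hΓ.invariantProbability (hitSet Γ A) := by
  have hinv : SMulInvariantMeasure G (G ⧸ Γ) hΓ.invariantProbability :=
    hΓ.exists_invariant.choose_spec.2
  rw [hitSet_conj]
  exact hinv.measure_preimage_smul _ (measurableSet_hitSet hA)

/-- Markov's inequality for the number of elements in A. The measurable S stands in for `hitSet Γ
A`, as A is not assumed open. -/
theorem measure_le_lintegral_tsum_conj (hΓ : IsLattice Γ) {p : G → Prop}
    (hp : ∀ g γ, p (g * γ * g⁻¹) → p γ) {f : G → ℝ≥0∞} (hA : ∀ k ∈ A, p k ∧ 1 ≤ f k)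
    {S : Set (G ⧸ Γ)} (hS : MeasurableSet S) (hSA : S ⊆ hitSet Γ A) :
    hΓ.invariantProbability S ≤ ∫⁻ x, ∑' γ : {γ : Γ // p γ},
      f (x.out * (γ.1 : G) * x.out⁻¹) ∂hΓ.invariantProbability := by
  rw [← lintegral_indicator_one hS]
  refine lintegral_mono fun x => ?_
  by_cases hx : x ∈ S
  · obtain ⟨γ, hγ, hk⟩ := hSA hx
    rw [Set.indicator_of_mem hx, Pi.one_apply]
    exact (hA _ hk).2.trans
      (ENNReal.le_tsum (f := fun γ : {γ : Γ // p γ} => f (x.out * (γ.1 : G) * x.out⁻¹))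
        ⟨⟨γ, hγ⟩, hp _ _ (hA _ hk).1⟩)
  · rw [Set.indicator_of_notMem hx]
    exact zero_le

/-- If any two of the sets `g i * V * (g i)⁻¹` have products in `A`, then a lattice all of whose
random conjugates rarely meet `A` also rarely meets `V`. -/
theorem nat_mul_measure_hitSet_le (hΓ : IsLattice Γ) {V : Set G} (hV : IsOpen V) {m : ℕ}
    (g : Fin m → G) (hg : ∀ i j, i ≠ j → ∀ k ∈ V, ∀ k' ∈ V,
      (g i * k * (g i)⁻¹) * (g j * k' * (g j)⁻¹) ∈ A) {τ : ℝ≥0∞}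
    (hτ : ∀ S, MeasurableSet S → S ⊆ hitSet Γ A → hΓ.invariantProbability S ≤ τ) :
    m * hΓ.invariantProbability (hitSet Γ V) ≤ 1 + m * m * τ := by
  let W : Fin m → Set G := fun i => {k | (g i)⁻¹ * k * g i ∈ V}
  have hW : ∀ i, IsOpen (W i) := fun i => hV.preimage (by fun_prop)
  have hsum : ∑ i, hΓ.invariantProbability (hitSet Γ (W i)) =
      m * hΓ.invariantProbability (hitSet Γ V) := by
    simp only [W, hΓ.measure_hitSet_conj hV]
    simp
  rw [← hsum]
  refine sum_measure_le_one_add _ (fun i => measurableSet_hitSet (hW i)) fun i j hij => ?_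
  refine hτ _ ((measurableSet_hitSet (hW i)).inter (measurableSet_hitSet (hW j))) ?_
  -- A subgroup meeting both conjugates contains the product of the two elements found, which lies
  -- in A.
  rintro x ⟨⟨γ, hγ, hk⟩, γ', hγ', hk'⟩
  refine ⟨γ * γ', Γ.mul_mem hγ hγ', ?_⟩
  convert hg i j hij _ hk _ hk' using 1
  group

theorem irs_apply (hΓ : IsLattice Γ) {S : Set (ClosedSubgroup G)} (hS : MeasurableSet S) :
    (hΓ.irs : Measure (ClosedSubgroup G)) S = hΓ.invariantProbability (hΓ.conjMap ⁻¹' S) :=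
  Measure.map_apply hΓ.measurable_conjMap hS

theorem conjMap_inter_nonempty_iff (hΓ : IsLattice Γ) (x : G ⧸ Γ) :
    (((hΓ.conjMap x).toSubgroup : Set G) ∩ A).Nonempty ↔ x ∈ hitSet Γ A := by
  induction x using QuotientGroup.induction_on with
  | H g =>
    rw [mk_mem_hitSet]
    change (((conjClosedSubgroup hΓ.toClosedSubgroup g).toSubgroup : Set G) ∩ A).Nonempty ↔ _
    constructor
    · rintro ⟨k, hk, hA⟩
      exact ⟨g⁻¹ * k * g, mem_conjClosedSubgroup.1 hk, by convert hA using 1; group⟩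
    · rintro ⟨γ, hγ, hA⟩
      refine ⟨g * γ * g⁻¹, mem_conjClosedSubgroup.2 ?_, hA⟩
      have e : g⁻¹ * (g * γ * g⁻¹) * g = γ := by group
      rw [e]
      exact hγ

end IsLattice

theorem mem_trivialClosedSubgroup {k : G} :
    k ∈ (trivialClosedSubgroup G).toSubgroup ↔ k = 1 := Subgroup.mem_bot

/-- If the random conjugates of the lattices `Γ n` rarely meet any given compact set which does not
contain `1`, then the invariant random subgroups converge to the trivial one. -/
theorem tendsto_irs_of_tendsto_measure_hitSet {Γ : ℕ → Subgroup G} (hΓ : ∀ n, IsLattice (Γ n))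
    (h : ∀ K : Set G, IsCompact K → (1 : G) ∉ K →
      Tendsto (fun n => (hΓ n).invariantProbability (hitSet (Γ n) K)) atTop (𝓝 0)) :
    Tendsto (fun n => (hΓ n).irs) atTop (𝓝 (trivialIRS G)) := by
  have hnhds : ∀ S ∈ 𝓝 (trivialClosedSubgroup G),
      Tendsto (fun n => (hΓ n).invariantProbability ((hΓ n).conjMap ⁻¹' S)ᶜ) atTop (𝓝 0) := by
    -- Sets of asymptotic probability 1 form a filter, so only subbasic Chabauty neighbourhoods need
    -- checking. Those given by open sets are automatic, since every subgroup contains 1.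
    let F : Filter (ClosedSubgroup G) :=
      { sets := {S | Tendsto (fun n => (hΓ n).invariantProbability ((hΓ n).conjMap ⁻¹' S)ᶜ)
          atTop (𝓝 0)}
        univ_sets := by simp
        sets_of_superset := fun {S T} hS hST =>
          tendsto_of_tendsto_of_tendsto_of_le_of_le tendsto_const_nhds hS (fun _ => zero_le)
            fun n => measure_mono (Set.compl_subset_compl.2 (Set.preimage_mono hST))
        inter_sets := fun {S T} hS hT => by
          have := Tendsto.add hS hT
          rw [add_zero] at this
          refine tendsto_of_tendsto_of_tendsto_of_le_of_le tendsto_const_nhds this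
            (fun _ => zero_le) fun n => ?_
          simp only
          rw [Set.preimage_inter, Set.compl_inter]
          exact measure_union_le _ _ }
    suffices hF : F ≤ 𝓝 (trivialClosedSubgroup G) from fun S hS => hF hS
    rw [chabautyTopology, TopologicalSpace.nhds_generateFrom]
    refine le_iInf₂ fun S hS => le_principal_iff.2 ?_
    change Tendsto (fun n => (hΓ n).invariantProbability ((hΓ n).conjMap ⁻¹' S)ᶜ) atTop (𝓝 0)
    obtain ⟨hS1, ⟨U, hU, rfl⟩ | ⟨K, hK, rfl⟩⟩ := hS
    · have h1 : (1 : G) ∈ U := by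
        obtain ⟨k, hk, hkU⟩ := hS1
        rwa [mem_trivialClosedSubgroup.1 hk] at hkU
      refine tendsto_const_nhds.congr fun n => ?_
      have e : ((hΓ n).conjMap ⁻¹' {H | ((H.toSubgroup : Set G) ∩ U).Nonempty})ᶜ = ∅ := by
        rw [Set.compl_empty_iff, Set.eq_univ_iff_forall]
        exact fun x => ⟨1, Subgroup.one_mem _, h1⟩
      rw [e, measure_empty]
    · have h1 : (1 : G) ∉ K := fun hk => by
        have : (1 : G) ∈ (((trivialClosedSubgroup G).toSubgroup : Set G) ∩ K) :=
          ⟨Subgroup.one_mem _, hk⟩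
        rw [hS1] at this
        exact this
      refine (h K hK h1).congr fun n => ?_
      congr 1
      ext x
      rw [← (hΓ n).conjMap_inter_nonempty_iff, Set.nonempty_iff_ne_empty]
      rfl
  refine tendsto_of_forall_isOpen_le_liminf_nat' fun O hO => ?_
  by_cases h1 : trivialClosedSubgroup G ∈ O
  · have h2 := hnhds O (hO.mem_nhds h1)
    have h3 : Tendsto (fun n => ((hΓ n).irs : Measure (ClosedSubgroup G)) O) atTop (𝓝 1) := by
      have := ENNReal.Tendsto.sub (tendsto_const_nhds (x := (1 : ℝ≥0∞))) h2
        (Or.inl ENNReal.one_ne_top)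
      rw [tsub_zero] at this
      refine this.congr fun n => ?_
      have hm := (hΓ n).measurable_conjMap hO.measurableSet
      rw [(hΓ n).irs_apply hO.measurableSet, ← prob_compl_eq_one_sub hm.compl, compl_compl]
    rw [h3.liminf_eq]
    exact prob_le_one
  · have h0 : ((trivialIRS G : ProbabilityMeasure _) : Measure (ClosedSubgroup G)) O = 0 := by
      change Measure.dirac (trivialClosedSubgroup G) O = 0
      rw [Measure.dirac_apply' _ hO.measurableSet, Set.indicator_of_notMem h1]
    rw [h0]
    exact zero_le

end HittingEvent

/-! ### Benjamini–Schramm convergence and the limiting argument -/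

section BenjaminiSchrammLimit

variable {X : Type*} [MetricSpace X]

theorem IsHyperbolicIsometry.of_conj {g γ : X ≃ᵢ X} (h : IsHyperbolicIsometry (g * γ * g⁻¹)) :
    IsHyperbolicIsometry γ := by
  intro x
  obtain ⟨c, hc, C, hC⟩ := h (g x)
  refine ⟨c, hc, C, fun n => (hC n).trans_eq ?_⟩
  rw [conj_zpow, IsometryEquiv.mul_apply, IsometryEquiv.mul_apply, IsometryEquiv.inv_apply_self,
    g.dist_eq]

/-- If all elements of `Γ` which move `z` by a bounded amount are close to the identity on the
`R`-ball around `z`, then the `R`-balls in `Γ \ X` and in `X` are close. -/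
theorem pointedGHClose_of_forall_dist_lt {Γ : Subgroup (X ≃ᵢ X)} {R ε : ℝ} (hR : 0 < R)
    (hε : 0 < ε) (g : X ≃ᵢ X) {z : X}
    (h : ∀ γ ∈ Γ, dist z (γ z) ≤ 4 * R + ε → ∀ x, dist z x ≤ R → dist x (γ x) < ε / 2) :
    PointedGHClose R ε (QuotientSpace.mk Γ z) (g z) := by
  have hlift : ∀ p : Metric.ball (QuotientSpace.mk Γ z) R, ∃ y : X,
      QuotientSpace.mk Γ y = p ∧ dist z y < R ∧ ((p : QuotientSpace Γ) = .mk Γ z → y = z) := by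
    rintro ⟨p, hp⟩
    by_cases hpz : p = .mk Γ z
    · exact ⟨z, hpz.symm, by simpa using hR, fun _ => rfl⟩
    · obtain ⟨y, hy, hd⟩ := QuotientSpace.exists_lt z p (r := R) (by
        rw [Metric.mem_ball, dist_comm] at hp
        exact hp)
      exact ⟨y, hy, hd, fun e => absurd e hpz⟩
  choose y hy hyR hyz using hlift
  refine ⟨fun p => g (y p), fun p hp => congrArg g (hyz p hp), fun p q => ?_, fun w hw => ?_⟩
  · rw [g.dist_eq]
    have h1 : dist (p : QuotientSpace Γ) q ≤ dist (y p) (y q) := by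
      rw [← hy p, ← hy q]
      exact QuotientSpace.orbitDist_le _ _
    obtain ⟨w, hw, hd⟩ := QuotientSpace.exists_lt (y p) (q : QuotientSpace Γ)
      (r := dist (p : QuotientSpace Γ) q + ε / 2) (by
        rw [hy p, ← QuotientSpace.dist_def]
        linarith)
    rw [← hy q] at hw
    obtain ⟨γ, hγ, rfl⟩ := QuotientSpace.mk_eq.1 hw
    have h2 := dist_triangle (y p) z (y q)
    rw [dist_comm (y p) z] at h2
    have h3 := dist_triangle4 z (y p) (γ (y q)) (γ z)
    rw [γ.dist_eq, dist_comm (y q) z] at h3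
    -- Here γ y_q is an almost nearest lift of q to y_p. It moves z by at most 2R plus d(p, q) +
    -- ε/2, and d(p, q) < 2R, whence the bound 4R + ε; so γ y_q is ε/2-close to y_q.
    have h4 := h γ hγ (by linarith [hyR p, hyR q]) (y q) (hyR q).le
    have h5 := dist_triangle (y p) (γ (y q)) (y q)
    rw [dist_comm (γ (y q))] at h5
    rw [abs_lt]
    constructor <;> linarith
  · have hx : dist z (g⁻¹ w) < R - ε := by
      rw [← g.dist_eq, IsometryEquiv.apply_inv_self, dist_comm]
      exact hw
    let p : Metric.ball (QuotientSpace.mk Γ z) R := ⟨.mk Γ (g⁻¹ w), by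
      rw [Metric.mem_ball, dist_comm]
      exact (QuotientSpace.orbitDist_le _ _).trans_lt (by linarith)⟩
    refine ⟨p, ?_⟩
    obtain ⟨γ, hγ, hγw⟩ := QuotientSpace.mk_eq.1 (hy p)
    have h3 := dist_triangle z (y p) (γ z)
    rw [← hγw, γ.dist_eq, dist_comm (g⁻¹ w), hγw] at h3
    have h4 := h γ hγ (by linarith [hyR p]) (g⁻¹ w) (by linarith)
    rw [hγw, ← g.dist_eq, IsometryEquiv.apply_inv_self, dist_comm] at h4
    linarith

variable [ProperSpace X]

/-- The compact set of elements which spoil the comparison of R-balls. Closedness comes from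
projecting a closed set along the compact ball. -/
theorem isCompact_setOf_exists_le_dist (o : X) (r R ε : ℝ) :
    IsCompact {k : X ≃ᵢ X | dist o (k o) ≤ r ∧ ∃ x ∈ Metric.closedBall o R, ε ≤ dist x (k x)} := by
  refine (isCompact_setOf_dist_le o r).of_isClosed_subset ?_ fun k hk => hk.1
  refine (isClosed_setOf_dist_le o r).inter ?_
  have hc : Continuous fun p : (X ≃ᵢ X) × Metric.closedBall o R => dist (p.2 : X) (p.1 p.2) :=
    (continuous_subtype_val.comp continuous_snd).dist
      ((IsometryEquiv.continuous_toContinuousMap.comp continuous_fst).eval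
        (continuous_subtype_val.comp continuous_snd))
  have : CompactSpace (Metric.closedBall o R) :=
    isCompact_iff_compactSpace.1 (isCompact_closedBall o R)
  have e : {k : X ≃ᵢ X | ∃ x ∈ Metric.closedBall o R, ε ≤ dist x (k x)} =
      Prod.fst '' {p : (X ≃ᵢ X) × Metric.closedBall o R | ε ≤ dist (p.2 : X) (p.1 p.2)} := by
    ext k
    constructor
    · rintro ⟨x, hx, hk⟩
      exact ⟨(k, ⟨x, hx⟩), hk, rfl⟩
    · rintro ⟨⟨k, x⟩, hk, rfl⟩
      exact ⟨x, x.2, hk⟩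
  change IsClosed {k : X ≃ᵢ X | ∃ x ∈ Metric.closedBall o R, ε ≤ dist x (k x)}
  rw [e]
  exact isClosedMap_fst_of_compactSpace _ (isClosed_le continuous_const hc)

theorem benjaminiSchrammConverges_of_tendsto_measure_hitSet {Γ : ℕ → Subgroup (X ≃ᵢ X)}
    (hΓ : ∀ n, IsLattice (Γ n))
    (h : ∀ K : Set (X ≃ᵢ X), IsCompact K → (1 : X ≃ᵢ X) ∉ K →
      Tendsto (fun n => (hΓ n).invariantProbability (hitSet (Γ n) K)) atTop (𝓝 0)) :
    BenjaminiSchrammConverges Γ hΓ := by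
  intro o R ε hR hε
  refine tendsto_of_tendsto_of_tendsto_of_le_of_le tendsto_const_nhds
    (h _ (isCompact_setOf_exists_le_dist o (4 * R + ε) R (ε / 2)) ?_) (fun _ => zero_le)
    fun n => measure_mono ?_
  · rintro ⟨-, x, -, hx⟩
    have : dist x ((1 : X ≃ᵢ X) x) = 0 := dist_self x
    linarith
  · intro x
    induction x using QuotientGroup.induction_on with
    | H g =>
      contrapose!
      intro hx
      rw [mk_mem_hitSet] at hx
      push Not at hx
      rw [Set.mem_ofPred_eq, not_not]
      have key := pointedGHClose_of_forall_dist_lt (Γ := Γ n) (z := g⁻¹ o) hR hε g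
        fun γ hγ hd w hw => ?_
      · rw [IsometryEquiv.apply_inv_self] at key
        exact key
      · by_contra hlt
        refine hx γ hγ ⟨?_, g w, ?_, ?_⟩
        · rw [IsometryEquiv.mul_apply, IsometryEquiv.mul_apply, ← (g⁻¹).dist_eq,
            IsometryEquiv.inv_apply_self]
          exact hd
        · rw [Metric.mem_closedBall, dist_comm, ← (g⁻¹).dist_eq, IsometryEquiv.inv_apply_self]
          exact hw
        · rw [IsometryEquiv.mul_apply, IsometryEquiv.mul_apply, IsometryEquiv.inv_apply_self,
            g.dist_eq]
          exact not_lt.1 hlt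

theorem exists_one_le_of_isCompact {G : Type*} [TopologicalSpace G] [T2Space G]
    [LocallyCompactSpace G] {K : Set G} (hK : IsCompact K) :
    ∃ f : C_c(G, ℝ≥0), ∀ k ∈ K, 1 ≤ f k := by
  obtain ⟨f, hf, -, hfc, -⟩ :=
    exists_continuous_one_zero_of_isCompact hK isClosed_empty (Set.disjoint_empty K)
  refine ⟨CompactlySupportedContinuousMap.nnrealPart ⟨f, hfc⟩, fun k hk => ?_⟩
  rw [CompactlySupportedContinuousMap.nnrealPart_apply]
  change 1 ≤ Real.toNNReal (f k)
  rw [hf hk]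
  simp

/-- The local claim, where ping-pong, unfolding and the second moment estimate meet. -/
theorem exists_nhds_tendsto_measure_hitSet {δ : ℝ} (hX : FourPoint X δ) (hne : IsNonElementary X)
    (hrad : ellipticRadical X = ⊥) (μ : Measure (X ≃ᵢ X)) [μ.IsHaarMeasure]
    (η : ∀ γ : X ≃ᵢ X, Measure (centraliser γ)) [∀ γ, (η γ).IsHaarMeasure]
    {Γ : ℕ → Subgroup (X ≃ᵢ X)} (hΓ : ∀ n, IsLattice (Γ n))
    (hsum : ∀ f : C_c(X ≃ᵢ X, ℝ≥0),
      Tendsto (fun n => hyperbolicSum μ η (Γ n) (fun g => (f g : ℝ≥0∞)) /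
        covolume (Γ n) (X ≃ᵢ X) μ) atTop (𝓝 0)) {k₀ : X ≃ᵢ X} (hk₀ : k₀ ≠ 1) :
    ∃ V ∈ 𝓝 k₀,
      Tendsto (fun n => (hΓ n).invariantProbability (hitSet (Γ n) V)) atTop (𝓝 0) := by
  obtain ⟨o, s, hs, hst⟩ := hne
  have hμ : μ.IsMulRightInvariant := (hΓ 0).isMulRightInvariant μ
  obtain ⟨V, hVo, hkV, ⟨R, hR⟩, hV⟩ := exists_nhds_conj_isHyperbolicIsometry hX hrad hs hst
    (fun a B ha hfix => ha.same_inv_of_forall_same hX μ hfix) hk₀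
  refine ⟨V, hVo.mem_nhds hkV, ENNReal.tendsto_zero_of_nat_mul_le fun m => ?_⟩
  obtain ⟨g, hg⟩ := hV m
  set D := ∑ i, dist o (g i o)
  have hD : ∀ i, dist o (g i o) ≤ D := fun i =>
    Finset.single_le_sum (f := fun i => dist o (g i o)) (fun _ _ => dist_nonneg)
      (Finset.mem_univ i)
  have hconj : ∀ i, ∀ k ∈ V, dist o ((g i * k * (g i)⁻¹) o) ≤ 2 * D + R := by
    intro i k hk
    have h1 := dist_mul_apply_le (g i * k) (g i)⁻¹ o
    have h2 := dist_mul_apply_le (g i) k o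
    rw [dist_self_inv_apply] at h1
    linarith [hR k hk, hD i]
  -- The test function dominates the indicator of the compact set containing all products of the m
  -- conjugates. It depends on m, hence so does the error term.
  obtain ⟨f, hf⟩ := exists_one_le_of_isCompact (isCompact_setOf_dist_le o (2 * (2 * D + R)))
  refine ⟨_, hsum f, fun n => ?_⟩
  refine (hΓ n).nat_mul_measure_hitSet_le hVo g
    (A := {k | IsHyperbolicIsometry k ∧ dist o (k o) ≤ 2 * (2 * D + R)})
    (fun i j hij k hk k' hk' => ⟨hg i j hij k hk k' hk', ?_⟩) fun S hS hSA => ?_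
  · have h1 := dist_mul_apply_le (g i * k * (g i)⁻¹) (g j * k' * (g j)⁻¹) o
    linarith [hconj i k hk, hconj j k' hk']
  · refine ((hΓ n).measure_le_lintegral_tsum_conj (p := IsHyperbolicIsometry)
      (f := fun g => (f g : ℝ≥0∞)) (fun _ _ h => h.of_conj) (fun k hk => ⟨hk.1, ?_⟩) hS hSA).trans
      ((hΓ n).lintegral_tsum_conj_le μ η (fun _ _ h => h.of_conj)
        (fun γ hγ => hγ.isMulRightInvariant_centraliser hX o (η γ)) ?_)
    · exact_mod_cast hf k hk.2
    · exact (ENNReal.continuous_coe.comp f.continuous).measurable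

theorem tendsto_measure_hitSet_of_isCompact {δ : ℝ} (hX : FourPoint X δ) (hne : IsNonElementary X)
    (hrad : ellipticRadical X = ⊥) (μ : Measure (X ≃ᵢ X)) [μ.IsHaarMeasure]
    (η : ∀ γ : X ≃ᵢ X, Measure (centraliser γ)) [∀ γ, (η γ).IsHaarMeasure]
    {Γ : ℕ → Subgroup (X ≃ᵢ X)} (hΓ : ∀ n, IsLattice (Γ n))
    (hsum : ∀ f : C_c(X ≃ᵢ X, ℝ≥0),
      Tendsto (fun n => hyperbolicSum μ η (Γ n) (fun g => (f g : ℝ≥0∞)) /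
        covolume (Γ n) (X ≃ᵢ X) μ) atTop (𝓝 0)) {K : Set (X ≃ᵢ X)} (hK : IsCompact K)
    (h1 : (1 : X ≃ᵢ X) ∉ K) :
    Tendsto (fun n => (hΓ n).invariantProbability (hitSet (Γ n) K)) atTop (𝓝 0) := by
  -- Having vanishing hitting probability passes to subsets and finite unions, so the local claim at
  -- each point of K suffices.
  refine hK.induction_on
    (p := fun A => Tendsto (fun n => (hΓ n).invariantProbability (hitSet (Γ n) A)) atTop (𝓝 0))
    ?_ ?_ ?_ ?_
  · simp [hitSet_empty]
  · intro A B hAB hB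
    exact tendsto_of_tendsto_of_tendsto_of_le_of_le tendsto_const_nhds hB (fun _ => zero_le)
      fun n => measure_mono (hitSet_mono hAB)
  · intro A B hA hB
    have := hA.add hB
    rw [add_zero] at this
    refine tendsto_of_tendsto_of_tendsto_of_le_of_le tendsto_const_nhds this (fun _ => zero_le)
      fun n => ?_
    simp only
    rw [hitSet_union]
    exact measure_union_le _ _
  · intro k hk
    obtain ⟨V, hV, hlim⟩ := exists_nhds_tendsto_measure_hitSet hX hne hrad μ η hΓ hsum
      (k₀ := k) fun e => h1 (e ▸ hk)
    exact ⟨V, mem_nhdsWithin_of_mem_nhds hV, hlim⟩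

end BenjaminiSchrammLimit

theorem mainTheorem4 {X : Type*} [MetricSpace X] [ProperSpace X]
    (hX : IsGromovHyperbolic X) (hne : IsNonElementary X) (hrad : ellipticRadical X = ⊥)
    (μ : Measure (X ≃ᵢ X)) [μ.IsHaarMeasure]
    (η : ∀ γ : X ≃ᵢ X, Measure (centraliser γ)) [∀ γ, (η γ).IsHaarMeasure]
    (Γ : ℕ → Subgroup (X ≃ᵢ X)) (hΓ : ∀ n, IsLattice (Γ n))
    (hsum : ∀ f : C_c(X ≃ᵢ X, ℝ≥0),
      Tendsto (fun n => hyperbolicSum μ η (Γ n) (fun g => (f g : ℝ≥0∞)) /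
        covolume (Γ n) (X ≃ᵢ X) μ) atTop (𝓝 0)) :
    Tendsto (fun n => (hΓ n).irs) atTop (𝓝 (trivialIRS (X ≃ᵢ X))) ∧
      BenjaminiSchrammConverges Γ hΓ := by
  obtain ⟨δ, hδ⟩ := hX
  have key := fun K hK h1 => tendsto_measure_hitSet_of_isCompact (δ := δ) hδ hne hrad μ η hΓ hsum
    (K := K) hK h1
  exact ⟨tendsto_irs_of_tendsto_measure_hitSet hΓ key,
    benjaminiSchrammConverges_of_tendsto_measure_hitSet hΓ key⟩
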